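/- Let $\mathbb K=\mathbb R$ or $\mathbb C$. Write functions on $\mathbb R^{1|1}$ as $F=f_0(x)+f_1(x)\theta$ with $f_i\in C^\infty(\mathbb R,\mathbb K)$, $\theta^2=0$, and put $\eta=\partial_\theta+\theta\partial_x$, $\bar\eta=\partial_\theta-\theta\partial_x$. For a function $G$ let $X_G=G\partial_x+\frac12\eta(G)\bar\eta$, and let $X_G^\lambda=X_G+\lambda G'$ be its action on densities of weight $\lambda\in\mathbb R$. Let $\mathfrak{osp}(1|2)$ be the real Lie superalgebra with even basis vectors $H=-X_x$, $X=X_1$, $Y=-X_{x^2}$ and odd basis vectors $A=2X_\theta$, $B=-2X_{x\theta}$. Its brackets are $[H,X]=X$, $[H,Y]=-Y$, $[X,Y]=2H$, $[H,A]=\frac12A$, $[X,A]=0$, $[Y,A]=-B$, $[H,B]=-\frac12B$, $[X,B]=-A$, $[Y,B]=0$, $[A,A]=2X$, $[A,B]=2H$, $[B,B]=-2Y$. For $\lambda,\mu\in\mathbb R$ let $\mathfrak D_{\lambda,\mu}$ be the $\mathbb K$-vector space of differential operators on $\mathbb R^{1|1}$ (finite sums of terms $F\partial_\theta^{\epsilon}\partial_x^{k}$),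 regarded as operators from densities of weight $\lambda$ to densities of weight $\mu$. It is $\mathbb Z_2$-graded by parity of operators, and it is an $\mathfrak{osp}(1|2)$-module for $X_G\cdot T=X_G^\mu\circ T-(-1)^{TG}\,T\circ X_G^\lambda$. The coefficients $F$ may be either all smooth functions or all polynomials in $x,\theta$; the statement holds in both cases. Let $C^n$ be the $\mathbb K$-space of $n$-linear graded antisymmetric maps $f:\mathfrak{osp}(1|2)^n\to\mathfrak D_{\lambda,\mu}$, with coboundary operator given on homogeneous $f$ and homogeneous arguments by $$\begin{aligned}(\partial f)(U_0,\dots,U_n)=&\sum_{i}(-1)^{i+U_i(f+U_0+\cdots+U_{i-1})}\,U_i\cdot f(U_0,\dots,\hat\imath,\dots,U_n)\\&+\sum_{i<j}(-1)^{i+j+U_i(U_0+\cdots+U_{i-1})+U_j(U_0+\cdots+\hat\imath+\cdots+U_{j-1})}f([U_i,U_j],U_0,\dots,\hat\imath,\dots,\hat\jmath,\dots,U_n),\end{aligned}$$ and let $\mathrm H^n=\ker(\partial|_{C^n})/\partial(C^{n-1})$. Then, with $k$ ranging over $\{0,1,2,\dots\}$: (i) $\dim_{\mathbb K}\mathrm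 H^0=1$ if $\lambda=\mu$ or if $(\lambda,\mu)=(-\frac k2,\frac{k+1}2)$ for some $k$, and $0$ otherwise. (ii) $\dim_{\mathbb K}\mathrm H^1=1$ if $\lambda=\mu$, $2$ if $(\lambda,\mu)=(-\frac k2,\frac{k+1}2)$ for some $k$, and $0$ otherwise. (iii) $\dim_{\mathbb K}\mathrm H^2=1$ if $(\lambda,\mu)=(-\frac k2,\frac{k+1}2)$ for some $k$, and $0$ otherwise. (iv) $\mathrm H^n=0$ for all $n>2$. Moreover, call an $n$-cochain $f$ ($n\ge1$) reduced if $f(A,U_2,\dots,U_n)=0$ for all $U_2,\dots,U_n\in\{A,H,B,Y\}$. If $\lambda=\mu$, then $\mathrm H^0$ is spanned by the identity, and $\mathrm H^1$ by the class of the reduced 1-cocycle $h$ with $$h(X)=h(A)=0,\quad h(H)=-1,\quad h(B)=-2\theta,\quad h(Y)=-2x.$$ If $(\lambda,\mu)=(-\frac k2,\frac{k+1}2)$, put $\delta_k=\partial_\theta\partial_x^k-\theta\partial_x^{k+1}$. Then $\mathrm H^0$ is spanned by $\delta_k$, and $\mathrm H^1$ by the classes of the reduced 1-cocycles $f_k,\tilde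 f_k$ with $$f_k(X)=f_k(A)=0,\quad f_k(H)=\delta_k,\quad f_k(B)=-2\theta\partial_\theta\partial_x^k,\quad f_k(Y)=2x\,\delta_k,$$ $$\tilde f_k(X)=\tilde f_k(A)=\tilde f_k(H)=0,\quad \tilde f_k(B)=-2\partial_x^k,\quad \tilde f_k(Y)=-2k\,\partial_\theta\partial_x^{k-1}+2(k+1)\,\theta\partial_x^k$$ (the first term of $\tilde f_k(Y)$ being $0$ for $k=0$). Finally, $\mathrm H^2$ is spanned by the class of the reduced 2-cocycle $\Omega_k(U,V)=f_k(U)\circ h(V)-(-1)^{UV}f_k(V)\circ h(U)$ ($U,V$ homogeneous). -/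

import Mathlib

open scoped ContDiff

noncomputable section

set_option linter.unusedSectionVars false

namespace OspCohomology

/-! ### The real Lie superalgebra `osp(1|2)` -/

/-- The homogeneous basis `(H, X, Y, A, B)` of `osp(1|2)`. -/
inductive OspBasis
  | H | X | Y | A | B
  deriving DecidableEq

instance : Fintype OspBasis := ⟨{.H, .X, .Y, .A, .B}, by intro b; cases b <;> simp⟩

/-- The parity of the basis vectors: `H, X, Y` are even, `A, B` are odd. -/
def OspBasis.parity : OspBasis → ℕ
  | .H => 0
  | .X => 0
  | .Y => 0
  | .A => 1
  | .B => 1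

/-- The underlying real vector space of `osp(1|2)`, in coordinates with respect to
`(H, X, Y, A, B)`. -/
abbrev Osp : Type := OspBasis → ℝ

/-- A basis vector, as an element of `osp(1|2)`. -/
def Osp.e (b : OspBasis) : Osp := Pi.single b 1

/-- The bracket of two basis vectors. -/
def Osp.bracketBasis : OspBasis → OspBasis → Osp
  | .H, .X => Osp.e .X
  | .X, .H => -Osp.e .X
  | .H, .Y => -Osp.e .Y
  | .Y, .H => Osp.e .Y
  | .X, .Y => (2 : ℝ) • Osp.e .H
  | .Y, .X => (-2 : ℝ) • Osp.e .H
  | .H, .A => (1 / 2 : ℝ) • Osp.e .A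
  | .A, .H => (-1 / 2 : ℝ) • Osp.e .A
  | .H, .B => (-1 / 2 : ℝ) • Osp.e .B
  | .B, .H => (1 / 2 : ℝ) • Osp.e .B
  | .Y, .A => -Osp.e .B
  | .A, .Y => Osp.e .B
  | .X, .B => -Osp.e .A
  | .B, .X => Osp.e .A
  | .A, .A => (2 : ℝ) • Osp.e .X
  | .A, .B => (2 : ℝ) • Osp.e .H
  | .B, .A => (2 : ℝ) • Osp.e .H
  | .B, .B => (-2 : ℝ) • Osp.e .Y
  | .H, .H => 0
  | .X, .X => 0
  | .Y, .Y => 0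
  | .X, .A => 0
  | .A, .X => 0
  | .Y, .B => 0
  | .B, .Y => 0

/-- The homogeneous component of `osp(1|2)` of parity `p`. -/
def Osp.grade (p : ℕ) : Submodule ℝ Osp :=
  Submodule.span ℝ (Osp.e '' {b | b.parity = p})

/-! ### Modules over `osp(1|2)` and their cohomology -/

/-- A `ℤ/2`-graded `osp(1|2)`-module structure on the `𝕜`-vector space `M`. The grading is given
by its involution `sign` (`1` on even vectors, `-1` on odd vectors), the action by the operators
of the basis vectors. -/
structure OspModule (𝕜 M : Type*) [RCLike 𝕜] [AddCommGroup M] [Module 𝕜 M] where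
  sign : M →ₗ[𝕜] M
  sign_sign : ∀ m, sign (sign m) = m
  act : OspBasis → M →ₗ[𝕜] M
  act_sign : ∀ b m, act b (sign m) = (-1 : 𝕜) ^ b.parity • sign (act b m)
  act_bracket : ∀ b c m,
    ∑ a, ((Osp.bracketBasis b c a : ℝ) : 𝕜) • act a m =
      act b (act c m) - (-1 : 𝕜) ^ (b.parity * c.parity) • act c (act b m)

/-- The multilinear map on `osp(1|2)ⁿ` with prescribed values on tuples of basis vectors. -/
def ofBasis {M : Type*} [AddCommGroup M] [Module ℝ M] {n : ℕ}
    (v : (Fin n → OspBasis) → M) : MultilinearMap ℝ (fun _ : Fin n => Osp) M :=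
  ∑ κ : Fin n → OspBasis,
    ((MultilinearMap.mkPiAlgebra ℝ (Fin n) ℝ).compLinearMap
      (fun i => LinearMap.proj (κ i))).smulRight (v κ)

theorem ofBasis_apply {M : Type*} [AddCommGroup M] [Module ℝ M] {n : ℕ}
    (v : (Fin n → OspBasis) → M) (U : Fin n → Osp) :
    ofBasis v U = ∑ κ : Fin n → OspBasis, (∏ i, U i (κ i)) • v κ := by
  simp [ofBasis]

theorem ofBasis_e {M : Type*} [AddCommGroup M] [Module ℝ M] {n : ℕ}
    (v : (Fin n → OspBasis) → M) (κ : Fin n → OspBasis) :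
    ofBasis v (fun i => Osp.e (κ i)) = v κ := by
  rw [ofBasis_apply, Finset.sum_eq_single κ]
  · simp [Osp.e]
  · intro κ' _ hne
    obtain ⟨i, hi⟩ := Function.ne_iff.mp hne
    rw [Finset.prod_eq_zero (Finset.mem_univ i), zero_smul]
    simp [Osp.e, hi]
  · simp

theorem ofBasis_add {M : Type*} [AddCommGroup M] [Module ℝ M] {n : ℕ}
    (v w : (Fin n → OspBasis) → M) : ofBasis (v + w) = ofBasis v + ofBasis w := by
  refine MultilinearMap.ext fun U => ?_
  simp [ofBasis_apply, Finset.sum_add_distrib]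

theorem ofBasis_smul {𝕜 M : Type*} [RCLike 𝕜] [AddCommGroup M] [Module 𝕜 M] [Module ℝ M]
    [IsScalarTower ℝ 𝕜 M] {n : ℕ} (a : 𝕜) (v : (Fin n → OspBasis) → M) :
    ofBasis (a • v) = a • ofBasis v := by
  refine MultilinearMap.ext fun U => ?_
  simp [ofBasis_apply, Finset.smul_sum, smul_comm a]

section Cohomology

variable {𝕜 M : Type*} [RCLike 𝕜] [AddCommGroup M] [Module 𝕜 M] [Module ℝ M]
  [IsScalarTower ℝ 𝕜 M]

variable (𝕜 M) in
/-- The space `Cⁿ(osp(1|2), M)` of `n`-cochains: `n`-linear maps that are graded antisymmetric,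
that is, exchanging two neighbouring homogeneous arguments `U`, `V` multiplies the value by
`-(-1)^(UV)`. -/
def cochains (n : ℕ) : Submodule 𝕜 (MultilinearMap ℝ (fun _ : Fin n => Osp) M) where
  carrier := {f | ∀ (U : Fin n → Osp) (p : Fin n → ℕ), (∀ l, U l ∈ Osp.grade (p l)) →
    ∀ i j : Fin n, (i : ℕ) + 1 = j →
      f (U ∘ Equiv.swap i j) = -((-1 : 𝕜) ^ (p i * p j) • f U)}
  add_mem' := by
    intro f g hf hg U p hU i j hij
    simp only [add_apply, hf U p hU i j hij, hg U p hU i j hij, smul_add]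
    abel
  zero_mem' := by
    intro U p hU i j hij
    simp
  smul_mem' := by
    intro a f hf U p hU i j hij
    simp only [smul_apply, hf U p hU i j hij, smul_neg]
    rw [smul_comm]

namespace OspModule

variable (ρ : OspModule 𝕜 M)

/-- The projection of `M` onto the component of parity `q` (modulo `2`). -/
def proj (q : ℕ) : M →ₗ[𝕜] M := (1 / 2 : 𝕜) • (LinearMap.id + (-1 : 𝕜) ^ q • ρ.sign)

/-- The homogeneous component of parity `q` of a multilinear map `f`; it sends
`U₁, …, Uₙ` to the component of parity `q + U₁ + ⋯ + Uₙ` of `f (U₁, …, Uₙ)`. -/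
def component (q : ℕ) {n : ℕ} (f : MultilinearMap ℝ (fun _ : Fin n => Osp) M) :
    MultilinearMap ℝ (fun _ : Fin n => Osp) M :=
  ofBasis fun κ => ρ.proj (q + ∑ i, (κ i).parity) (f fun i => Osp.e (κ i))

/-- The first sum in the coboundary of a cochain `f` that is homogeneous of parity `q`, evaluated
on basis vectors `U₀, …, Uₙ`:
`∑ᵢ (-1)^i (-1)^(Uᵢ (f + U₀ + ⋯ + Uᵢ₋₁)) Uᵢ f(U₀, …, î, …, Uₙ)`. -/
def actionTerm (q : ℕ) {n : ℕ} (f : MultilinearMap ℝ (fun _ : Fin n => Osp) M)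
    (κ : Fin (n + 1) → OspBasis) : M :=
  ∑ i : Fin (n + 1),
    (-1 : 𝕜) ^ ((i : ℕ) + (κ i).parity * (q + ∑ l ∈ Finset.Iio i, (κ l).parity)) •
      ρ.act (κ i) (f fun t => Osp.e (κ (i.succAbove t)))

variable (𝕜) in
/-- The second sum in the coboundary of a cochain, evaluated on basis vectors `U₀, …, Uₙ`:
`∑_{i<j} (-1)^(i+j) (-1)^(Uᵢ (U₀ + ⋯ + Uᵢ₋₁)) (-1)^(Uⱼ (U₀ + ⋯ + î + ⋯ + Uⱼ₋₁))
f([Uᵢ, Uⱼ], U₀, …, î, …, ĵ, …, Uₙ)`.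
For `i < j`, the index `i` of `Fin (m + 1)` stands for the entry `i.castSucc` of `Fin (m + 2)`. -/
def bracketTerm : {n : ℕ} → MultilinearMap ℝ (fun _ : Fin n => Osp) M →
    (Fin (n + 1) → OspBasis) → M
  | 0, _, _ => 0
  | m + 1, f, κ =>
    ∑ j : Fin (m + 2), ∑ i : Fin (m + 1) with i.castSucc < j,
      (-1 : 𝕜) ^ ((i : ℕ) + (j : ℕ)
          + (κ i.castSucc).parity * ∑ l ∈ Finset.Iio i.castSucc, (κ l).parity
          + (κ j).parity * ∑ l ∈ (Finset.Iio j).erase i.castSucc, (κ l).parity) •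
        f (Fin.cons (Osp.bracketBasis (κ i.castSucc) (κ j))
          fun t : Fin m => Osp.e (κ (j.succAbove (i.succAbove t))))

theorem bracketTerm_add {n : ℕ} (f g : MultilinearMap ℝ (fun _ : Fin n => Osp) M)
    (κ : Fin (n + 1) → OspBasis) :
    bracketTerm 𝕜 (f + g) κ = bracketTerm 𝕜 f κ + bracketTerm 𝕜 g κ := by
  cases n with
  | zero => simp [bracketTerm]
  | succ m => simp [bracketTerm, Finset.sum_add_distrib]

theorem bracketTerm_smul {n : ℕ} (a : 𝕜) (f : MultilinearMap ℝ (fun _ : Fin n => Osp) M)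
    (κ : Fin (n + 1) → OspBasis) :
    bracketTerm 𝕜 (a • f) κ = a • bracketTerm 𝕜 f κ := by
  cases n with
  | zero => simp [bracketTerm]
  | succ m => simp [bracketTerm, Finset.smul_sum, smul_comm a]

theorem component_e (q : ℕ) {n : ℕ} (f : MultilinearMap ℝ (fun _ : Fin n => Osp) M)
    (κ : Fin n → OspBasis) :
    ρ.component q f (fun i => Osp.e (κ i)) =
      ρ.proj (q + ∑ i, (κ i).parity) (f fun i => Osp.e (κ i)) :=
  ofBasis_e _ _

theorem component_add (q : ℕ) {n : ℕ} (f g : MultilinearMap ℝ (fun _ : Fin n => Osp) M) :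
    ρ.component q (f + g) = ρ.component q f + ρ.component q g := by
  refine MultilinearMap.ext fun U => ?_
  simp [component, ofBasis_apply, Finset.sum_add_distrib]

theorem component_smul (q : ℕ) {n : ℕ} (a : 𝕜)
    (f : MultilinearMap ℝ (fun _ : Fin n => Osp) M) :
    ρ.component q (a • f) = a • ρ.component q f := by
  refine MultilinearMap.ext fun U => ?_
  simp [component, ofBasis_apply, Finset.smul_sum, smul_comm a]

/-- The coboundary operator `∂`. It is given by the usual formula with Koszul signs on
homogeneous cochains, evaluated on basis vectors, and extended by linearity: a cochain is the sum
of its components of parity `0` and `1`. -/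
def d (n : ℕ) : MultilinearMap ℝ (fun _ : Fin n => Osp) M →ₗ[𝕜]
    MultilinearMap ℝ (fun _ : Fin (n + 1) => Osp) M where
  toFun f := ofBasis fun κ => ∑ q ∈ Finset.range 2,
    (ρ.actionTerm q (ρ.component q f) κ + bracketTerm 𝕜 (ρ.component q f) κ)
  map_add' f g := by
    rw [← ofBasis_add]
    congr 1
    funext κ
    simp only [component_add, bracketTerm_add, actionTerm, add_apply, map_add,
      smul_add, Finset.sum_add_distrib, Pi.add_apply]
    abel
  map_smul' a f := by
    rw [RingHom.id_apply, ← ofBasis_smul]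
    congr 1
    funext κ
    simp only [component_smul, bracketTerm_smul, actionTerm, smul_apply, map_smul,
      Finset.smul_sum, smul_add, Pi.smul_apply, smul_comm a]

/-- The space `Zⁿ` of `n`-cocycles. -/
def cocycles (n : ℕ) : Submodule 𝕜 (MultilinearMap ℝ (fun _ : Fin n => Osp) M) :=
  cochains 𝕜 M n ⊓ LinearMap.ker (ρ.d n)

/-- The space `Bⁿ` of `n`-coboundaries. -/
def coboundaries : (n : ℕ) → Submodule 𝕜 (MultilinearMap ℝ (fun _ : Fin n => Osp) M)
  | 0 => ⊥
  | n + 1 => (cochains 𝕜 M n).map (ρ.d n)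

/-- The cohomology group `Hⁿ(osp(1|2), M) = Zⁿ / Bⁿ`. -/
abbrev cohomology (n : ℕ) : Type _ :=
  ρ.cocycles n ⧸ (ρ.coboundaries n).submoduleOf (ρ.cocycles n)

/-- The cohomology class of a cocycle. -/
def cls {n : ℕ} (f : MultilinearMap ℝ (fun _ : Fin n => Osp) M) (hf : f ∈ ρ.cocycles n) :
    ρ.cohomology n :=
  ((ρ.coboundaries n).submoduleOf (ρ.cocycles n)).mkQ ⟨f, hf⟩

end OspModule

end Cohomology

/-! ### Functions and differential operators on `ℝ^{1|1}` -/

section DiffOps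

variable (𝕜 : Type*) [RCLike 𝕜]

/-- The algebra `C^∞(ℝ)` of smooth `𝕜`-valued functions. -/
def smoothFun : Subalgebra 𝕜 (ℝ → 𝕜) where
  carrier := {f | ContDiff ℝ ∞ f}
  mul_mem' {f g} (hf : ContDiff ℝ ∞ f) (hg : ContDiff ℝ ∞ g) := hf.mul hg
  add_mem' {f g} (hf : ContDiff ℝ ∞ f) (hg : ContDiff ℝ ∞ g) := hf.add hg
  algebraMap_mem' a := (contDiff_const : ContDiff ℝ ∞ fun _ : ℝ => a)

/-- The type of smooth `𝕜`-valued functions on `ℝ`. -/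
def SmoothFun : Type _ := smoothFun 𝕜

instance : CommRing (SmoothFun 𝕜) := inferInstanceAs (CommRing (smoothFun 𝕜))

instance : Algebra 𝕜 (SmoothFun 𝕜) := inferInstanceAs (Algebra 𝕜 (smoothFun 𝕜))

/-- The algebra `C^∞(ℝ^{1|1})` of functions `f₀(x) + f₁(x) θ` with `θ² = 0`. -/
abbrev SuperFun : Type _ := DualNumber (SmoothFun 𝕜)

/-- The derivative on `C^∞(ℝ)`. -/
def smoothDeriv : SmoothFun 𝕜 →ₗ[𝕜] SmoothFun 𝕜 where
  toFun f := ⟨deriv f.1, (contDiff_infty_iff_deriv.mp f.2).2⟩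
  map_add' f g := Subtype.ext <| funext fun t =>
    deriv_add ((contDiff_infty_iff_deriv.mp f.2).1 t) ((contDiff_infty_iff_deriv.mp g.2).1 t)
  map_smul' a f := Subtype.ext <| funext fun t =>
    deriv_const_mul a ((contDiff_infty_iff_deriv.mp f.2).1 t)

/-- The function `x ↦ x` on `ℝ`. -/
def smoothX : SmoothFun 𝕜 := ⟨fun t => (t : 𝕜),
  (RCLike.ofRealCLM (K := 𝕜)).contDiff (n := ∞)⟩

/-- The even coordinate function `x`. -/
def coordX : SuperFun 𝕜 := TrivSqZeroExt.inl (smoothX 𝕜)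

/-- The odd coordinate function `θ`. -/
def coordTheta : SuperFun 𝕜 := TrivSqZeroExt.inr 1

/-- The even derivation `∂_x`. -/
def dx : Module.End 𝕜 (SuperFun 𝕜) where
  toFun F := TrivSqZeroExt.inl (smoothDeriv 𝕜 F.fst) + TrivSqZeroExt.inr (smoothDeriv 𝕜 F.snd)
  map_add' F G := by ext <;> simp
  map_smul' a F := by ext <;> simp

/-- The odd derivation `∂_θ`, which sends `f₀(x) + f₁(x) θ` to `f₁(x)`. -/
def dtheta : Module.End 𝕜 (SuperFun 𝕜) where
  toFun F := TrivSqZeroExt.inl F.snd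
  map_add' F G := by ext <;> simp
  map_smul' a F := by ext <;> simp

variable {𝕜} in
/-- Multiplication by a function. -/
def mulOp (F : SuperFun 𝕜) : Module.End 𝕜 (SuperFun 𝕜) := LinearMap.mulLeft 𝕜 F

/-- `η = ∂_θ + θ ∂_x`. -/
def eta : Module.End 𝕜 (SuperFun 𝕜) := dtheta 𝕜 + mulOp (coordTheta 𝕜) * dx 𝕜

/-- `η̄ = ∂_θ - θ ∂_x`. -/
def etaBar : Module.End 𝕜 (SuperFun 𝕜) := dtheta 𝕜 - mulOp (coordTheta 𝕜) * dx 𝕜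

variable {𝕜} in
/-- The action on densities `F α^l` of weight `l` of the contact vector field
`X_G = G ∂_x + (1/2) η(G) η̄`, that is, the operator `X_G + l G'`. -/
def contactOp (l : ℝ) (G : SuperFun 𝕜) : Module.End 𝕜 (SuperFun 𝕜) :=
  mulOp G * dx 𝕜 + (1 / 2 : 𝕜) • (mulOp (eta 𝕜 G) * etaBar 𝕜) + (l : 𝕜) • mulOp (dx 𝕜 G)

/-- The functions `G` with `(H, X, Y, A, B) = (-X_x, X_1, -X_{x²}, 2 X_θ, -2 X_{xθ})`. -/
def hamiltonian : OspBasis → SuperFun 𝕜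
  | .H => -coordX 𝕜
  | .X => 1
  | .Y => -coordX 𝕜 ^ 2
  | .A => (2 : 𝕜) • coordTheta 𝕜
  | .B => (-2 : 𝕜) • (coordX 𝕜 * coordTheta 𝕜)

/-- The two classes of coefficients for differential operators: arbitrary smooth functions on
`ℝ^{1|1}`, or polynomials in `x` and `θ`. -/
inductive CoeffClass
  | smooth
  | polynomial

/-- The algebra of coefficients. -/
def coeff : CoeffClass → Subalgebra 𝕜 (SuperFun 𝕜)
  | .smooth => ⊤
  | .polynomial => Algebra.adjoin 𝕜 {coordX 𝕜, coordTheta 𝕜}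

/-- The algebra of differential operators on `ℝ^{1|1}` with coefficients of class `c`, generated
by the multiplications by coefficients and by `∂_x` and `∂_θ`. -/
def diffOps (c : CoeffClass) : Subalgebra 𝕜 (Module.End 𝕜 (SuperFun 𝕜)) :=
  Algebra.adjoin 𝕜 (mulOp '' (coeff 𝕜 c : Set (SuperFun 𝕜)) ∪ {dx 𝕜, dtheta 𝕜})

variable {𝕜}

theorem smoothDeriv_mul (f g : SmoothFun 𝕜) :
    smoothDeriv 𝕜 (f * g) = f * smoothDeriv 𝕜 g + smoothDeriv 𝕜 f * g := by
  refine Subtype.ext <| funext fun t => ?_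
  have h : deriv (f.1 * g.1) t = deriv f.1 t * g.1 t + f.1 t * deriv g.1 t :=
    deriv_mul ((contDiff_infty_iff_deriv.mp f.2).1 t) ((contDiff_infty_iff_deriv.mp g.2).1 t)
  exact h.trans (add_comm _ _)

theorem smoothDeriv_X : smoothDeriv 𝕜 (smoothX 𝕜) = 1 := by
  refine Subtype.ext <| funext fun t => ?_
  exact (RCLike.ofRealCLM (K := 𝕜)).hasDerivAt.deriv.trans (RCLike.ofReal_one (K := 𝕜))

theorem smoothDeriv_one : smoothDeriv 𝕜 1 = 0 := by
  have h := smoothDeriv_mul (𝕜 := 𝕜) 1 1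
  simpa using h

theorem dx_mul (F G : SuperFun 𝕜) : dx 𝕜 (F * G) = F * dx 𝕜 G + dx 𝕜 F * G := by
  ext1
  · simp [dx, smoothDeriv_mul]
  · simp [dx, smoothDeriv_mul]
    ring

variable (𝕜) in
/-- The grading involution `f₀(x) + f₁(x) θ ↦ f₀(x) - f₁(x) θ`, as a differential operator. -/
def signOp : Module.End 𝕜 (SuperFun 𝕜) := 1 - (2 : 𝕜) • (mulOp (coordTheta 𝕜) * dtheta 𝕜)

theorem signOp_fst (F : SuperFun 𝕜) : (signOp 𝕜 F).fst = F.fst := by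
  simp [signOp, mulOp, dtheta, coordTheta]

theorem signOp_snd (F : SuperFun 𝕜) : (signOp 𝕜 F).snd = -F.snd := by
  simp [signOp, mulOp, dtheta, coordTheta, two_smul]

theorem signOp_signOp : signOp 𝕜 * signOp 𝕜 = 1 := by
  refine LinearMap.ext fun F => ?_
  ext1 <;> simp [signOp_fst, signOp_snd]

theorem mulOp_mem {c : CoeffClass} {G : SuperFun 𝕜} (hG : G ∈ coeff 𝕜 c) :
    mulOp G ∈ diffOps 𝕜 c :=
  Algebra.subset_adjoin (Or.inl ⟨G, hG, rfl⟩)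

theorem dx_mem (c : CoeffClass) : dx 𝕜 ∈ diffOps 𝕜 c :=
  Algebra.subset_adjoin (Or.inr (Or.inl rfl))

theorem dtheta_mem (c : CoeffClass) : dtheta 𝕜 ∈ diffOps 𝕜 c :=
  Algebra.subset_adjoin (Or.inr (Or.inr rfl))

theorem coordX_mem (c : CoeffClass) : coordX 𝕜 ∈ coeff 𝕜 c := by
  cases c
  · exact Algebra.mem_top
  · exact Algebra.subset_adjoin (Or.inl rfl)

theorem coordTheta_mem (c : CoeffClass) : coordTheta 𝕜 ∈ coeff 𝕜 c := by
  cases c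
  · exact Algebra.mem_top
  · exact Algebra.subset_adjoin (Or.inr rfl)

theorem hamiltonian_mem (c : CoeffClass) (b : OspBasis) : hamiltonian 𝕜 b ∈ coeff 𝕜 c := by
  cases b
  · exact neg_mem (coordX_mem c)
  · exact one_mem _
  · exact neg_mem (pow_mem (coordX_mem c) 2)
  · exact Subalgebra.smul_mem _ (coordTheta_mem c) _
  · exact Subalgebra.smul_mem _ (mul_mem (coordX_mem c) (coordTheta_mem c)) _

theorem signOp_mem (c : CoeffClass) : signOp 𝕜 ∈ diffOps 𝕜 c :=
  sub_mem (one_mem _)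
    (Subalgebra.smul_mem _ (mul_mem (mulOp_mem (coordTheta_mem c)) (dtheta_mem c)) _)

theorem mulOp_dx (G : SuperFun 𝕜) : mulOp (dx 𝕜 G) = dx 𝕜 * mulOp G - mulOp G * dx 𝕜 := by
  refine LinearMap.ext fun F => ?_
  simp [mulOp, dx_mul]

theorem mulOp_dtheta (G : SuperFun 𝕜) : mulOp (dtheta 𝕜 G) =
    dtheta 𝕜 * mulOp G - signOp 𝕜 * mulOp G * signOp 𝕜 * dtheta 𝕜 := by
  refine LinearMap.ext fun F => ?_
  ext1
  · simp [mulOp, dtheta, signOp_fst]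
  · simp [mulOp, dtheta, signOp_fst, signOp_snd]

theorem mulOp_mul (F G : SuperFun 𝕜) : mulOp (F * G) = mulOp F * mulOp G := by
  refine LinearMap.ext fun K => ?_
  simp [mulOp]

theorem mulOp_add (F G : SuperFun 𝕜) : mulOp (F + G) = mulOp F + mulOp G := by
  refine LinearMap.ext fun K => ?_
  simp [mulOp, add_mul]

theorem contactOp_mem {c : CoeffClass} (l : ℝ) {G : SuperFun 𝕜} (hG : G ∈ coeff 𝕜 c) :
    contactOp l G ∈ diffOps 𝕜 c := by
  have hx := dx_mem (𝕜 := 𝕜) c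
  have ht := dtheta_mem (𝕜 := 𝕜) c
  have hθ := mulOp_mem (coordTheta_mem (𝕜 := 𝕜) c)
  have hs := signOp_mem (𝕜 := 𝕜) c
  have hm := mulOp_mem hG
  have h1 : mulOp (dx 𝕜 G) ∈ diffOps 𝕜 c := by
    rw [mulOp_dx]
    exact sub_mem (mul_mem hx hm) (mul_mem hm hx)
  have h2 : mulOp (eta 𝕜 G) ∈ diffOps 𝕜 c := by
    have : eta 𝕜 G = dtheta 𝕜 G + coordTheta 𝕜 * dx 𝕜 G := rfl
    rw [this, mulOp_add, mulOp_mul, mulOp_dtheta]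
    exact add_mem (sub_mem (mul_mem ht hm) (mul_mem (mul_mem (mul_mem hs hm) hs) ht))
      (mul_mem hθ h1)
  exact add_mem (add_mem (mul_mem hm hx)
    (Subalgebra.smul_mem _ (mul_mem h2 (sub_mem ht (mul_mem hθ hx))) _))
    (Subalgebra.smul_mem _ h1 _)

theorem contactOp_fst (l : ℝ) (b : OspBasis) (F : SuperFun 𝕜) :
    (contactOp l (hamiltonian 𝕜 b) F).fst = match b with
      | .H => -(smoothX 𝕜 * smoothDeriv 𝕜 F.fst) - (l : 𝕜) • F.fst
      | .X => smoothDeriv 𝕜 F.fst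
      | .Y => -(smoothX 𝕜 ^ 2 * smoothDeriv 𝕜 F.fst) - (2 * l : 𝕜) • (smoothX 𝕜 * F.fst)
      | .A => F.snd
      | .B => -(smoothX 𝕜 * F.snd) := by
  cases b <;>
  simp [contactOp, hamiltonian, mulOp, eta, etaBar, dx, dtheta, coordX, coordTheta,
    smoothDeriv_X, smoothDeriv_mul, smoothDeriv_one, pow_two]
  all_goals simp only [Algebra.smul_def, map_mul, map_ofNat]; ring

theorem contactOp_snd (l : ℝ) (b : OspBasis) (F : SuperFun 𝕜) :
    (contactOp l (hamiltonian 𝕜 b) F).snd = match b with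
      | .H => -(smoothX 𝕜 * smoothDeriv 𝕜 F.snd) - (l + 1 / 2 : 𝕜) • F.snd
      | .X => smoothDeriv 𝕜 F.snd
      | .Y => -(smoothX 𝕜 ^ 2 * smoothDeriv 𝕜 F.snd) - (2 * l + 1 : 𝕜) • (smoothX 𝕜 * F.snd)
      | .A => smoothDeriv 𝕜 F.fst
      | .B => -(smoothX 𝕜 * smoothDeriv 𝕜 F.fst) - (2 * l : 𝕜) • F.fst := by
  cases b <;>
  simp [contactOp, hamiltonian, mulOp, eta, etaBar, dx, dtheta, coordX, coordTheta,
    smoothDeriv_X, smoothDeriv_mul, smoothDeriv_one, pow_two]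
  all_goals simp only [Algebra.smul_def, map_add, map_mul, map_ofNat, map_one]
  case Y =>
    have h : algebraMap 𝕜 (SmoothFun 𝕜) 2⁻¹ * 2 = 1 := by
      rw [← map_ofNat (algebraMap 𝕜 (SmoothFun 𝕜)) 2, ← map_mul]
      simp
    linear_combination (-(smoothX 𝕜 * F.snd)) * h
  all_goals ring

theorem sum_ospBasis {N : Type*} [AddCommMonoid N] (f : OspBasis → N) :
    ∑ a, f a = f .H + (f .X + (f .Y + (f .A + f .B))) := by
  change ∑ a ∈ ({.H, .X, .Y, .A, .B} : Finset OspBasis), f a = _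
  simp

set_option maxHeartbeats 1000000 in
theorem contactOp_bracket_fst (l : ℝ) (b c : OspBasis) (F : SuperFun 𝕜) :
    ((∑ a, ((Osp.bracketBasis b c a : ℝ) : 𝕜) • contactOp l (hamiltonian 𝕜 a)) F).fst =
      ((contactOp l (hamiltonian 𝕜 b) * contactOp l (hamiltonian 𝕜 c) -
        (-1 : 𝕜) ^ (b.parity * c.parity) •
          (contactOp l (hamiltonian 𝕜 c) * contactOp l (hamiltonian 𝕜 b))) F).fst := by
  have h2 : algebraMap 𝕜 (SmoothFun 𝕜) 2⁻¹ * 2 = 1 := by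
    rw [← map_ofNat (algebraMap 𝕜 (SmoothFun 𝕜)) 2, ← map_mul]
    simp
  cases b <;> cases c <;>
    simp [sum_ospBasis, Osp.bracketBasis, Osp.e, OspBasis.parity, contactOp_fst, contactOp_snd,
      smoothDeriv_mul, smoothDeriv_X, pow_two] <;>
    simp only [Algebra.smul_def, map_add, map_mul, map_ofNat, map_one, map_neg, neg_div,
      one_div] <;>
    first
      | done
      | ring1
      | linear_combination (smoothX 𝕜 * F.snd) * h2
      | linear_combination -(smoothX 𝕜 * F.snd) * h2

set_option maxHeartbeats 1000000 in
theorem contactOp_bracket_snd (l : ℝ) (b c : OspBasis) (F : SuperFun 𝕜) :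
    ((∑ a, ((Osp.bracketBasis b c a : ℝ) : 𝕜) • contactOp l (hamiltonian 𝕜 a)) F).snd =
      ((contactOp l (hamiltonian 𝕜 b) * contactOp l (hamiltonian 𝕜 c) -
        (-1 : 𝕜) ^ (b.parity * c.parity) •
          (contactOp l (hamiltonian 𝕜 c) * contactOp l (hamiltonian 𝕜 b))) F).snd := by
  have h2 : algebraMap 𝕜 (SmoothFun 𝕜) 2⁻¹ * 2 = 1 := by
    rw [← map_ofNat (algebraMap 𝕜 (SmoothFun 𝕜)) 2, ← map_mul]
    simp
  cases b <;> cases c <;>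
    simp [sum_ospBasis, Osp.bracketBasis, Osp.e, OspBasis.parity, contactOp_fst, contactOp_snd,
      smoothDeriv_mul, smoothDeriv_X, pow_two] <;>
    simp only [Algebra.smul_def, map_add, map_mul, map_ofNat, map_one, map_neg, neg_div,
      one_div] <;>
    first
      | done
      | ring1
      | linear_combination smoothDeriv 𝕜 F.fst * h2
      | linear_combination -smoothDeriv 𝕜 F.fst * h2
      | linear_combination F.snd * h2
      | linear_combination -F.snd * h2

theorem contactOp_bracket (l : ℝ) (b c : OspBasis) :
    ∑ a, ((Osp.bracketBasis b c a : ℝ) : 𝕜) • contactOp l (hamiltonian 𝕜 a) =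
      contactOp l (hamiltonian 𝕜 b) * contactOp l (hamiltonian 𝕜 c) -
        (-1 : 𝕜) ^ (b.parity * c.parity) •
          (contactOp l (hamiltonian 𝕜 c) * contactOp l (hamiltonian 𝕜 b)) :=
  LinearMap.ext fun F =>
    TrivSqZeroExt.ext (contactOp_bracket_fst l b c F) (contactOp_bracket_snd l b c F)

theorem signOp_contactOp (l : ℝ) (b : OspBasis) :
    signOp 𝕜 * contactOp l (hamiltonian 𝕜 b) =
      (-1 : 𝕜) ^ b.parity • (contactOp l (hamiltonian 𝕜 b) * signOp 𝕜) := by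
  refine LinearMap.ext fun F => ?_
  ext1 <;> cases b <;>
    simp [OspBasis.parity, contactOp_fst, contactOp_snd, signOp_fst, signOp_snd] <;> ring

/-! ### The module `𝔇_{λ,μ}` -/

variable (𝕜) in
/-- The type of differential operators on `ℝ^{1|1}` with coefficients of class `c`. -/
def DiffOp (c : CoeffClass) : Type _ := diffOps 𝕜 c

instance (c : CoeffClass) : Ring (DiffOp 𝕜 c) := inferInstanceAs (Ring (diffOps 𝕜 c))

instance (c : CoeffClass) : Algebra 𝕜 (DiffOp 𝕜 c) := inferInstanceAs (Algebra 𝕜 (diffOps 𝕜 c))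

instance (c : CoeffClass) : Module ℝ (DiffOp 𝕜 c) := Module.compHom _ (algebraMap ℝ 𝕜)

instance (c : CoeffClass) : IsScalarTower ℝ 𝕜 (DiffOp 𝕜 c) :=
  ⟨fun a b m => by
    change (a • b) • m = (algebraMap ℝ 𝕜 a) • b • m
    rw [Algebra.smul_def a b, mul_smul]⟩

namespace DiffOp

variable (𝕜) in
/-- Multiplication by `x`. -/
def x (c : CoeffClass) : DiffOp 𝕜 c := ⟨mulOp (coordX 𝕜), mulOp_mem (coordX_mem c)⟩

variable (𝕜) in
/-- Multiplication by `θ`. -/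
def θ (c : CoeffClass) : DiffOp 𝕜 c := ⟨mulOp (coordTheta 𝕜), mulOp_mem (coordTheta_mem c)⟩

variable (𝕜) in
/-- The operator `∂_x`. -/
def partialX (c : CoeffClass) : DiffOp 𝕜 c := ⟨dx 𝕜, dx_mem c⟩

variable (𝕜) in
/-- The operator `∂_θ`. -/
def partialTheta (c : CoeffClass) : DiffOp 𝕜 c := ⟨dtheta 𝕜, dtheta_mem c⟩

variable (𝕜) in
/-- The grading involution of `C^∞(ℝ^{1|1})` as a differential operator. -/
def ε (c : CoeffClass) : DiffOp 𝕜 c := ⟨signOp 𝕜, signOp_mem c⟩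

variable (𝕜) in
/-- The action of a basis vector of `osp(1|2)` on densities of weight `l`. -/
def field (c : CoeffClass) (l : ℝ) (b : OspBasis) : DiffOp 𝕜 c :=
  ⟨contactOp l (hamiltonian 𝕜 b), contactOp_mem l (hamiltonian_mem c b)⟩

variable (𝕜) in
/-- The grading involution of the differential operators, `T ↦ ε ∘ T ∘ ε`: it is `1` on operators
that preserve parity and `-1` on operators that reverse it. -/
def signMap (c : CoeffClass) : DiffOp 𝕜 c →ₗ[𝕜] DiffOp 𝕜 c :=
  LinearMap.mulLeft 𝕜 (ε 𝕜 c) ∘ₗ LinearMap.mulRight 𝕜 (ε 𝕜 c)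

variable (𝕜) in
/-- The action `U · T = U ∘ T - (-1)^(TU) T ∘ U` of a basis vector `U` of `osp(1|2)`, where on the
left `U` acts on densities of weight `m`, and on the right on densities of weight `l`. The operator
`(-1)^(TU) T` is `T` if `U` is even, and the image of `T` under the grading involution if `U` is
odd. -/
def actMap (c : CoeffClass) (l m : ℝ) (b : OspBasis) : DiffOp 𝕜 c →ₗ[𝕜] DiffOp 𝕜 c :=
  LinearMap.mulLeft 𝕜 (field 𝕜 c m b) -
    LinearMap.mulRight 𝕜 (field 𝕜 c l b) ∘ₗ (signMap 𝕜 c) ^ b.parity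

theorem ε_mul_ε (c : CoeffClass) : ε 𝕜 c * ε 𝕜 c = 1 := Subtype.ext signOp_signOp

theorem ε_mul_field (c : CoeffClass) (l : ℝ) (b : OspBasis) :
    ε 𝕜 c * field 𝕜 c l b = (-1 : 𝕜) ^ b.parity • (field 𝕜 c l b * ε 𝕜 c) :=
  Subtype.ext (signOp_contactOp l b)

theorem field_bracket (c : CoeffClass) (l : ℝ) (b b' : OspBasis) :
    ∑ a, ((Osp.bracketBasis b b' a : ℝ) : 𝕜) • field 𝕜 c l a =
      field 𝕜 c l b * field 𝕜 c l b' -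
        (-1 : 𝕜) ^ (b.parity * b'.parity) • (field 𝕜 c l b' * field 𝕜 c l b) := by
  have h := contactOp_bracket (𝕜 := 𝕜) l b b'
  rw [sum_ospBasis] at h ⊢
  exact Subtype.ext h

theorem signMap_apply (c : CoeffClass) (T : DiffOp 𝕜 c) :
    signMap 𝕜 c T = ε 𝕜 c * (T * ε 𝕜 c) := rfl

theorem signMap_signMap (c : CoeffClass) (T : DiffOp 𝕜 c) :
    signMap 𝕜 c (signMap 𝕜 c T) = T := by
  simp only [signMap_apply, mul_assoc, ε_mul_ε, mul_one]
  rw [← mul_assoc, ε_mul_ε, one_mul]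

theorem signMap_mul (c : CoeffClass) (S T : DiffOp 𝕜 c) :
    signMap 𝕜 c (S * T) = signMap 𝕜 c S * signMap 𝕜 c T := by
  simp only [signMap_apply, mul_assoc]
  rw [← mul_assoc (ε 𝕜 c) (ε 𝕜 c), ε_mul_ε, one_mul]

theorem signMap_field (c : CoeffClass) (l : ℝ) (b : OspBasis) :
    signMap 𝕜 c (field 𝕜 c l b) = (-1 : 𝕜) ^ b.parity • field 𝕜 c l b := by
  rw [signMap_apply, ← mul_assoc, ε_mul_field, smul_mul_assoc, mul_assoc, ε_mul_ε, mul_one]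

theorem actMap_apply (c : CoeffClass) (l m : ℝ) (b : OspBasis) (T : DiffOp 𝕜 c) :
    actMap 𝕜 c l m b T =
      field 𝕜 c m b * T - ((signMap 𝕜 c) ^ b.parity) T * field 𝕜 c l b := rfl

theorem parity_cases (b : OspBasis) : b.parity = 0 ∨ b.parity = 1 := by
  cases b <;> simp [OspBasis.parity]

theorem actMap_signMap (c : CoeffClass) (l m : ℝ) (b : OspBasis) (T : DiffOp 𝕜 c) :
    actMap 𝕜 c l m b (signMap 𝕜 c T) =
      (-1 : 𝕜) ^ b.parity • signMap 𝕜 c (actMap 𝕜 c l m b T) := by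
  rcases parity_cases b with h | h <;>
    simp [actMap_apply, h, signMap_mul, signMap_field, signMap_signMap, sub_eq_add_neg]

theorem actMap_bracket (c : CoeffClass) (l m : ℝ) (b b' : OspBasis) (T : DiffOp 𝕜 c) :
    ∑ a, ((Osp.bracketBasis b b' a : ℝ) : 𝕜) • actMap 𝕜 c l m a T =
      actMap 𝕜 c l m b (actMap 𝕜 c l m b' T) -
        (-1 : 𝕜) ^ (b.parity * b'.parity) • actMap 𝕜 c l m b' (actMap 𝕜 c l m b T) := by
  have hp : ∀ a, ((Osp.bracketBasis b b' a : ℝ) : 𝕜) • actMap 𝕜 c l m a T =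
      (((Osp.bracketBasis b b' a : ℝ) : 𝕜) • field 𝕜 c m a) * T -
      ((signMap 𝕜 c) ^ (b.parity + b'.parity)) T *
        (((Osp.bracketBasis b b' a : ℝ) : 𝕜) • field 𝕜 c l a) := by
    intro a
    have h2 : (signMap 𝕜 c) ^ 2 = 1 := LinearMap.ext fun T => by
      simp [pow_two, signMap_signMap]
    have key : Osp.bracketBasis b b' a = 0 ∨
        (signMap 𝕜 c) ^ (b.parity + b'.parity) = (signMap 𝕜 c) ^ a.parity := by
      cases b <;> cases b' <;> cases a <;>
        simp [Osp.bracketBasis, Osp.e, OspBasis.parity, h2]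
    rcases key with h | h
    · simp [h]
    · rw [actMap_apply, h, smul_sub, smul_mul_assoc, mul_smul_comm]
  simp only [hp, Finset.sum_sub_distrib, ← Finset.sum_mul, ← Finset.mul_sum, field_bracket]
  rcases parity_cases b with h | h <;> rcases parity_cases b' with h' | h' <;>
    simp [actMap_apply, h, h', signMap_mul, signMap_field, signMap_signMap, pow_two] <;>
    noncomm_ring

end DiffOp

variable (𝕜) in
/-- The `osp(1|2)`-module `𝔇_{l,m}` of differential operators with coefficients of class `c` from
densities of weight `l` to densities of weight `m`. -/
def densityModule (c : CoeffClass) (l m : ℝ) : OspModule 𝕜 (DiffOp 𝕜 c) where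
  sign := DiffOp.signMap 𝕜 c
  sign_sign := DiffOp.signMap_signMap c
  act := DiffOp.actMap 𝕜 c l m
  act_sign := DiffOp.actMap_signMap c l m
  act_bracket := DiffOp.actMap_bracket c l m

/-! ### Explicit cochains -/

/-- The `0`-cochain given by an element `T`. -/
def cochainZero {M : Type*} [AddCommGroup M] [Module ℝ M] (T : M) :
    MultilinearMap ℝ (fun _ : Fin 0 => Osp) M :=
  MultilinearMap.constOfIsEmpty ℝ (fun _ : Fin 0 => Osp) T

/-- The `1`-cochain with prescribed values on the basis vectors. -/
def cochainOne {M : Type*} [AddCommGroup M] [Module ℝ M] (v : OspBasis → M) :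
    MultilinearMap ℝ (fun _ : Fin 1 => Osp) M :=
  ofBasis fun κ => v (κ 0)

/-- A cochain `f` is reduced if `f(A, U₂, …, Uₙ) = 0` for all `U₂, …, Uₙ` in `{A, H, B, Y}`. -/
def IsReduced {M : Type*} [AddCommGroup M] [Module ℝ M] {n : ℕ}
    (f : MultilinearMap ℝ (fun _ : Fin (n + 1) => Osp) M) : Prop :=
  ∀ κ : Fin n → OspBasis, (∀ t, κ t ≠ .X) → f (Fin.cons (Osp.e .A) fun t => Osp.e (κ t)) = 0

namespace DiffOp

variable (𝕜) in
/-- The operator `∂_θ ∂_x^k - θ ∂_x^(k+1)`. -/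
def delta (c : CoeffClass) (k : ℕ) : DiffOp 𝕜 c :=
  partialTheta 𝕜 c * partialX 𝕜 c ^ k - θ 𝕜 c * partialX 𝕜 c ^ (k + 1)

variable (𝕜) in
/-- The `1`-cochain `h`, with `h(X_G) = G'`. -/
def h (c : CoeffClass) : MultilinearMap ℝ (fun _ : Fin 1 => Osp) (DiffOp 𝕜 c) :=
  cochainOne fun
    | .X => 0
    | .A => 0
    | .H => -1
    | .B => (-2 : 𝕜) • θ 𝕜 c
    | .Y => (-2 : 𝕜) • x 𝕜 c

variable (𝕜) in
/-- The `1`-cochain `f_k`. -/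
def f (c : CoeffClass) (k : ℕ) : MultilinearMap ℝ (fun _ : Fin 1 => Osp) (DiffOp 𝕜 c) :=
  cochainOne fun
    | .X => 0
    | .A => 0
    | .H => delta 𝕜 c k
    | .B => (-2 : 𝕜) • (θ 𝕜 c * partialTheta 𝕜 c * partialX 𝕜 c ^ k)
    | .Y => (2 : 𝕜) • (x 𝕜 c * delta 𝕜 c k)

variable (𝕜) in
/-- The `1`-cochain `f̃_k`. For `k = 0` the first term of its value on `Y` vanishes. -/
def fTilde (c : CoeffClass) (k : ℕ) : MultilinearMap ℝ (fun _ : Fin 1 => Osp) (DiffOp 𝕜 c) :=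
  cochainOne fun
    | .X => 0
    | .A => 0
    | .H => 0
    | .B => (-2 : 𝕜) • partialX 𝕜 c ^ k
    | .Y => (-2 * k : 𝕜) • (partialTheta 𝕜 c * partialX 𝕜 c ^ (k - 1)) +
        (2 * (k + 1) : 𝕜) • (θ 𝕜 c * partialX 𝕜 c ^ k)

/-- The cup product of `1`-cochains,
`(f ∨ g)(U, V) = f(U) ∘ g(V) - (-1)^(UV) f(V) ∘ g(U)` for `U`, `V` basis vectors. -/
def cup {c : CoeffClass} (f g : MultilinearMap ℝ (fun _ : Fin 1 => Osp) (DiffOp 𝕜 c)) :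
    MultilinearMap ℝ (fun _ : Fin 2 => Osp) (DiffOp 𝕜 c) :=
  ofBasis fun κ =>
    f (fun _ => Osp.e (κ 0)) * g (fun _ => Osp.e (κ 1)) -
      (-1 : 𝕜) ^ ((κ 0).parity * (κ 1).parity) •
        (f (fun _ => Osp.e (κ 1)) * g (fun _ => Osp.e (κ 0)))

end DiffOp

end DiffOps
end OspCohomology
end

noncomputable section

set_option linter.unusedSectionVars false

/-! ### Structure constants and Koszul signs. -/

namespace OspCohomology

/-! Write `ι_b` for contraction with a basis vector and `L_b` for the Lie derivative. Composing the
action of odd vectors with the grading involution (`twist`) absorbs the sign that depends on the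
parity of the cochain, so the coboundary makes sense for inhomogeneous cochains. On functions of
lists of basis vectors it is defined recursively by Cartan's formula `ι_b d = L_b - d ι_b` (`diff`),
which makes `d² = 0` and the commutation rules short inductions; `toList_d` identifies it with the
given coboundary.

The action of `A` on differential operators is onto, because functions have antiderivatives. This
allows every cocycle of positive degree to be changed by a coboundary until `ι_A v = 0`
(`exists_contract_A_sub_diff`): the top power of `ι_A` that does not kill `v` is removed first,
using that `[A, A] = 2X`. A closed `v` with `ι_A v = 0` also satisfies `L_A v = 0` and `ι_X v = 0`.
Such a relative cocycle is determined by its values on `B, …, B` (`eq_zero_of_relative`). Dividing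
these values by binomial factors gives a primitive, with one possible obstruction, the value on `(H,
B)` (`exists_eq_diff`). Hence there is no cohomology above degree two.

In degrees at most two what remains is a small complex on `K = ker A`. Let `τ` be a right inverse of
`A` on `K`, and let `lower` be `B + 2τH`, the correction of `B` that preserves `K`. Relative
cochains are described by `w`, by `(q, p)` with `v(H) = q`, `v(B) = p - 2τq`, and by the value on
`(H, B)`; the differentials are `w ↦ (Hw, lower w)` and `(q, p) ↦ (H + 1/2)p - lower q`. If `H` and
`H + 1/2` split `K` into kernel plus image (`IsSplit`), only the map `lower : ker H → ker (H + 1/2)`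
inside `K` matters: its kernel is `H⁰`, its kernel plus its cokernel is `H¹`, its cokernel is `H²`.

For densities of weights `l`, `m`, every operator is uniquely a sum of terms `F η̄^j`, and `A` acts
on the coefficients `F` alone, by `η` up to sign. So `K` consists of the polynomials in `η̄`, with
`η̄^j` of weight `l - m + j/2`, and `ker H`, `ker (H + 1/2)` have dimension at most one. Since
`lower` sends `1` to `0`, `η̄^(2i+1)` to `(2l + i) η̄^(2i)` and `η̄^(2i+2)` to `-(i+1) η̄^(2i+1)`,
it is bijective between these kernels except when `l = m`, where `ker H` is spanned by `1` and `ker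
(H + 1/2) = 0`, and when `l = -k/2`, `m = (k+1)/2`, where both kernels are lines and `lower`
vanishes on `ker H`. -/

/-- Twice the structure constants of `osp(1|2)`, as integers. -/
def structureConst : OspBasis → OspBasis → OspBasis → ℤ
  | .H, .X, .X => 2
  | .X, .H, .X => -2
  | .H, .Y, .Y => -2
  | .Y, .H, .Y => 2
  | .X, .Y, .H => 4
  | .Y, .X, .H => -4
  | .H, .A, .A => 1
  | .A, .H, .A => -1
  | .H, .B, .B => -1
  | .B, .H, .B => 1
  | .Y, .A, .B => -2
  | .A, .Y, .B => 2
  | .X, .B, .A => -2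
  | .B, .X, .A => 2
  | .A, .A, .X => 4
  | .A, .B, .H => 4
  | .B, .A, .H => 4
  | .B, .B, .Y => -4
  | _, _, _ => 0

/-- Doubling clears the halves, so the Lie superalgebra identities become integer identities that
are checked by evaluation over all basis vectors. -/
theorem bracketBasis_eq (b c a : OspBasis) :
    Osp.bracketBasis b c a = structureConst b c a / 2 := by
  cases b <;> cases c <;> cases a <;>
    norm_num [Osp.bracketBasis, Osp.e, structureConst, Pi.single_apply] <;> nofun

theorem structureConst_antisymm (b c a : OspBasis) :
    structureConst b c a = -((-1) ^ (b.parity * c.parity) * structureConst c b a) := by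
  cases b <;> cases c <;> cases a <;> rfl

/-- The bracket is even: a nonzero constant forces the parity of `a` to be that of `b` plus that of
`c`. -/
theorem structureConst_parity (b c a d : OspBasis) :
    structureConst b c a * (-1) ^ (a.parity * d.parity) = structureConst b c a *
      ((-1) ^ (b.parity * d.parity) * (-1) ^ (c.parity * d.parity)) := by
  cases b <;> cases c <;> cases a <;> cases d <;> rfl

/-- The graded Jacobi identity, arranged as it appears when two Lie derivatives are commuted past a
contraction. -/
theorem structureConst_jacobi (b c a f : OspBasis) :
    ∑ e, structureConst b a e * structureConst c e f -
        (-1) ^ (b.parity * c.parity) *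
          ∑ e, structureConst c a e * structureConst b e f =
      -((-1) ^ (b.parity * c.parity) *
        ∑ e, structureConst b c e * structureConst e a f) := by
  simp only [sum_ospBasis]
  cases b <;> cases c <;> cases a <;> cases f <;> rfl

section Signs

variable (𝕜 : Type*) [RCLike 𝕜]

/-- The structure constants of `osp(1|2)` as elements of `𝕜`. -/
def brCoeff (b c a : OspBasis) : 𝕜 := ((Osp.bracketBasis b c a : ℝ) : 𝕜)

/-- The Koszul sign `(-1)^(bc)`. -/
def koszul (b c : OspBasis) : 𝕜 := (-1) ^ (b.parity * c.parity)

theorem brCoeff_eq (b c a : OspBasis) : brCoeff 𝕜 b c a = (structureConst b c a : 𝕜) / 2 := by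
  rw [brCoeff, bracketBasis_eq]
  push_cast
  rfl

theorem koszul_comm (b c : OspBasis) : koszul 𝕜 b c = koszul 𝕜 c b := by
  simp [koszul, mul_comm]

theorem koszul_mul_self (b c : OspBasis) : koszul 𝕜 b c * koszul 𝕜 b c = 1 := by
  simp [koszul, ← mul_pow]

theorem koszul_cases (b c : OspBasis) : koszul 𝕜 b c = 1 ∨ koszul 𝕜 b c = -1 :=
  neg_one_pow_eq_or 𝕜 _

theorem brCoeff_antisymm (b c a : OspBasis) :
    brCoeff 𝕜 b c a = -(koszul 𝕜 b c * brCoeff 𝕜 c b a) := by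
  rw [brCoeff_eq, brCoeff_eq, structureConst_antisymm, koszul]
  push_cast
  ring

theorem brCoeff_mul_koszul (b c a d : OspBasis) : brCoeff 𝕜 b c a * koszul 𝕜 a d =
    brCoeff 𝕜 b c a * (koszul 𝕜 b d * koszul 𝕜 c d) := by
  have h := congrArg (fun n : ℤ => (n : 𝕜)) (structureConst_parity b c a d)
  push_cast at h
  simp only [brCoeff_eq, koszul, div_mul_eq_mul_div, h]

theorem brCoeff_jacobi (b c a f : OspBasis) :
    ∑ e, brCoeff 𝕜 b a e * brCoeff 𝕜 c e f -
        koszul 𝕜 b c * ∑ e, brCoeff 𝕜 c a e * brCoeff 𝕜 b e f =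
      -(koszul 𝕜 b c * ∑ e, brCoeff 𝕜 b c e * brCoeff 𝕜 e a f) := by
  have h := congrArg (fun n : ℤ => (n : 𝕜)) (structureConst_jacobi b c a f)
  push_cast at h
  simp only [brCoeff_eq, koszul, div_mul_div_comm, ← Finset.sum_div]
  linear_combination h / 4

end Signs

/-! ### Cartan calculus on functions of lists of basis vectors. -/

section Calculus

variable {𝕜 M : Type*} [RCLike 𝕜] [AddCommGroup M] [Module 𝕜 M]

variable (𝕜) in
/-- The contraction of a cochain, given by its values on lists of basis vectors, with a basis
vector in the first argument. -/
def contract (b : OspBasis) : (List OspBasis → M) →ₗ[𝕜] (List OspBasis → M) where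
  toFun v l := v (b :: l)
  map_add' _ _ := rfl
  map_smul' _ _ := rfl

@[simp]
theorem contract_apply (b : OspBasis) (v : List OspBasis → M) (l : List OspBasis) :
    contract 𝕜 b v l = v (b :: l) := rfl

namespace OspModule

variable (ρ : OspModule 𝕜 M)

/-- The action of a basis vector, twisted by the grading involution for odd basis vectors. -/
def twist (b : OspBasis) : M →ₗ[𝕜] M := ρ.act b ∘ₗ ρ.sign ^ b.parity

theorem twist_apply (b : OspBasis) (m : M) :
    ρ.twist b m = ρ.act b ((ρ.sign ^ b.parity) m) := rfl

theorem sign_pow_act (b : OspBasis) (n : ℕ) (hn : n = 0 ∨ n = 1) (m : M) :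
    (ρ.sign ^ n) (ρ.act b m) = (-1 : 𝕜) ^ (n * b.parity) • ρ.act b ((ρ.sign ^ n) m) := by
  rcases hn with rfl | rfl
  · simp
  · rw [pow_one, one_mul, ρ.act_sign, smul_smul, ← mul_pow]
    simp

/-- The extra Koszul sign on the right, compared with a genuine representation, comes from moving
the grading involution attached to `b` past the action of `c`. The involutions combine because
`bracketBasis b c` has parity equal to the sum of the parities. -/
theorem twist_twist (b c : OspBasis) (m : M) :
    ρ.twist b (ρ.twist c m) - koszul 𝕜 b c • ρ.twist c (ρ.twist b m) =
      koszul 𝕜 b c • ∑ a, brCoeff 𝕜 b c a • ρ.twist a m := by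
  have hb : ∀ a, brCoeff 𝕜 b c a • ρ.twist a m = brCoeff 𝕜 b c a •
      ρ.act a ((ρ.sign ^ b.parity) ((ρ.sign ^ c.parity) m)) := by
    intro a
    have key : Osp.bracketBasis b c a = 0 ∨
        ρ.sign ^ a.parity = ρ.sign ^ b.parity * ρ.sign ^ c.parity := by
      have h2 : ρ.sign * ρ.sign = 1 := LinearMap.ext fun m => ρ.sign_sign m
      rw [bracketBasis_eq]
      cases b <;> cases c <;> cases a <;> simp [structureConst, OspBasis.parity, h2]
    rcases key with h | h
    · simp [brCoeff, h]
    · rw [twist_apply, h, Module.End.mul_apply]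
  have hs : (ρ.sign ^ c.parity) ((ρ.sign ^ b.parity) m) =
      (ρ.sign ^ b.parity) ((ρ.sign ^ c.parity) m) := by
    rw [← Module.End.mul_apply, ← pow_add, add_comm, pow_add, Module.End.mul_apply]
  simp only [hb]
  have h := ρ.act_bracket b c ((ρ.sign ^ b.parity) ((ρ.sign ^ c.parity) m))
  simp only [brCoeff, h]
  rw [twist_apply, twist_apply, ρ.sign_pow_act c _ (DiffOp.parity_cases b), twist_apply,
    twist_apply, ρ.sign_pow_act b _ (DiffOp.parity_cases c), hs, map_smul, map_smul, smul_sub,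
    smul_smul, smul_smul, koszul, mul_comm c.parity b.parity]

/-- The Lie derivative of cochains along a basis vector. -/
def lieFun (b : OspBasis) : List OspBasis → (List OspBasis → M) → M
  | [], v => ρ.twist b (v [])
  | c :: l, v =>
    koszul 𝕜 b c • lieFun b l (contract 𝕜 c v) - ∑ a, brCoeff 𝕜 b c a • v (a :: l)

/-- The Lie derivative of cochains along a basis vector. -/
def lie (b : OspBasis) : (List OspBasis → M) →ₗ[𝕜] (List OspBasis → M) where
  toFun v l := ρ.lieFun b l v
  map_add' v w := by
    funext l
    induction l generalizing v w with
    | nil => simp [lieFun]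
    | cons c l ih =>
      have h := ih (contract 𝕜 c v) (contract 𝕜 c w)
      simp only [Pi.add_apply] at h
      simp only [Pi.add_apply, lieFun, map_add, h, smul_add, Finset.sum_add_distrib]
      abel
  map_smul' r v := by
    funext l
    induction l generalizing v with
    | nil => simp [lieFun]
    | cons c l ih =>
      have h := ih (contract 𝕜 c v)
      simp only [Pi.smul_apply, RingHom.id_apply] at h
      simp only [Pi.smul_apply, RingHom.id_apply, lieFun, map_smul, h, smul_sub,
        Finset.smul_sum, smul_comm r]

theorem lie_nil (b : OspBasis) (v : List OspBasis → M) : ρ.lie b v [] = ρ.twist b (v []) := rfl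

theorem lie_cons (b c : OspBasis) (v : List OspBasis → M) (l : List OspBasis) :
    ρ.lie b v (c :: l) =
      koszul 𝕜 b c • ρ.lie b (contract 𝕜 c v) l - ∑ a, brCoeff 𝕜 b c a • v (a :: l) := rfl

theorem contract_lie (b c : OspBasis) (v : List OspBasis → M) :
    contract 𝕜 c (ρ.lie b v) =
      koszul 𝕜 b c • ρ.lie b (contract 𝕜 c v) - ∑ a, brCoeff 𝕜 b c a • contract 𝕜 a v := by
  funext l
  simp [lie_cons]

/-- Induction on the argument list: the empty list is `twist_twist`, and each further argument adds
double brackets that cancel by the Jacobi identity, here `hJ`. -/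
theorem lie_lie (b c : OspBasis) (v : List OspBasis → M) :
    ρ.lie b (ρ.lie c v) - koszul 𝕜 b c • ρ.lie c (ρ.lie b v) =
      koszul 𝕜 b c • ∑ a, brCoeff 𝕜 b c a • ρ.lie a v := by
  funext l
  induction l generalizing v with
  | nil => simpa [lie_nil] using ρ.twist_twist b c (v [])
  | cons a l ih =>
    have ih := ih (contract 𝕜 a v)
    have hJ : (∑ e, brCoeff 𝕜 b a e • ∑ f, brCoeff 𝕜 c e f • v (f :: l)) -
        koszul 𝕜 b c • ∑ e, brCoeff 𝕜 c a e • ∑ f, brCoeff 𝕜 b e f • v (f :: l) =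
        -(koszul 𝕜 b c • ∑ e, brCoeff 𝕜 b c e • ∑ f, brCoeff 𝕜 e a f • v (f :: l)) := by
      have hsum : ∀ p : OspBasis → 𝕜, ∀ q : OspBasis → OspBasis → 𝕜,
          ∑ e, p e • ∑ f, q e f • v (f :: l) = ∑ f, (∑ e, p e * q e f) • v (f :: l) := by
        intro p q
        simp only [Finset.smul_sum, smul_smul, Finset.sum_smul]
        exact Finset.sum_comm
      rw [hsum, hsum, hsum, Finset.smul_sum, Finset.smul_sum, ← Finset.sum_sub_distrib,
        ← Finset.sum_neg_distrib]
      refine Finset.sum_congr rfl fun f _ => ?_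
      rw [smul_smul, smul_smul, ← sub_smul, ← neg_smul, brCoeff_jacobi]
    have e1 : ∀ p q r : OspBasis, ∑ e, brCoeff 𝕜 p q e • koszul 𝕜 r e •
        ρ.lie r (contract 𝕜 e v) l = (koszul 𝕜 r p * koszul 𝕜 r q) •
          ∑ e, brCoeff 𝕜 p q e • ρ.lie r (contract 𝕜 e v) l := by
      intro p q r
      rw [Finset.smul_sum]
      refine Finset.sum_congr rfl fun e _ => ?_
      rw [smul_smul, koszul_comm, brCoeff_mul_koszul, smul_smul, koszul_comm 𝕜 r p,
        koszul_comm 𝕜 r q, mul_comm]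
    have e2 : ∑ e, brCoeff 𝕜 b c e • koszul 𝕜 e a • ρ.lie e (contract 𝕜 a v) l =
        (koszul 𝕜 b a * koszul 𝕜 c a) • ∑ e, brCoeff 𝕜 b c e • ρ.lie e (contract 𝕜 a v) l := by
      rw [Finset.smul_sum]
      refine Finset.sum_congr rfl fun e _ => ?_
      rw [smul_smul, brCoeff_mul_koszul, smul_smul, mul_comm]
    have e3 : ∀ p q : OspBasis, ρ.lie p (ρ.lie q v) (a :: l) =
        koszul 𝕜 p a • (koszul 𝕜 q a • ρ.lie p (ρ.lie q (contract 𝕜 a v)) l -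
          ∑ e, brCoeff 𝕜 q a e • ρ.lie p (contract 𝕜 e v) l) -
        ((koszul 𝕜 q p * koszul 𝕜 q a) • ∑ e, brCoeff 𝕜 p a e • ρ.lie q (contract 𝕜 e v) l -
          ∑ e, brCoeff 𝕜 p a e • ∑ f, brCoeff 𝕜 q e f • v (f :: l)) := by
      intro p q
      rw [lie_cons, contract_lie, ← e1]
      simp [lie_cons, smul_sub]
    simp only [Pi.sub_apply, Pi.smul_apply, Finset.sum_apply] at ih ⊢
    rw [e3, e3]
    simp only [lie_cons, smul_sub, Finset.sum_sub_distrib]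
    rw [e2]
    rw [koszul_comm 𝕜 c b]
    rcases koszul_cases 𝕜 b c with h | h <;> rw [h] at hJ ih ⊢ <;>
      linear_combination (norm := module) (koszul 𝕜 b a * koszul 𝕜 c a) • ih + hJ

/-- The coboundary operator on cochains of all degrees. -/
def diffFun : List OspBasis → (List OspBasis → M) → M
  | [], _ => 0
  | b :: l, v => ρ.lie b v l - diffFun l (contract 𝕜 b v)

/-- The coboundary operator on cochains of all degrees. -/
def diff : (List OspBasis → M) →ₗ[𝕜] (List OspBasis → M) where
  toFun v l := ρ.diffFun l v
  map_add' v w := by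
    funext l
    induction l generalizing v w with
    | nil => simp [diffFun]
    | cons c l ih =>
      have h := ih (contract 𝕜 c v) (contract 𝕜 c w)
      simp only [Pi.add_apply] at h
      simp only [Pi.add_apply, diffFun, map_add, h]
      abel
  map_smul' r v := by
    funext l
    induction l generalizing v with
    | nil => simp [diffFun]
    | cons c l ih =>
      have h := ih (contract 𝕜 c v)
      simp only [Pi.smul_apply, RingHom.id_apply] at h
      simp only [Pi.smul_apply, RingHom.id_apply, diffFun, map_smul, h, smul_sub]

theorem diff_nil (v : List OspBasis → M) : ρ.diff v [] = 0 := rfl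

theorem diff_cons (b : OspBasis) (v : List OspBasis → M) (l : List OspBasis) :
    ρ.diff v (b :: l) = ρ.lie b v l - ρ.diff (contract 𝕜 b v) l := rfl

theorem contract_diff (b : OspBasis) (v : List OspBasis → M) :
    contract 𝕜 b (ρ.diff v) = ρ.lie b v - ρ.diff (contract 𝕜 b v) := rfl

/-- Induction on the argument list: contracting both sides with `c` and using Cartan's formula
leaves exactly the commutator `lie_lie`. -/
theorem lie_diff (b : OspBasis) (v : List OspBasis → M) :
    ρ.lie b (ρ.diff v) = ρ.diff (ρ.lie b v) := by
  funext l
  induction l generalizing v with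
  | nil => simp [lie_nil, diff_nil]
  | cons c l ih =>
    have ih := ih (contract 𝕜 c v)
    have h := congrFun (ρ.lie_lie b c v) l
    rw [diff_cons, contract_lie, lie_cons, contract_diff]
    simp only [diff_cons, map_sub, map_sum, map_smul, Pi.sub_apply, Pi.smul_apply,
      Finset.sum_apply, smul_sub, Finset.sum_sub_distrib, ih] at h ⊢
    rcases koszul_cases 𝕜 b c with hk | hk <;> rw [hk] at h ⊢
    · linear_combination (norm := module) h
    · linear_combination (norm := module) -h

/-- Cartan's formula and `lie_diff` give `ι_b d d = L_b d - d L_b + d d ι_b = d d ι_b`, so the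
induction on the list closes. -/
theorem diff_diff (v : List OspBasis → M) : ρ.diff (ρ.diff v) = 0 := by
  funext l
  induction l generalizing v with
  | nil => rfl
  | cons b l ih =>
    rw [diff_cons, contract_diff, map_sub, lie_diff]
    simp [ih]

end OspModule

/-! ### Graded antisymmetric cochains. -/

variable (𝕜) in
/-- Graded antisymmetry of a cochain. -/
def IsAlt (v : List OspBasis → M) : Prop :=
  ∀ (l₁ : List OspBasis) (b c : OspBasis) (l₂ : List OspBasis),
    v (l₁ ++ b :: c :: l₂) = -(koszul 𝕜 b c • v (l₁ ++ c :: b :: l₂))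

namespace IsAlt

theorem contract {v : List OspBasis → M} (hv : IsAlt 𝕜 v) (b : OspBasis) :
    IsAlt 𝕜 (contract 𝕜 b v) :=
  fun l₁ c d l₂ => hv (b :: l₁) c d l₂

theorem zero : IsAlt 𝕜 (0 : List OspBasis → M) := by
  intro l₁ b c l₂
  simp

theorem add {v w : List OspBasis → M} (hv : IsAlt 𝕜 v) (hw : IsAlt 𝕜 w) : IsAlt 𝕜 (v + w) := by
  intro l₁ b c l₂
  simp only [Pi.add_apply, hv l₁ b c l₂, hw l₁ b c l₂, smul_add]
  abel

theorem smul {v : List OspBasis → M} (r : 𝕜) (hv : IsAlt 𝕜 v) : IsAlt 𝕜 (r • v) := by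
  intro l₁ b c l₂
  simp only [Pi.smul_apply, hv l₁ b c l₂, smul_neg, smul_comm r]

theorem neg {v : List OspBasis → M} (hv : IsAlt 𝕜 v) : IsAlt 𝕜 (-v) := by
  simpa using hv.smul (-1 : 𝕜)

theorem sub {v w : List OspBasis → M} (hv : IsAlt 𝕜 v) (hw : IsAlt 𝕜 w) : IsAlt 𝕜 (v - w) := by
  simpa [sub_eq_add_neg] using hv.add hw.neg

theorem contract_contract {v : List OspBasis → M} (hv : IsAlt 𝕜 v) (b c : OspBasis) :
    OspCohomology.contract 𝕜 b (OspCohomology.contract 𝕜 c v) =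
      -(koszul 𝕜 b c • OspCohomology.contract 𝕜 c (OspCohomology.contract 𝕜 b v)) := by
  funext l
  simpa [koszul_comm 𝕜 b c] using hv [] c b l

variable (ρ : OspModule 𝕜 M)

theorem sum_brCoeff_contract {v : List OspBasis → M} (hv : IsAlt 𝕜 v) (b c d : OspBasis)
    (l : List OspBasis) :
    ∑ a, brCoeff 𝕜 b c a • v (a :: d :: l) =
      -((koszul 𝕜 b d * koszul 𝕜 c d) • ∑ a, brCoeff 𝕜 b c a • v (d :: a :: l)) := by
  rw [Finset.smul_sum, ← Finset.sum_neg_distrib]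
  refine Finset.sum_congr rfl fun a _ => ?_
  rw [show v (a :: d :: l) = _ from hv [] a d l, List.nil_append, smul_neg, smul_smul, brCoeff_mul_koszul, smul_smul, mul_comm]

theorem lie {v : List OspBasis → M} (hv : IsAlt 𝕜 v) (b : OspBasis) : IsAlt 𝕜 (ρ.lie b v) := by
  have main : ∀ (l₁ : List OspBasis) (c d : OspBasis) (l₂ : List OspBasis),
      ∀ v : List OspBasis → M, IsAlt 𝕜 v → ρ.lie b v (l₁ ++ c :: d :: l₂) =
        -(koszul 𝕜 c d • ρ.lie b v (l₁ ++ d :: c :: l₂)) := by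
    intro l₁
    induction l₁ with
    | nil =>
      intro c d l₂ v hv
      have h1 := hv.contract_contract c d
      have h2 := hv.sum_brCoeff_contract b c d l₂
      have h3 := hv.sum_brCoeff_contract b d c l₂
      simp only [List.nil_append, OspModule.lie_cons, contract_apply]
      rw [h1, h2, h3, map_neg, map_smul, koszul_comm 𝕜 d c]
      simp only [Pi.neg_apply, Pi.smul_apply]
      rcases koszul_cases 𝕜 b c with hk | hk <;> rcases koszul_cases 𝕜 b d with hk' | hk' <;>
        rcases koszul_cases 𝕜 c d with hk2 | hk2 <;> rw [hk, hk', hk2] <;> module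
    | cons a l₁ ih =>
      intro c d l₂ v hv
      simp only [List.cons_append, OspModule.lie_cons, ih c d l₂ _ (hv.contract a)]
      have h : ∀ e, v (e :: (l₁ ++ c :: d :: l₂)) =
          -(koszul 𝕜 c d • v (e :: (l₁ ++ d :: c :: l₂))) := fun e => hv (e :: l₁) c d l₂
      simp only [h, smul_neg, smul_sub, Finset.sum_neg_distrib, Finset.smul_sum,
        smul_comm (koszul 𝕜 c d)]
      abel
  exact fun l₁ c d l₂ => main l₁ c d l₂ v hv

theorem diff {v : List OspBasis → M} (hv : IsAlt 𝕜 v) : IsAlt 𝕜 (ρ.diff v) := by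
  have main : ∀ (l₁ : List OspBasis) (c d : OspBasis) (l₂ : List OspBasis),
      ∀ v : List OspBasis → M, IsAlt 𝕜 v → ρ.diff v (l₁ ++ c :: d :: l₂) =
        -(koszul 𝕜 c d • ρ.diff v (l₁ ++ d :: c :: l₂)) := by
    intro l₁
    induction l₁ with
    | nil =>
      intro c d l₂ v hv
      have h1 := hv.contract_contract d c
      have h2 : ∑ a, brCoeff 𝕜 c d a • v (a :: l₂) =
          -(koszul 𝕜 c d • ∑ a, brCoeff 𝕜 d c a • v (a :: l₂)) := by
        rw [Finset.smul_sum, ← Finset.sum_neg_distrib]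
        refine Finset.sum_congr rfl fun a _ => ?_
        rw [brCoeff_antisymm, smul_smul, neg_smul]
      simp only [List.nil_append, OspModule.diff_cons, OspModule.lie_cons]
      rw [h1, h2, map_neg, map_smul, koszul_comm 𝕜 d c]
      simp only [Pi.neg_apply, Pi.smul_apply]
      rcases koszul_cases 𝕜 c d with hk2 | hk2 <;> rw [hk2] <;> module
    | cons a l₁ ih =>
      intro c d l₂ v hv
      simp only [List.cons_append, OspModule.diff_cons, ih c d l₂ _ (hv.contract a),
        hv.lie ρ a l₁ c d l₂, smul_sub]
      abel
  exact fun l₁ c d l₂ => main l₁ c d l₂ v hv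

/-- The sign is left undetermined because the lemma serves only to transport vanishing. -/
theorem perm {v : List OspBasis → M} (hv : IsAlt 𝕜 v) {l l' : List OspBasis} (h : l.Perm l') :
    v l = v l' ∨ v l = -v l' := by
  induction h generalizing v with
  | nil => exact Or.inl rfl
  | cons b _ ih => exact ih (hv.contract b)
  | swap b c l =>
    have h := hv [] c b l
    rcases koszul_cases 𝕜 c b with hk | hk <;> rw [hk] at h <;> simp at h <;> simp [h]
  | trans _ _ ih₁ ih₂ =>
    rcases ih₁ hv with h₁ | h₁ <;> rcases ih₂ hv with h₂ | h₂ <;> simp [h₁, h₂]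

theorem eq_zero_of_perm {v : List OspBasis → M} (hv : IsAlt 𝕜 v) {l l' : List OspBasis}
    (h : l.Perm l') (h0 : v l' = 0) : v l = 0 := by
  rcases hv.perm h with h | h <;> simp [h, h0]

theorem even_twice {v : List OspBasis → M} (hv : IsAlt 𝕜 v) {b : OspBasis} (hb : b.parity = 0)
    (l : List OspBasis) : v (b :: b :: l) = 0 := by
  have h := hv [] b b l
  simp only [koszul, hb, List.nil_append, mul_zero, pow_zero, one_smul] at h
  have h2 : (2 : 𝕜) • v (b :: b :: l) = 0 := by
    rw [two_smul]
    exact add_eq_zero_iff_eq_neg.mpr h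
  simpa using h2

end IsAlt

/-- A cochain is determined by its values on sorted lists; here is the case of a cochain that
vanishes when contracted with `A` and `X`. -/
theorem IsAlt.eq_zero {v : List OspBasis → M} (hv : IsAlt 𝕜 v)
    (hA : OspCohomology.contract 𝕜 .A v = 0) (hX : OspCohomology.contract 𝕜 .X v = 0)
    (h0 : ∀ n, v (List.replicate n .B) = 0)
    (hH : ∀ n, v (.H :: List.replicate n .B) = 0)
    (hY : ∀ n, v (.Y :: List.replicate n .B) = 0)
    (hHY : ∀ n, v (.H :: .Y :: List.replicate n .B) = 0) : v = 0 := by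
  funext l
  have key : ∀ a ∈ l, v l ≠ 0 → v (a :: l.erase a) ≠ 0 := by
    intro a ha hne h
    exact hne (hv.eq_zero_of_perm (List.perm_cons_erase ha) h)
  by_contra hne
  have hne : v l ≠ 0 := hne
  have hAl : OspBasis.A ∉ l := fun h => key _ h hne (congrFun hA _)
  have hXl : OspBasis.X ∉ l := fun h => key _ h hne (congrFun hX _)
  -- Two copies of an even vector could be moved to the front, where `even_twice` kills the value.
  -- The odd vector `B` may repeat, so four families of sorted lists remain.
  have hlt : ∀ b : OspBasis, b.parity = 0 → l.count b = 0 ∨ l.count b = 1 := by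
    intro b hb
    by_contra hlt
    obtain ⟨t, ht⟩ := (List.replicate_sublist_iff.mpr
      (show 2 ≤ l.count b by omega)).exists_perm_append
    exact hne (hv.eq_zero_of_perm ht (hv.even_twice hb t))
  have hperm : ∀ l' : List OspBasis, (∀ a, l.count a = l'.count a) → v l' ≠ 0 :=
    fun l' h h' => hne (hv.eq_zero_of_perm (List.perm_iff_count.mpr h) h')
  have hcA := List.count_eq_zero_of_not_mem hAl
  have hcX := List.count_eq_zero_of_not_mem hXl
  rcases hlt .H rfl with h | h <;> rcases hlt .Y rfl with h' | h'
  · exact hperm _ (fun a => by cases a <;> simp [h, h', hcA, hcX, List.count_replicate])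
      (h0 (l.count .B))
  · exact hperm _ (fun a => by cases a <;> simp [h, h', hcA, hcX, List.count_replicate])
      (hY (l.count .B))
  · exact hperm _ (fun a => by cases a <;> simp [h, h', hcA, hcX, List.count_replicate])
      (hH (l.count .B))
  · exact hperm _ (fun a => by cases a <;> simp [h, h', hcA, hcX, List.count_replicate])
      (hHY (l.count .B))

end Calculus

/-! ### Comparison of the recursive coboundary with the alternating sum. -/

theorem neg_one_pow_eq_of_even_add {R : Type*} [Ring R] {a b : ℕ} (h : Even (a + b)) :
    (-1 : R) ^ a = (-1) ^ b :=
  neg_one_pow_congr (Nat.even_add.mp h)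

theorem sum_Iio_succ_cons {n : ℕ} (b : OspBasis) (κ : Fin n → OspBasis) (i : Fin n) :
    ∑ l ∈ Finset.Iio i.succ, ((Fin.cons b κ : Fin (n + 1) → OspBasis) l).parity =
      b.parity + ∑ l ∈ Finset.Iio i, (κ l).parity := by
  have h : Finset.Iio i.succ = insert 0 ((Finset.Iio i).map (Fin.succEmb n)) := by
    ext l
    refine Fin.cases ?_ (fun l => ?_) l <;> simp [Fin.succ_pos]
  rw [h, Finset.sum_insert (by simp), Finset.sum_map]
  simp only [Fin.cons_zero, Fin.coe_succEmb, Fin.cons_succ]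

theorem sum_Iio_erase_succ_cons {n : ℕ} (b : OspBasis) (κ : Fin n → OspBasis) (i k : Fin n) :
    ∑ l ∈ (Finset.Iio i.succ).erase k.succ,
        ((Fin.cons b κ : Fin (n + 1) → OspBasis) l).parity =
      b.parity + ∑ l ∈ (Finset.Iio i).erase k, (κ l).parity := by
  have h : (Finset.Iio i.succ).erase k.succ =
      insert 0 (((Finset.Iio i).erase k).map (Fin.succEmb n)) := by
    ext l
    refine Fin.cases ?_ (fun l => ?_) l
    · simp [Fin.succ_pos, (Fin.succ_ne_zero k).symm]
    · simp
  rw [h, Finset.sum_insert (by simp), Finset.sum_map]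
  simp only [Fin.cons_zero, Fin.coe_succEmb, Fin.cons_succ]

theorem sum_Iio_erase_zero_cons {n : ℕ} (b : OspBasis) (κ : Fin n → OspBasis) (i : Fin n) :
    ∑ l ∈ (Finset.Iio i.succ).erase 0,
        ((Fin.cons b κ : Fin (n + 1) → OspBasis) l).parity =
      ∑ l ∈ Finset.Iio i, (κ l).parity := by
  have h : (Finset.Iio i.succ).erase 0 = (Finset.Iio i).map (Fin.succEmb n) := by
    ext l
    refine Fin.cases ?_ (fun l => ?_) l <;> simp [Fin.succ_pos]
  rw [h, Finset.sum_map]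
  simp only [Fin.coe_succEmb, Fin.cons_succ]

theorem Iio_zero_fin (n : ℕ) : Finset.Iio (0 : Fin (n + 1)) = ∅ := by
  ext l
  simp

theorem cons_comp_succAbove_succ {n : ℕ} (b : OspBasis) (κ : Fin (n + 1) → OspBasis)
    (i : Fin (n + 1)) :
    (fun t => (Fin.cons b κ : Fin (n + 2) → OspBasis) (i.succ.succAbove t)) =
      Fin.cons b fun t => κ (i.succAbove t) := by
  funext t
  refine Fin.cases ?_ (fun t => ?_) t <;> simp

section Bridge

variable {𝕜 M : Type*} [RCLike 𝕜] [AddCommGroup M] [Module 𝕜 M]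

namespace OspModule

variable (ρ : OspModule 𝕜 M)

/-- The first sum in the coboundary of a cochain given by its values on lists. -/
def listActionTerm {n : ℕ} (v : List OspBasis → M) (κ : Fin (n + 1) → OspBasis) : M :=
  ∑ i : Fin (n + 1), (-1 : 𝕜) ^ ((i : ℕ) + (κ i).parity *
      (∑ l ∈ Finset.Iio i, (κ l).parity + ∑ t, (κ (i.succAbove t)).parity)) •
    ρ.twist (κ i) (v (List.ofFn fun t => κ (i.succAbove t)))

variable (𝕜) in
/-- The part of the second sum in the coboundary that involves the brackets with `b`. -/
def listBracketRow {n : ℕ} (b : OspBasis) (v : List OspBasis → M)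
    (κ : Fin (n + 1) → OspBasis) : M :=
  ∑ j : Fin (n + 1), (-1 : 𝕜) ^ ((j : ℕ) + 1 + (κ j).parity *
      ∑ l ∈ Finset.Iio j, (κ l).parity) •
    ∑ a, brCoeff 𝕜 b (κ j) a • v (a :: List.ofFn fun t => κ (j.succAbove t))

variable (𝕜) in
/-- The second sum in the coboundary of a cochain given by its values on lists. -/
def listBracketTerm {n : ℕ} (v : List OspBasis → M) (κ : Fin (n + 2) → OspBasis) : M :=
  ∑ j : Fin (n + 2), ∑ i : Fin (n + 1), if i.castSucc < j then
    (-1 : 𝕜) ^ ((i : ℕ) + (j : ℕ)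
        + (κ i.castSucc).parity * ∑ l ∈ Finset.Iio i.castSucc, (κ l).parity
        + (κ j).parity * ∑ l ∈ (Finset.Iio j).erase i.castSucc, (κ l).parity) •
      ∑ a, brCoeff 𝕜 (κ i.castSucc) (κ j) a •
        v (a :: List.ofFn fun t => κ (j.succAbove (i.succAbove t))) else 0

theorem listActionTerm_zero (v : List OspBasis → M) (b : OspBasis) (κ : Fin 0 → OspBasis) :
    ρ.listActionTerm v (Fin.cons b κ : Fin 1 → OspBasis) = ρ.twist b (v []) := by
  simp [listActionTerm, Iio_zero_fin]

theorem listActionTerm_cons {n : ℕ} (v : List OspBasis → M) (b : OspBasis)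
    (κ : Fin (n + 1) → OspBasis) :
    ρ.listActionTerm v (Fin.cons b κ : Fin (n + 2) → OspBasis) =
      (-1 : 𝕜) ^ (b.parity * ∑ t, (κ t).parity) • ρ.twist b (v (List.ofFn κ)) -
        ρ.listActionTerm (contract 𝕜 b v) κ := by
  rw [listActionTerm, Fin.sum_univ_succ, sub_eq_add_neg, listActionTerm,
    ← Finset.sum_neg_distrib]
  congr 1
  · simp [Iio_zero_fin]
  · refine Finset.sum_congr rfl fun i _ => ?_
    rw [sum_Iio_succ_cons, cons_comp_succAbove_succ]
    have h : ∑ t, ((Fin.cons b κ : Fin (n + 2) → OspBasis) (i.succ.succAbove t)).parity =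
        ∑ t, ((Fin.cons b fun t => κ (i.succAbove t) : Fin (n + 1) → OspBasis) t).parity :=
      Finset.sum_congr rfl fun t _ =>
        congrArg OspBasis.parity (congrFun (cons_comp_succAbove_succ b κ i) t)
    rw [h, Fin.sum_univ_succ]
    simp only [Fin.cons_zero, Fin.cons_succ, List.ofFn_succ, contract_apply, Fin.val_succ]
    rw [← neg_smul, neg_eq_neg_one_mul ((-1 : 𝕜) ^ _), ← pow_succ']
    congr 1
    apply neg_one_pow_eq_of_even_add
    exact ⟨i + 1 + (κ i).parity * (b.parity + ∑ l ∈ Finset.Iio i, (κ l).parity +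
      ∑ t, (κ (i.succAbove t)).parity), by ring⟩

theorem listBracketRow_zero (b c : OspBasis) (v : List OspBasis → M) (κ : Fin 0 → OspBasis) :
    listBracketRow 𝕜 b v (Fin.cons c κ : Fin 1 → OspBasis) = -∑ a, brCoeff 𝕜 b c a • v [a] := by
  simp [listBracketRow, Iio_zero_fin]

theorem listBracketRow_cons {n : ℕ} (b c : OspBasis) {v : List OspBasis → M} (hv : IsAlt 𝕜 v)
    (κ : Fin (n + 1) → OspBasis) :
    listBracketRow 𝕜 b v (Fin.cons c κ : Fin (n + 2) → OspBasis) =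
      koszul 𝕜 b c • listBracketRow 𝕜 b (contract 𝕜 c v) κ -
        ∑ a, brCoeff 𝕜 b c a • v (a :: List.ofFn κ) := by
  rw [listBracketRow, Fin.sum_univ_succ, sub_eq_neg_add, listBracketRow, Finset.smul_sum (r := koszul 𝕜 b c)]
  congr 1
  · simp [Iio_zero_fin]
  · refine Finset.sum_congr rfl fun i _ => ?_
    rw [sum_Iio_succ_cons, cons_comp_succAbove_succ]
    simp only [Fin.cons_succ, List.ofFn_succ, contract_apply, Fin.val_succ, Fin.cons_zero]
    rw [hv.sum_brCoeff_contract, smul_neg, smul_smul, smul_smul, ← neg_smul]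
    congr 1
    rw [koszul, koszul]
    rcases neg_one_pow_eq_or 𝕜 (b.parity * c.parity) with h | h <;> rw [h] <;>
    rw [mul_add, pow_add _ ((i : ℕ) + 1 + 1), pow_add _ ((i : ℕ) + 1), pow_add _ ((i : ℕ) + 1),
      pow_add _ ((κ i).parity * c.parity)] <;>
    rcases neg_one_pow_eq_or 𝕜 ((κ i).parity * c.parity) with h' | h' <;> rw [h'] <;> ring

theorem listBracketTerm_zero (v : List OspBasis → M) (b : OspBasis) (κ : Fin 1 → OspBasis) :
    listBracketTerm 𝕜 v (Fin.cons b κ : Fin 2 → OspBasis) = listBracketRow 𝕜 b v κ := by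
  rw [listBracketTerm, Fin.sum_univ_succ, listBracketRow]
  simp [sum_Iio_erase_zero_cons, Iio_zero_fin]

theorem listBracketTerm_cons {n : ℕ} {v : List OspBasis → M} (hv : IsAlt 𝕜 v) (b : OspBasis)
    (κ : Fin (n + 2) → OspBasis) :
    listBracketTerm 𝕜 v (Fin.cons b κ : Fin (n + 3) → OspBasis) =
      listBracketRow 𝕜 b v κ - listBracketTerm 𝕜 (contract 𝕜 b v) κ := by
  rw [listBracketTerm, Fin.sum_univ_succ, listBracketRow, listBracketTerm, sub_eq_add_neg,
    ← Finset.sum_neg_distrib, ← Finset.sum_add_distrib, ← Finset.sum_add_distrib]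
  refine Finset.sum_congr rfl fun j _ => ?_
  rw [if_neg (Fin.not_lt_zero _), zero_add]
  rw [Fin.sum_univ_succ, ← Finset.sum_neg_distrib]
  congr 1
  · have h : (0 : Fin (n + 2)).castSucc = 0 := rfl
    rw [h, if_pos (Fin.succ_pos j), sum_Iio_erase_zero_cons]
    simp [Iio_zero_fin]
  · refine Finset.sum_congr rfl fun i _ => ?_
    simp only [Fin.castSucc_succ, Fin.succ_lt_succ_iff, sum_Iio_erase_succ_cons,
      sum_Iio_succ_cons, Fin.cons_succ, Fin.val_succ]
    split_ifs with hij
    · have hf : (fun t => (Fin.cons b κ : Fin (n + 3) → OspBasis)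
          (j.succ.succAbove (i.succ.succAbove t))) =
          Fin.cons b fun t => κ (j.succAbove (i.succAbove t)) := by
        funext t
        refine Fin.cases ?_ (fun t => ?_) t <;> simp
      rw [hf]
      simp only [List.ofFn_succ, Fin.cons_zero, Fin.cons_succ, contract_apply]
      rw [hv.sum_brCoeff_contract, smul_neg, smul_smul, ← neg_smul, ← neg_smul]
      congr 1
      rw [koszul, koszul]
      rw [← pow_add, ← pow_add]
      congr 1
      apply neg_one_pow_eq_of_even_add
      exact ⟨i + j + 1 + (κ i.castSucc).parity * b.parity + (κ j).parity * b.parity +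
        (κ i.castSucc).parity * ∑ l ∈ Finset.Iio i.castSucc, (κ l).parity +
        (κ j).parity * ∑ l ∈ (Finset.Iio j).erase i.castSucc, (κ l).parity, by ring⟩
    · simp

/-- Unrolling the recursion puts the bracket `[b, κ j]` in position `j`; antisymmetry moves it to
the front, which yields the signs of `listBracketRow`. -/
theorem lie_ofFn {n : ℕ} (b : OspBasis) {v : List OspBasis → M} (hv : IsAlt 𝕜 v)
    (κ : Fin (n + 1) → OspBasis) : ρ.lie b v (List.ofFn κ) =
      (-1 : 𝕜) ^ (b.parity * ∑ t, (κ t).parity) • ρ.twist b (v (List.ofFn κ)) +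
        listBracketRow 𝕜 b v κ := by
  induction n generalizing v with
  | zero =>
    obtain ⟨c, κ, rfl⟩ : ∃ c κ', κ = Fin.cons c κ' := ⟨κ 0, Fin.tail κ, by simp⟩
    rw [listBracketRow_zero]
    simp [lie_cons, lie_nil, koszul, sub_eq_add_neg]
  | succ n ih =>
    obtain ⟨c, κ, rfl⟩ : ∃ c κ', κ = Fin.cons c κ' := ⟨κ 0, Fin.tail κ, by simp⟩
    rw [listBracketRow_cons b c hv, Fin.sum_univ_succ, List.ofFn_succ]
    simp only [Fin.cons_zero, Fin.cons_succ]
    rw [lie_cons, ih (hv.contract c), koszul, mul_add, pow_add, contract_apply]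
    module

theorem diff_ofFn_one (v : List OspBasis → M) (κ : Fin 1 → OspBasis) :
    ρ.diff v (List.ofFn κ) = ρ.listActionTerm v κ := by
  obtain ⟨c, κ, rfl⟩ : ∃ c κ', κ = Fin.cons c κ' := ⟨κ 0, Fin.tail κ, by simp⟩
  rw [listActionTerm_zero]
  simp [diff_cons, lie_nil, diff_nil]

/-- Separate the first argument `c`: the terms in which it acts or is bracketed make up `L_c`, and
the others form minus the coboundary of `ι_c v`. This is the recursion that defines `diff`. -/
theorem diff_ofFn {n : ℕ} {v : List OspBasis → M} (hv : IsAlt 𝕜 v) (κ : Fin (n + 2) → OspBasis) :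
    ρ.diff v (List.ofFn κ) = ρ.listActionTerm v κ + listBracketTerm 𝕜 v κ := by
  induction n generalizing v with
  | zero =>
    obtain ⟨c, κ, rfl⟩ : ∃ c κ', κ = Fin.cons c κ' := ⟨κ 0, Fin.tail κ, by simp⟩
    rw [listBracketTerm_zero, listActionTerm_cons, List.ofFn_succ]
    simp only [Fin.cons_zero, Fin.cons_succ]
    rw [diff_cons, diff_ofFn_one, lie_ofFn ρ c hv]
    abel
  | succ n ih =>
    obtain ⟨c, κ, rfl⟩ : ∃ c κ', κ = Fin.cons c κ' := ⟨κ 0, Fin.tail κ, by simp⟩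
    rw [listBracketTerm_cons hv, listActionTerm_cons, List.ofFn_succ]
    simp only [Fin.cons_zero, Fin.cons_succ]
    rw [diff_cons, ih (hv.contract c), lie_ofFn ρ c hv]
    abel

end OspModule

end Bridge

/-! ### Dictionary between multilinear maps and functions of lists. -/

section Bridge

variable {𝕜 M : Type*} [RCLike 𝕜] [AddCommGroup M] [Module 𝕜 M]

/-- The operator `diff` is homogeneous of degree one, so statements about functions of all lists can
be restricted to a single degree. -/
theorem OspModule.diff_congr (ρ : OspModule 𝕜 M) {v w : List OspBasis → M} {n : ℕ}
    (h : ∀ l, l.length = n → v l = w l) (l : List OspBasis) (hl : l.length = n + 1) :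
    ρ.diff v l = ρ.diff w l := by
  have hlie : ∀ (b : OspBasis) (l : List OspBasis) (v w : List OspBasis → M) (n : ℕ),
      (∀ l, l.length = n → v l = w l) → l.length = n → ρ.lie b v l = ρ.lie b w l := by
    intro b l
    induction l with
    | nil =>
      rintro v w n h rfl
      rw [ρ.lie_nil, ρ.lie_nil, h [] rfl]
    | cons c l ih =>
      rintro v w n h rfl
      rw [ρ.lie_cons, ρ.lie_cons, ih (contract 𝕜 c v) (contract 𝕜 c w) l.length
        (fun l' hl' => h (c :: l') (by simp [hl'])) rfl]
      congr 1
      exact Finset.sum_congr rfl fun a _ => by rw [h (a :: l) (by simp)]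
  induction l generalizing v w n with
  | nil => simp at hl
  | cons b l ih =>
    have hl : l.length = n := by simpa using hl
    rw [ρ.diff_cons, ρ.diff_cons, hlie b l v w n h hl]
    congr 1
    cases n with
    | zero =>
      rw [List.eq_nil_of_length_eq_zero hl, ρ.diff_nil, ρ.diff_nil]
    | succ n => exact ih (fun l' hl' => h (b :: l') (by simp [hl'])) hl

namespace OspModule

variable (ρ : OspModule 𝕜 M)

theorem sum_proj (e : ℕ) (m : M) :
    ∑ q ∈ Finset.range 2, ρ.proj (q + e) m = m := by
  simp only [Finset.sum_range_succ, Finset.sum_range_zero, proj, LinearMap.smul_apply,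
    LinearMap.add_apply, LinearMap.id_apply, pow_add, pow_zero, pow_one]
  module

/-- On the component of parity `q` the value has parity `q + e`, so `(-1)^(bq)` equals `(-1)^(be)`
times the sign by which the grading involution, used when `b` is odd, acts on this value. Summing
over `q` restores `m` and leaves the twisted action. -/
theorem sum_sign_act_proj (b : OspBasis) (e s : ℕ) (m : M) :
    ∑ q ∈ Finset.range 2, (-1 : 𝕜) ^ (b.parity * (q + s)) • ρ.act b (ρ.proj (q + e) m) =
      (-1 : 𝕜) ^ (b.parity * (s + e)) • ρ.twist b m := by
  simp only [Finset.sum_range_succ, Finset.sum_range_zero, proj, LinearMap.smul_apply,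
    LinearMap.add_apply, LinearMap.id_apply, twist_apply, map_smul, map_add]
  rcases DiffOp.parity_cases b with h | h <;> rw [h] <;>
    simp only [zero_mul, one_mul, pow_zero, pow_one, pow_add, Module.End.one_apply] <;>
    rcases neg_one_pow_eq_or 𝕜 e with he | he <;> rw [he] <;> module

end OspModule

/-- The part of a cochain in degree `n`. -/
def degreePart (n : ℕ) (v : List OspBasis → M) : List OspBasis → M :=
  fun l => if l.length = n then v l else 0

theorem degreePart_apply {n : ℕ} (v : List OspBasis → M) {l : List OspBasis}
    (hl : l.length = n) : degreePart n v l = v l := if_pos hl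

theorem IsAlt.degreePart {v : List OspBasis → M} (hv : IsAlt 𝕜 v) (n : ℕ) :
    IsAlt 𝕜 (degreePart n v) := by
  intro l₁ b c l₂
  by_cases h : (l₁ ++ b :: c :: l₂).length = n
  · rw [degreePart_apply v h, degreePart_apply v (by simpa using h), hv]
  · have h' : ¬(l₁ ++ c :: b :: l₂).length = n := by simpa using h
    simp only [OspCohomology.degreePart, if_neg h, if_neg h', smul_zero, neg_zero]

theorem OspModule.diff_degreePart (ρ : OspModule 𝕜 M) (n : ℕ) (v : List OspBasis → M) :
    ρ.diff (degreePart n v) = degreePart (n + 1) (ρ.diff v) := by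
  funext l
  by_cases h : l.length = n + 1
  · rw [degreePart_apply _ h]
    exact ρ.diff_congr (fun l hl => degreePart_apply v hl) l h
  · rw [degreePart, if_neg h]
    cases l with
    | nil => rfl
    | cons b l =>
      have h0 := ρ.diff_congr (v := degreePart n v) (w := 0) (n := l.length)
        (fun l' hl' => if_neg (fun h' => h (by simp [← hl', h']))) (b :: l) (by simp)
      simpa using h0

variable [Module ℝ M] [IsScalarTower ℝ 𝕜 M]

/-- The values of a multilinear map on lists of basis vectors. -/
def toList {n : ℕ} (f : MultilinearMap ℝ (fun _ : Fin n => Osp) M) : List OspBasis → M :=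
  fun l => if h : l.length = n then f (fun i => Osp.e (l.get (i.cast h.symm))) else 0

/-- The multilinear map with prescribed values on lists of basis vectors. -/
def ofList (n : ℕ) (v : List OspBasis → M) : MultilinearMap ℝ (fun _ : Fin n => Osp) M :=
  ofBasis fun κ => v (List.ofFn κ)

theorem toList_ofFn {n : ℕ} (f : MultilinearMap ℝ (fun _ : Fin n => Osp) M)
    (κ : Fin n → OspBasis) : toList f (List.ofFn κ) = f fun i => Osp.e (κ i) := by
  simp [toList]

theorem toList_of_length_ne {n : ℕ} (f : MultilinearMap ℝ (fun _ : Fin n => Osp) M)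
    {l : List OspBasis} (h : l.length ≠ n) : toList f l = 0 := dif_neg h

theorem toList_ofList {n : ℕ} (v : List OspBasis → M) :
    toList (ofList n v) = degreePart n v := by
  funext l
  by_cases h : l.length = n
  · subst h
    rw [degreePart_apply v rfl, toList, dif_pos rfl]
    exact (ofBasis_e _ _).trans (congrArg v (List.ofFn_get l))
  · rw [toList_of_length_ne _ h, degreePart, if_neg h]

theorem multilinear_ext {n : ℕ} {f g : MultilinearMap ℝ (fun _ : Fin n => Osp) M}
    (h : ∀ κ : Fin n → OspBasis, (f fun i => Osp.e (κ i)) = g fun i => Osp.e (κ i)) : f = g := by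
  refine Module.Basis.ext_multilinear (fun _ => Pi.basisFun ℝ OspBasis) fun κ => ?_
  simpa [Osp.e] using h κ

theorem toList_injective {n : ℕ} {f g : MultilinearMap ℝ (fun _ : Fin n => Osp) M}
    (h : toList f = toList g) : f = g :=
  multilinear_ext fun κ => by rw [← toList_ofFn, ← toList_ofFn, h]

theorem ofList_toList {n : ℕ} (f : MultilinearMap ℝ (fun _ : Fin n => Osp) M) :
    ofList n (toList f) = f :=
  multilinear_ext fun κ => by rw [ofList, ofBasis_e, toList_ofFn]

theorem toList_sub {n : ℕ} (f g : MultilinearMap ℝ (fun _ : Fin n => Osp) M) :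
    toList (f - g) = toList f - toList g := by
  funext l
  by_cases h : l.length = n <;> simp [toList, h]

theorem toList_add {n : ℕ} (f g : MultilinearMap ℝ (fun _ : Fin n => Osp) M) :
    toList (f + g) = toList f + toList g := by
  funext l
  by_cases h : l.length = n <;> simp [toList, h]

theorem toList_smul {n : ℕ} (r : 𝕜) (f : MultilinearMap ℝ (fun _ : Fin n => Osp) M) :
    toList (r • f) = r • toList f := by
  funext l
  by_cases h : l.length = n <;> simp [toList, h]

theorem ofFn_swap {n : ℕ} (κ : Fin n → OspBasis) (i j : Fin n) (hij : (i : ℕ) + 1 = j) :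
    ∃ l₁ l₂ : List OspBasis, l₁.length = (i : ℕ) ∧ List.ofFn κ = l₁ ++ κ i :: κ j :: l₂ ∧
      List.ofFn (κ ∘ Equiv.swap i j) = l₁ ++ κ j :: κ i :: l₂ := by
  induction n with
  | zero => exact i.elim0
  | succ n ih =>
    obtain ⟨b, κ, rfl⟩ : ∃ c κ', κ = Fin.cons c κ' := ⟨κ 0, Fin.tail κ, by simp⟩
    obtain ⟨j, rfl⟩ := Fin.exists_succ_eq.mpr (show j ≠ 0 by rintro rfl; simp at hij)
    refine Fin.cases (fun hij => ?_) (fun i hij => ?_) i hij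
    · obtain ⟨n, rfl⟩ : ∃ m, n = m + 1 := ⟨n - 1, by have := j.2; omega⟩
      have hj : j = 0 := Fin.ext (by simpa using hij.symm)
      subst hj
      refine ⟨[], List.ofFn (Fin.tail κ), rfl, by simp [List.ofFn_succ, Fin.tail_def], ?_⟩
      rw [List.ofFn_succ, List.ofFn_succ]
      simp only [Function.comp_apply, Equiv.swap_apply_left, Equiv.swap_apply_right,
        List.nil_append, Fin.cons_zero, Fin.cons_succ]
      congr 3
    · obtain ⟨l₁, l₂, h1, h2, h3⟩ := ih κ i j (by simpa using hij)
      refine ⟨b :: l₁, l₂, by simp [h1], by simp [List.ofFn_succ, h2], ?_⟩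
      rw [List.ofFn_succ]
      have h0 : Equiv.swap i.succ j.succ 0 = 0 :=
        Equiv.swap_apply_of_ne_of_ne (Fin.succ_ne_zero _).symm (Fin.succ_ne_zero _).symm
      simp only [Function.comp_apply, h0, Fin.cons_zero, List.cons_append, Fin.cons_succ]
      rw [← h3]
      congr 2
      funext t
      by_cases hi : t = i
      · subst hi
        simp
      · by_cases hj : t = j
        · subst hj
          simp
        · rw [Function.comp_apply, Equiv.swap_apply_of_ne_of_ne hi hj,
            Equiv.swap_apply_of_ne_of_ne (fun h => hi (Fin.succ_injective _ h))
              (fun h => hj (Fin.succ_injective _ h)), Fin.cons_succ]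

theorem grade_apply_eq_zero {p : ℕ} {U : Osp} (hU : U ∈ Osp.grade p) {b : OspBasis}
    (hb : b.parity ≠ p) : U b = 0 := by
  induction hU using Submodule.span_induction with
  | mem x hx =>
    obtain ⟨c, hc, rfl⟩ := hx
    have : b ≠ c := by rintro rfl; exact hb hc
    simp [Osp.e, this]
  | zero => rfl
  | add x y _ _ hx hy => simp [hx, hy]
  | smul r x _ hx => simp [hx]

theorem e_mem_grade (b : OspBasis) : Osp.e b ∈ Osp.grade b.parity :=
  Submodule.subset_span ⟨b, rfl, rfl⟩

/-- Antisymmetry on basis vectors suffices: in the expansion of `f U` the swap permutes the index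
tuples, and a tuple whose parities at `i`, `j` differ from those of `U i`, `U j` has coefficient
zero. -/
theorem mem_cochains_iff {n : ℕ} (f : MultilinearMap ℝ (fun _ : Fin n => Osp) M) :
    f ∈ cochains 𝕜 M n ↔ IsAlt 𝕜 (toList f) := by
  constructor
  · intro hf l₁ b c l₂
    by_cases hn : (l₁ ++ b :: c :: l₂).length = n
    · obtain ⟨l, hl⟩ : ∃ l, l = l₁ ++ b :: c :: l₂ := ⟨_, rfl⟩
      rw [← hl] at hn ⊢
      subst hn
      obtain ⟨i, hi⟩ : ∃ i : Fin l.length, (i : ℕ) = l₁.length := ⟨⟨l₁.length, by simp [hl]⟩, rfl⟩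
      obtain ⟨j, hj⟩ : ∃ j : Fin l.length, (j : ℕ) = l₁.length + 1 :=
        ⟨⟨l₁.length + 1, by simp [hl]⟩, rfl⟩
      have hij : (i : ℕ) + 1 = j := by rw [hi, hj]
      obtain ⟨k₁, k₂, h1, h2, h3⟩ := ofFn_swap l.get i j hij
      rw [List.ofFn_get] at h2
      obtain ⟨h4, h5⟩ := List.append_inj (hl.symm.trans h2) (by rw [h1, hi])
      obtain ⟨hb, hc, h6⟩ : b = l.get i ∧ c = l.get j ∧ l₂ = k₂ := by simpa using h5
      have key := hf (fun t => Osp.e ((l.get ∘ Equiv.swap i j) t))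
        _ (fun t => e_mem_grade _) i j hij
      have h7 : (fun t => Osp.e ((l.get ∘ Equiv.swap i j) t)) ∘ Equiv.swap i j =
          fun t => Osp.e (l.get t) := by
        funext t
        simp
      have h8 := toList_ofFn f l.get
      rw [List.ofFn_get] at h8
      rw [h7] at key
      rw [h4, h6, hb, hc, ← h3, toList_ofFn, h8, key, koszul, mul_comm]
      simp
    · have hl' : (l₁ ++ c :: b :: l₂).length ≠ n := by simpa using hn
      rw [toList_of_length_ne f hn, toList_of_length_ne f hl', smul_zero, neg_zero]
  · intro hf U p hU i j hij
    have hF : ∀ V : Fin n → Osp, f V = ∑ κ : Fin n → OspBasis,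
        (∏ i, V i (κ i)) • toList f (List.ofFn κ) := by
      intro V
      conv_lhs => rw [← ofList_toList f]
      exact ofBasis_apply _ V
    rw [hF, hF, ← (Equiv.arrowCongr (Equiv.swap i j) (Equiv.refl OspBasis)).sum_comp,
      Finset.smul_sum, ← Finset.sum_neg_distrib]
    refine Finset.sum_congr rfl fun κ _ => ?_
    have hc : (Equiv.arrowCongr (Equiv.swap i j) (Equiv.refl OspBasis)) κ =
        κ ∘ Equiv.swap i j := by
      funext t
      simp
    have hp : ∏ t, (U ∘ Equiv.swap i j) t ((κ ∘ Equiv.swap i j) t) = ∏ t, U t (κ t) :=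
      Equiv.prod_comp (Equiv.swap i j) fun t => U t (κ t)
    rw [hc, hp]
    by_cases hκ : (κ i).parity = p i ∧ (κ j).parity = p j
    · obtain ⟨l₁, l₂, -, h2, h3⟩ := ofFn_swap κ i j hij
      rw [h2, h3, hf l₁ (κ j) (κ i) l₂, koszul, hκ.1, hκ.2, mul_comm (p j), smul_neg,
        smul_comm]
    · have h0 : ∏ t, U t (κ t) = 0 := by
        rcases not_and_or.mp hκ with h | h
        · exact Finset.prod_eq_zero (Finset.mem_univ i) (grade_apply_eq_zero (hU i) h)
        · exact Finset.prod_eq_zero (Finset.mem_univ j) (grade_apply_eq_zero (hU j) h)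
      simp [h0]

namespace OspModule

variable (ρ : OspModule 𝕜 M)

theorem sum_component {n : ℕ} (f : MultilinearMap ℝ (fun _ : Fin n => Osp) M) :
    ∑ q ∈ Finset.range 2, ρ.component q f = f := by
  refine multilinear_ext fun κ => ?_
  rw [sum_apply]
  simp only [component_e, sum_proj]

theorem sum_actionTerm {n : ℕ} (f : MultilinearMap ℝ (fun _ : Fin n => Osp) M)
    (κ : Fin (n + 1) → OspBasis) :
    ∑ q ∈ Finset.range 2, ρ.actionTerm q (ρ.component q f) κ =
      ρ.listActionTerm (toList f) κ := by
  simp only [actionTerm]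
  rw [Finset.sum_comm, listActionTerm]
  refine Finset.sum_congr rfl fun i _ => ?_
  simp only [ρ.component_e _ f (fun t => κ (i.succAbove t)), toList_ofFn, pow_add (-1 : 𝕜) (i : ℕ),
    mul_smul, ← Finset.smul_sum, sum_sign_act_proj]

theorem sum_bracketTerm {n : ℕ} (f : MultilinearMap ℝ (fun _ : Fin n => Osp) M)
    (κ : Fin (n + 1) → OspBasis) :
    ∑ q ∈ Finset.range 2, bracketTerm 𝕜 (ρ.component q f) κ = bracketTerm 𝕜 f κ := by
  conv_rhs => rw [← ρ.sum_component f]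
  simp only [Finset.sum_range_succ, Finset.sum_range_zero, zero_add, bracketTerm_add]

theorem apply_cons_bracketBasis {n : ℕ} (f : MultilinearMap ℝ (fun _ : Fin (n + 1) => Osp) M)
    (b c : OspBasis) (κ : Fin n → OspBasis) :
    f (Fin.cons (Osp.bracketBasis b c) fun t => Osp.e (κ t)) =
      ∑ a, brCoeff 𝕜 b c a • toList f (a :: List.ofFn κ) := by
  have h : Osp.bracketBasis b c = ∑ a, Osp.bracketBasis b c a • Osp.e a := by
    funext d
    simp [Osp.e, Finset.sum_apply, Pi.single_apply]
  have h1 : ∀ w : Osp, f (Fin.cons w fun t => Osp.e (κ t)) =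
      f.curryLeft w fun t => Osp.e (κ t) := fun _ => rfl
  rw [h1]
  conv_lhs => rw [h]
  rw [map_sum, sum_apply]
  refine Finset.sum_congr rfl fun a _ => ?_
  rw [map_smul, smul_apply, ← h1, brCoeff, RCLike.real_smul_eq_coe_smul (K := 𝕜)]
  have h2 := toList_ofFn f (Fin.cons a κ)
  rw [List.ofFn_succ] at h2
  simp only [Fin.cons_zero, Fin.cons_succ] at h2
  rw [h2]
  congr 2
  funext t
  refine Fin.cases ?_ (fun t => ?_) t <;> simp

theorem bracketTerm_eq {n : ℕ} (f : MultilinearMap ℝ (fun _ : Fin (n + 1) => Osp) M)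
    (κ : Fin (n + 2) → OspBasis) :
    bracketTerm 𝕜 f κ = listBracketTerm 𝕜 (toList f) κ := by
  simp only [bracketTerm, listBracketTerm, Finset.sum_filter,
    apply_cons_bracketBasis (𝕜 := 𝕜) f _ _ fun t => κ (_)]

theorem toList_d {n : ℕ} {f : MultilinearMap ℝ (fun _ : Fin n => Osp) M}
    (hf : f ∈ cochains 𝕜 M n) : toList (ρ.d n f) = ρ.diff (toList f) := by
  have halt := (mem_cochains_iff f).mp hf
  -- The coboundary is concentrated in degree `n + 1`, so both sides need comparing only on tuples
  -- of that length.
  have h1 : ρ.diff (toList f) = degreePart (n + 1) (ρ.diff (toList f)) := by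
    rw [← diff_degreePart, ← toList_ofList, ofList_toList]
  rw [h1, ← toList_ofList]
  congr 1
  refine multilinear_ext fun κ => ?_
  rw [ofList, ofBasis_e]
  refine (ofBasis_e _ κ).trans ?_
  rw [Finset.sum_add_distrib, sum_actionTerm, sum_bracketTerm]
  cases n with
  | zero => rw [diff_ofFn_one, bracketTerm, add_zero]
  | succ n => rw [diff_ofFn ρ halt, bracketTerm_eq]

theorem mem_cocycles_iff {n : ℕ} (f : MultilinearMap ℝ (fun _ : Fin n => Osp) M) :
    f ∈ ρ.cocycles n ↔ IsAlt 𝕜 (toList f) ∧ ρ.diff (toList f) = 0 := by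
  rw [cocycles, Submodule.mem_inf, LinearMap.mem_ker, ← mem_cochains_iff]
  refine and_congr_right fun hf => ?_
  rw [← ρ.toList_d hf]
  constructor
  · intro h
    rw [h]
    funext l
    by_cases h : l.length = n + 1 <;> simp [toList, h]
  · intro h
    refine toList_injective (h.trans ?_)
    funext l
    by_cases h : l.length = n + 1 <;> simp [toList, h]

end OspModule

end Bridge

/-! ### Construction of cochains without `X`-component from free coordinates. -/

section Coordinates

variable {𝕜 M : Type*} [RCLike 𝕜] [AddCommGroup M] [Module 𝕜 M]

variable (𝕜) in
/-- The sign of moving an odd basis vector past `h` copies of `H` and `y` copies of `Y`. -/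
def boolSign (h y : Bool) : 𝕜 := (if h then -1 else 1) * (if y then -1 else 1)

variable (𝕜) in
/-- Contraction with a basis vector for cochains without `X`-component, in coordinates: the value
`φ h y a b` is the value of the cochain on `h` copies of `H`, `y` of `Y`, `a` of `A`, `b` of `B`. -/
def coordContract : OspBasis → (Bool → Bool → ℕ → ℕ → M) → (Bool → Bool → ℕ → ℕ → M)
  | .H, φ => fun h y a b => if h then 0 else φ true y a b
  | .X, _ => 0
  | .Y, φ => fun h y a b => if y then 0 else (if h then (-1 : 𝕜) else 1) • φ h true a b
  | .A, φ => fun h y a b => boolSign 𝕜 h y • φ h y (a + 1) b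
  | .B, φ => fun h y a b => boolSign 𝕜 h y • φ h y a (b + 1)

variable (𝕜) in
/-- The cochain without `X`-component with prescribed coordinates. -/
def ofCoord : List OspBasis → (Bool → Bool → ℕ → ℕ → M) → M
  | [], φ => φ false false 0 0
  | b :: l, φ => ofCoord l (coordContract 𝕜 b φ)

theorem coordContract_neg_smul (b : OspBasis) (r : 𝕜) (φ : Bool → Bool → ℕ → ℕ → M) :
    coordContract 𝕜 b (-(r • φ)) = -(r • coordContract 𝕜 b φ) := by
  funext h y a b'
  cases b <;> cases h <;> cases y <;> simp [coordContract, boolSign]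

theorem ofCoord_neg_smul (r : 𝕜) (φ : Bool → Bool → ℕ → ℕ → M) (l : List OspBasis) :
    ofCoord 𝕜 l (-(r • φ)) = -(r • ofCoord 𝕜 l φ) := by
  induction l generalizing φ with
  | nil => rfl
  | cons b l ih => rw [ofCoord, coordContract_neg_smul, ih, ofCoord]

/-- The contraction operators on coordinates already satisfy the graded relations, so arbitrary
coordinates produce an antisymmetric cochain. -/
theorem coordContract_comm (b c : OspBasis) (φ : Bool → Bool → ℕ → ℕ → M) :
    coordContract 𝕜 c (coordContract 𝕜 b φ) =
      -(koszul 𝕜 b c • coordContract 𝕜 b (coordContract 𝕜 c φ)) := by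
  funext h y a b'
  cases b <;> cases c <;> cases h <;> cases y <;>
    simp [coordContract, boolSign, koszul, OspBasis.parity]

theorem isAlt_ofCoord (φ : Bool → Bool → ℕ → ℕ → M) :
    IsAlt 𝕜 fun l => ofCoord 𝕜 l φ := by
  intro l₁ b c l₂
  induction l₁ generalizing φ with
  | nil =>
    change ofCoord 𝕜 l₂ _ = -(koszul 𝕜 b c • ofCoord 𝕜 l₂ _)
    rw [coordContract_comm, ofCoord_neg_smul]
  | cons a l₁ ih => exact ih (coordContract 𝕜 a φ)

theorem ofCoord_replicate (φ : Bool → Bool → ℕ → ℕ → M) (n : ℕ) :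
    ofCoord 𝕜 (List.replicate n .B) φ = φ false false 0 n := by
  induction n generalizing φ with
  | zero => rfl
  | succ n ih =>
    rw [List.replicate_succ, ofCoord, ih]
    simp [coordContract, boolSign]

theorem ofCoord_H (φ : Bool → Bool → ℕ → ℕ → M) (n : ℕ) :
    ofCoord 𝕜 (.H :: List.replicate n .B) φ = φ true false 0 n := by
  rw [ofCoord, ofCoord_replicate]
  simp [coordContract]

theorem ofCoord_Y (φ : Bool → Bool → ℕ → ℕ → M) (n : ℕ) :
    ofCoord 𝕜 (.Y :: List.replicate n .B) φ = φ false true 0 n := by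
  rw [ofCoord, ofCoord_replicate]
  simp [coordContract]

theorem ofCoord_HY (φ : Bool → Bool → ℕ → ℕ → M) (n : ℕ) :
    ofCoord 𝕜 (.H :: .Y :: List.replicate n .B) φ = φ true true 0 n := by
  rw [ofCoord, ofCoord_Y]
  simp [coordContract]

theorem contract_X_ofCoord (φ : Bool → Bool → ℕ → ℕ → M) :
    contract 𝕜 .X (fun l => ofCoord 𝕜 l φ) = 0 := by
  -- Taking the scalar `0` shows that zero coordinates give the zero cochain.
  have h := fun l => ofCoord_neg_smul (0 : 𝕜) (0 : Bool → Bool → ℕ → ℕ → M) l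
  funext l
  simpa [ofCoord, coordContract] using h l

theorem contract_A_iterate_ofCoord (φ : Bool → Bool → ℕ → ℕ → M) (k : ℕ) :
    (contract 𝕜 .A)^[k] (fun l => ofCoord 𝕜 l φ) =
      fun l => ofCoord 𝕜 l fun h y a b => boolSign 𝕜 h y ^ k • φ h y (a + k) b := by
  induction k generalizing φ with
  | zero => simp
  | succ k ih =>
    rw [Function.iterate_succ_apply]
    refine (ih (coordContract 𝕜 .A φ)).trans ?_
    simp only [coordContract, smul_smul, pow_succ, add_assoc]

theorem boolSign_mul_self (h y : Bool) : boolSign 𝕜 h y * boolSign 𝕜 h y = 1 := by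
  cases h <;> cases y <;> simp [boolSign]

/-- A cochain without `A`- and `X`-components is the `k`-fold contraction with `A` of a cochain
without `X`-component. -/
theorem exists_iterate_contract_A (k : ℕ) (p q s t : ℕ → M) :
    ∃ u : List OspBasis → M, IsAlt 𝕜 u ∧ contract 𝕜 .A u = 0 ∧ contract 𝕜 .X u = 0 ∧
      (∀ n, u (List.replicate n .B) = p n) ∧ (∀ n, u (.H :: List.replicate n .B) = q n) ∧
      (∀ n, u (.Y :: List.replicate n .B) = s n) ∧
      (∀ n, u (.H :: .Y :: List.replicate n .B) = t n) ∧
      ∃ g : List OspBasis → M, IsAlt 𝕜 g ∧ contract 𝕜 .X g = 0 ∧ (contract 𝕜 .A)^[k] g = u := by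
  set ψ : Bool → Bool → ℕ → M := fun h y => match h, y with
    | false, false => p
    | true, false => q
    | false, true => s
    | true, true => t with hψ
  have h0 : ∀ l, ofCoord 𝕜 l (0 : Bool → Bool → ℕ → ℕ → M) = 0 := fun l => by
    simpa using ofCoord_neg_smul (0 : 𝕜) (0 : Bool → Bool → ℕ → ℕ → M) l
  -- The coordinates of `u` are supported at `a = 0` and those of `g` at `a = k`. The factor
  -- `boolSign ^ k` in `g` cancels the sign produced by `k` contractions with `A`.
  refine ⟨fun l => ofCoord 𝕜 l fun h y a b => if a = 0 then ψ h y b else 0, isAlt_ofCoord _, ?_,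
    contract_X_ofCoord _, fun n => ?_, fun n => ?_, fun n => ?_, fun n => ?_,
    fun l => ofCoord 𝕜 l fun h y a b => if a = k then boolSign 𝕜 h y ^ k • ψ h y b else 0,
    isAlt_ofCoord _, contract_X_ofCoord _, ?_⟩
  · refine (contract_A_iterate_ofCoord _ 1).trans ?_
    funext l
    simp only [Nat.add_eq_zero_iff, one_ne_zero, and_false, if_false, smul_zero]
    exact h0 l
  · simp only [ofCoord_replicate, hψ, if_true]
  · simp only [ofCoord_H, hψ, if_true]
  · simp only [ofCoord_Y, hψ, if_true]
  · simp only [ofCoord_HY, hψ, if_true]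
  · rw [contract_A_iterate_ofCoord]
    funext l
    congr 1
    funext h y a b
    by_cases ha : a = 0
    · simp [ha, smul_smul, ← mul_pow, boolSign_mul_self]
    · simp [ha]

end Coordinates

/-! ### Values of the Lie derivatives and of the coboundary on sorted lists. -/

section Reduction

variable {𝕜 M : Type*} [RCLike 𝕜] [AddCommGroup M] [Module 𝕜 M] (ρ : OspModule 𝕜 M)

namespace OspModule

theorem contract_A_lie_A (v : List OspBasis → M) : contract 𝕜 .A (ρ.lie .A v) =
    -ρ.lie .A (contract 𝕜 .A v) - (2 : 𝕜) • contract 𝕜 .X v := by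
  rw [contract_lie, sum_ospBasis]
  norm_num [brCoeff_eq, structureConst, koszul, OspBasis.parity]

theorem contract_X_lie_A (v : List OspBasis → M) : contract 𝕜 .X (ρ.lie .A v) =
    ρ.lie .A (contract 𝕜 .X v) := by
  rw [contract_lie, sum_ospBasis]
  norm_num [brCoeff_eq, structureConst, koszul, OspBasis.parity]

theorem contract_H_lie_A (v : List OspBasis → M) : contract 𝕜 .H (ρ.lie .A v) =
    ρ.lie .A (contract 𝕜 .H v) + (1 / 2 : 𝕜) • contract 𝕜 .A v := by
  rw [contract_lie, sum_ospBasis]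
  norm_num [brCoeff_eq, structureConst, koszul, OspBasis.parity]

theorem contract_Y_lie_A (v : List OspBasis → M) : contract 𝕜 .Y (ρ.lie .A v) =
    ρ.lie .A (contract 𝕜 .Y v) - contract 𝕜 .B v := by
  rw [contract_lie, sum_ospBasis]
  norm_num [brCoeff_eq, structureConst, koszul, OspBasis.parity]

theorem contract_B_lie_A (v : List OspBasis → M) : contract 𝕜 .B (ρ.lie .A v) =
    -ρ.lie .A (contract 𝕜 .B v) - (2 : 𝕜) • contract 𝕜 .H v := by
  rw [contract_lie, sum_ospBasis]
  norm_num [brCoeff_eq, structureConst, koszul, OspBasis.parity]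

theorem contract_B_lie_B (v : List OspBasis → M) : contract 𝕜 .B (ρ.lie .B v) =
    -ρ.lie .B (contract 𝕜 .B v) + (2 : 𝕜) • contract 𝕜 .Y v := by
  rw [contract_lie, sum_ospBasis]
  norm_num [brCoeff_eq, structureConst, koszul, OspBasis.parity]

theorem contract_even_odd {v : List OspBasis → M} (hv : IsAlt 𝕜 v) {b c : OspBasis}
    (hb : b.parity = 0) : contract 𝕜 c (contract 𝕜 b v) = -contract 𝕜 b (contract 𝕜 c v) := by
  rw [hv.contract_contract]
  simp [koszul, hb]

/-- Each of the `n` copies of `B` contributes the same term, through `[A, B] = 2H`. The truncated `n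
- 1` is harmless at `n = 0`, since the coefficient vanishes there. -/
theorem lie_A_replicate {v : List OspBasis → M} (hv : IsAlt 𝕜 v) (n : ℕ) :
    ρ.lie .A v (List.replicate n .B) = (-1 : 𝕜) ^ n • ρ.twist .A (v (List.replicate n .B)) -
      (2 * n : 𝕜) • v (.H :: List.replicate (n - 1) .B) := by
  induction n generalizing v with
  | zero => simp [lie_nil]
  | succ n ih =>
    rw [List.replicate_succ]
    have h := congrFun (ρ.contract_B_lie_A v) (List.replicate n .B)
    refine h.trans ?_
    simp only [Pi.sub_apply, Pi.neg_apply, Pi.smul_apply, ih (hv.contract .B), contract_apply,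
      Nat.add_sub_cancel]
    cases n with
    | zero => simp
    | succ n =>
      have h2 := congrFun (contract_even_odd hv (b := .H) (c := .B) rfl) (List.replicate n .B)
      simp only [contract_apply, Pi.neg_apply] at h2
      simp only [Nat.add_sub_cancel, List.replicate_succ, h2] at *
      push_cast
      rw [pow_succ]
      module

theorem lie_B_replicate {v : List OspBasis → M} (hv : IsAlt 𝕜 v) (n : ℕ) :
    ρ.lie .B v (List.replicate n .B) = (-1 : 𝕜) ^ n • ρ.twist .B (v (List.replicate n .B)) +
      (2 * n : 𝕜) • v (.Y :: List.replicate (n - 1) .B) := by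
  induction n generalizing v with
  | zero => simp [lie_nil]
  | succ n ih =>
    rw [List.replicate_succ]
    have h := congrFun (ρ.contract_B_lie_B v) (List.replicate n .B)
    refine h.trans ?_
    simp only [Pi.add_apply, Pi.neg_apply, Pi.smul_apply, ih (hv.contract .B), contract_apply,
      Nat.add_sub_cancel]
    cases n with
    | zero => simp
    | succ n =>
      have h2 := congrFun (contract_even_odd hv (b := .Y) (c := .B) rfl) (List.replicate n .B)
      simp only [contract_apply, Pi.neg_apply] at h2
      simp only [Nat.add_sub_cancel, List.replicate_succ, h2] at *
      push_cast
      rw [pow_succ]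
      module

/-- The `n + 1` action terms agree, and so do the bracket terms of the `(n + 1)n / 2` pairs, each
carrying a factor two from `[B, B] = -2Y`. -/
theorem diff_replicate {v : List OspBasis → M} (hv : IsAlt 𝕜 v) (n : ℕ) :
    ρ.diff v (List.replicate (n + 1) .B) =
      ((-1) ^ n * (n + 1) : 𝕜) • ρ.twist .B (v (List.replicate n .B)) +
        ((n + 1) * n : 𝕜) • v (.Y :: List.replicate (n - 1) .B) := by
  induction n generalizing v with
  | zero => simp [diff_cons, lie_nil, diff_nil]
  | succ n ih =>
    rw [List.replicate_succ, diff_cons, ρ.lie_B_replicate hv, ih (hv.contract .B)]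
    simp only [contract_apply, Nat.add_sub_cancel]
    cases n with
    | zero =>
      simp
      module
    | succ n =>
      have h2 := congrFun (contract_even_odd hv (b := .Y) (c := .B) rfl) (List.replicate n .B)
      simp only [contract_apply, Pi.neg_apply] at h2
      simp only [Nat.add_sub_cancel, List.replicate_succ, h2]
      push_cast
      rw [pow_succ, pow_succ]
      module

theorem lie_A_H {v : List OspBasis → M} (hv : IsAlt 𝕜 v) (hA : contract 𝕜 .A v = 0) (n : ℕ) :
    ρ.lie .A v (.H :: List.replicate n .B) =
      (-1 : 𝕜) ^ n • ρ.twist .A (v (.H :: List.replicate n .B)) := by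
  refine (congrFun (ρ.contract_H_lie_A v) _).trans ?_
  rw [hA, Pi.add_apply, ρ.lie_A_replicate (hv.contract .H)]
  simp [hv.even_twice (b := .H) rfl]

theorem lie_A_Y {v : List OspBasis → M} (hv : IsAlt 𝕜 v) (n : ℕ) :
    ρ.lie .A v (.Y :: List.replicate n .B) =
      (-1 : 𝕜) ^ n • ρ.twist .A (v (.Y :: List.replicate n .B)) +
        (2 * n : 𝕜) • v (.H :: .Y :: List.replicate (n - 1) .B) -
        v (List.replicate (n + 1) .B) := by
  refine (congrFun (ρ.contract_Y_lie_A v) _).trans ?_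
  rw [Pi.sub_apply, ρ.lie_A_replicate (hv.contract .Y)]
  have h2 := congrFun (contract_even_odd hv (b := .H) (c := .Y) rfl) (List.replicate (n - 1) .B)
  simp only [contract_apply, Pi.neg_apply] at h2
  simp only [contract_apply, List.replicate_succ, h2]
  module

theorem lie_A_HY {v : List OspBasis → M} (hv : IsAlt 𝕜 v) (hA : contract 𝕜 .A v = 0) (n : ℕ) :
    ρ.lie .A v (.H :: .Y :: List.replicate n .B) =
      (-1 : 𝕜) ^ n • ρ.twist .A (v (.H :: .Y :: List.replicate n .B)) -
        v (.H :: List.replicate (n + 1) .B) := by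
  refine (congrFun (ρ.contract_H_lie_A v) _).trans ?_
  rw [hA, Pi.add_apply, ρ.lie_A_Y (hv.contract .H)]
  simp [hv.even_twice (b := .H) rfl]

theorem lie_A_eq_zero {v : List OspBasis → M} (hv : IsAlt 𝕜 v) (hA : contract 𝕜 .A v = 0)
    (hX : contract 𝕜 .X v = 0)
    (h0 : ∀ n : ℕ, (-1 : 𝕜) ^ n • ρ.twist .A (v (List.replicate n .B)) =
      (2 * n : 𝕜) • v (.H :: List.replicate (n - 1) .B))
    (hH : ∀ n, ρ.twist .A (v (.H :: List.replicate n .B)) = 0)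
    (hY : ∀ n : ℕ, (-1 : 𝕜) ^ n • ρ.twist .A (v (.Y :: List.replicate n .B)) +
      (2 * n : 𝕜) • v (.H :: .Y :: List.replicate (n - 1) .B) = v (List.replicate (n + 1) .B))
    (hHY : ∀ n, (-1 : 𝕜) ^ n • ρ.twist .A (v (.H :: .Y :: List.replicate n .B)) =
        v (.H :: List.replicate (n + 1) .B)) : ρ.lie .A v = 0 := by
  refine (hv.lie ρ .A).eq_zero ?_ ?_ (fun n => ?_) (fun n => ?_) (fun n => ?_) (fun n => ?_)
  · rw [contract_A_lie_A, hA, hX]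
    simp
  · rw [contract_X_lie_A, hX, map_zero]
  · rw [ρ.lie_A_replicate hv, h0, sub_self]
  · rw [ρ.lie_A_H hv hA, hH, smul_zero]
  · rw [ρ.lie_A_Y hv, hY, sub_self]
  · rw [ρ.lie_A_HY hv hA, hHY, sub_self]

/-- Cartan's formula iterated. The `X`-term appears because `[A, A] = 2X` keeps `ι_A` from simply
anticommuting with `L_A`; its coefficient makes the truncated exponent `p - 1` irrelevant at `p =
0`. -/
theorem iterate_contract_A_diff {v : List OspBasis → M} (hv : IsAlt 𝕜 v) (p : ℕ) :
    (contract 𝕜 .A)^[p + 1] (ρ.diff v) = (-1 : 𝕜) ^ (p + 1) •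
      (ρ.diff ((contract 𝕜 .A)^[p + 1] v) - (p + 1 : 𝕜) • ρ.lie .A ((contract 𝕜 .A)^[p] v) -
        ((p + 1) * p : 𝕜) • contract 𝕜 .X ((contract 𝕜 .A)^[p - 1] v)) := by
  induction p with
  | zero =>
    simp only [zero_add, Function.iterate_one, contract_diff, Function.iterate_zero, id_eq]
    simp
  | succ p ih =>
    rw [Function.iterate_succ_apply', ih, map_smul, map_sub, map_sub, map_smul, map_smul,
      contract_diff, contract_A_lie_A, ← Function.iterate_succ_apply' (contract 𝕜 .A),
      ← Function.iterate_succ_apply' (contract 𝕜 .A), Nat.add_sub_cancel]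
    have halt : ∀ k, IsAlt 𝕜 ((contract 𝕜 .A)^[k] v) := by
      intro k
      induction k with
      | zero => exact hv
      | succ k ih => rw [Function.iterate_succ_apply']; exact ih.contract .A
    rw [contract_even_odd (halt _) rfl, pow_succ _ (p + 1)]
    cases p with
    | zero =>
      simp
      module
    | succ p =>
      rw [Nat.add_sub_cancel, ← Function.iterate_succ_apply' (contract 𝕜 .A)]
      push_cast
      module

end OspModule

end Reduction

/-! ### Elimination of the `A`-component and relative cocycles. -/

section Reduction

variable {𝕜 M : Type*} [RCLike 𝕜] [AddCommGroup M] [Module 𝕜 M] (ρ : OspModule 𝕜 M)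

namespace OspModule

/-- On sorted lists the equation is triangular: the `H`-values are solved first, then those on `H,
Y`, then those on copies of `B` alone, then the `Y`-values. Each step only inverts the action of
`A`. -/
theorem exists_lie_A_eq (hA : Function.Surjective (ρ.twist .A)) (k : ℕ)
    {w : List OspBasis → M} (hw : IsAlt 𝕜 w) (hwA : contract 𝕜 .A w = 0)
    (hwX : contract 𝕜 .X w = 0) :
    ∃ g : List OspBasis → M, IsAlt 𝕜 g ∧ contract 𝕜 .X g = 0 ∧ (contract 𝕜 .A)^[k + 1] g = 0 ∧
      ρ.lie .A ((contract 𝕜 .A)^[k] g) = w := by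
  choose r hr using hA
  have hr' : ∀ (n : ℕ) (m : M), (-1 : 𝕜) ^ n • ρ.twist .A (r ((-1 : 𝕜) ^ n • m)) = m := by
    intro n m
    rw [hr, smul_smul, ← mul_pow]
    simp
  obtain ⟨q, hq⟩ : ∃ q : ℕ → M, ∀ n, (-1 : 𝕜) ^ n • ρ.twist .A (q n) =
    w (.H :: List.replicate n .B) := ⟨_, fun n => hr' n _⟩
  obtain ⟨t, ht⟩ : ∃ t : ℕ → M, ∀ n, (-1 : 𝕜) ^ n • ρ.twist .A (t n) =
    w (.H :: .Y :: List.replicate n .B) + q (n + 1) := ⟨_, fun n => hr' n _⟩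
  obtain ⟨p, hp⟩ : ∃ p : ℕ → M, ∀ n : ℕ, (-1 : 𝕜) ^ n • ρ.twist .A (p n) =
    w (List.replicate n .B) + (2 * n : 𝕜) • q (n - 1) := ⟨_, fun n => hr' n _⟩
  obtain ⟨s, hs⟩ : ∃ s : ℕ → M, ∀ n : ℕ, (-1 : 𝕜) ^ n • ρ.twist .A (s n) =
    w (.Y :: List.replicate n .B) - (2 * n : 𝕜) • t (n - 1) + p (n + 1) :=
    ⟨_, fun n => hr' n _⟩
  obtain ⟨u, hu, huA, huX, h0, hH, hY, hHY, g, hg, hgX, hgu⟩ :=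
    exists_iterate_contract_A (𝕜 := 𝕜) k p q s t
  refine ⟨g, hg, hgX, by rw [Function.iterate_succ_apply', hgu, huA], ?_⟩
  rw [hgu, ← sub_eq_zero]
  refine ((hu.lie ρ .A).sub hw).eq_zero ?_ ?_ (fun n => ?_) (fun n => ?_) (fun n => ?_)
    (fun n => ?_)
  · rw [map_sub, contract_A_lie_A, huA, huX, hwA]
    simp
  · rw [map_sub, contract_X_lie_A, huX, hwX]
    simp
  · rw [Pi.sub_apply, ρ.lie_A_replicate hu, h0, hH, hp]
    abel
  · rw [Pi.sub_apply, ρ.lie_A_H hu huA, hH, hq, sub_self]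
  · rw [Pi.sub_apply, ρ.lie_A_Y hu, hY, hHY, h0, hs]
    abel
  · rw [Pi.sub_apply, ρ.lie_A_HY hu huA, hHY, hH, ht]
    abel

/-- Filtration by the number of arguments `A`. The top contraction `w` has neither `A`- nor
`X`-component, so it can be written as `L_A` of a contraction of some `g`; subtracting `d g` kills
it and lowers the filtration degree. -/
theorem exists_contract_A_sub_diff (hA : Function.Surjective (ρ.twist .A)) (p : ℕ)
    {v : List OspBasis → M} (hv : IsAlt 𝕜 v) (hd : ρ.diff v = 0)
    (hp : (contract 𝕜 .A)^[p + 1] v = 0) :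
    ∃ g : List OspBasis → M, IsAlt 𝕜 g ∧ contract 𝕜 .A (v - ρ.diff g) = 0 := by
  induction p generalizing v with
  | zero => exact ⟨0, IsAlt.zero, by simpa using hp⟩
  | succ p ih =>
    have halt : ∀ k, IsAlt 𝕜 ((contract 𝕜 .A)^[k] v) := by
      intro k
      induction k with
      | zero => exact hv
      | succ k ih => rw [Function.iterate_succ_apply']; exact ih.contract .A
    have hiter0 : ∀ k, (contract 𝕜 .A)^[k] (0 : List OspBasis → M) = 0 := fun k =>
      Function.iterate_fixed (map_zero _) k
    have hitersub : ∀ k (x y : List OspBasis → M), (contract 𝕜 .A)^[k] (x - y) =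
        (contract 𝕜 .A)^[k] x - (contract 𝕜 .A)^[k] y := by
      intro k
      induction k with
      | zero => simp
      | succ k ih => intro x y; simp only [Function.iterate_succ_apply', ih, map_sub]
    set w := (contract 𝕜 .A)^[p + 1] v with hw
    have hwA : contract 𝕜 .A w = 0 := by rw [hw, ← Function.iterate_succ_apply' (contract 𝕜 .A), hp]
    have hp0 : ((p + 1 : ℕ) : 𝕜) + 1 ≠ 0 := by exact_mod_cast Nat.succ_ne_zero (p + 1)
    -- This is `iterate_contract_A_diff` for the closed `v`, divided by the common nonzero factor `p
    -- + 2`.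
    have h1 : ρ.lie .A w + ((p + 1 : ℕ) : 𝕜) • contract 𝕜 .X ((contract 𝕜 .A)^[p] v) = 0 := by
      have h := ρ.iterate_contract_A_diff hv (p + 1)
      rw [hd, hiter0, hp, map_zero, Nat.add_sub_cancel, ← hw, zero_sub, mul_smul, ← smul_neg,
        ← smul_sub] at h
      have h2 := (smul_eq_zero.mp ((smul_eq_zero.mp h.symm).resolve_left
        (pow_ne_zero _ (by simp)))).resolve_left hp0
      rw [← neg_eq_zero, neg_add, ← h2]
      abel
    -- Contracting `h1` with `A` turns both of its terms into multiples of `ι_X w`, with total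
    -- coefficient `-(p + 3)`.
    have hwX : contract 𝕜 .X w = 0 := by
      have h := congrArg (contract 𝕜 .A) h1
      rw [map_add, map_smul, contract_A_lie_A, hwA, contract_even_odd (halt p) rfl,
        ← Function.iterate_succ_apply' (contract 𝕜 .A), ← hw, map_zero, map_zero] at h
      have h2 : (-(((p + 2 : ℕ) : 𝕜) + 1)) • contract 𝕜 .X w = 0 := by
        rw [← h]
        push_cast
        module
      refine (smul_eq_zero.mp h2).resolve_left (neg_ne_zero.mpr ?_)
      exact_mod_cast Nat.succ_ne_zero (p + 2)
    -- The scalar inverts the factor `(-1)^(p+1) · (-(p+1))` before `L_A` in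
    -- `iterate_contract_A_diff`, so that `d g` has the same top contraction `w` as `v`.
    obtain ⟨g, hg, hgX, hg0, hgw⟩ := ρ.exists_lie_A_eq hA p
      ((halt (p + 1)).smul ((-1 : 𝕜) ^ p * ((p : 𝕜) + 1)⁻¹)) (by rw [map_smul, hwA, smul_zero])
      (by rw [map_smul, hwX, smul_zero])
    have hX : ∀ k, contract 𝕜 .X ((contract 𝕜 .A)^[k] g) = 0 := by
      have halt' : ∀ k, IsAlt 𝕜 ((contract 𝕜 .A)^[k] g) := by
        intro k
        induction k with
        | zero => exact hg
        | succ k ih => rw [Function.iterate_succ_apply']; exact ih.contract .A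
      intro k
      induction k with
      | zero => exact hgX
      | succ k ih =>
        rw [Function.iterate_succ_apply', ← neg_eq_zero, ← contract_even_odd (halt' k) rfl, ih,
          map_zero]
    obtain ⟨g', hg', hg''⟩ := ih (hv.sub (hg.diff ρ)) (by rw [map_sub, hd, diff_diff, sub_zero])
      (by
        rw [hitersub, ρ.iterate_contract_A_diff hg, hg0, hgw, hX, map_zero, ← hw, smul_zero,
          sub_zero, zero_sub, smul_neg, smul_smul, smul_smul, pow_succ]
        have hp1 : (p : 𝕜) + 1 ≠ 0 := by exact_mod_cast Nat.succ_ne_zero p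
        have h3 : (-1 : 𝕜) ^ p * (-1) ^ p = 1 := by rw [← mul_pow]; simp
        have h4 : (-1 : 𝕜) ^ p * -1 * (p + 1) * ((-1) ^ p * ((p : 𝕜) + 1)⁻¹) = -1 := by
          field_simp
          linear_combination -h3
        rw [h4]
        simp)
    refine ⟨g + g', hg.add hg', ?_⟩
    rw [map_add, ← sub_sub]
    exact hg''

/-- A closed cochain without `A`-component has no `X`-component and is invariant under `A`. -/
theorem relative_of_closed {v : List OspBasis → M} (hd : ρ.diff v = 0)
    (hA : contract 𝕜 .A v = 0) : ρ.lie .A v = 0 ∧ contract 𝕜 .X v = 0 := by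
  have h1 : ρ.lie .A v = 0 := by
    have h := ρ.contract_diff .A v
    rwa [hd, hA, map_zero, map_zero, sub_zero, eq_comm] at h
  refine ⟨h1, ?_⟩
  have h := ρ.contract_A_lie_A v
  rw [h1, hA, map_zero, map_zero, neg_zero, zero_sub, eq_comm, neg_eq_zero] at h
  exact (smul_eq_zero.mp h).resolve_left two_ne_zero

/-- The equation `d v = 0` on copies of `B` recovers the `Y`-values, and `L_A v = 0` recovers the
`H`-values and the values on `H, Y`. The integers to be inverted are nonzero. -/
theorem eq_zero_of_relative {v : List OspBasis → M} (hv : IsAlt 𝕜 v) (hd : ρ.diff v = 0)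
    (hA : contract 𝕜 .A v = 0) (h0 : ∀ n, v (List.replicate n .B) = 0) : v = 0 := by
  obtain ⟨hL, hX⟩ := ρ.relative_of_closed hd hA
  have hn : ∀ n : ℕ, (2 * (n + 1 : ℕ) : 𝕜) ≠ 0 := fun n =>
    mul_ne_zero two_ne_zero (by exact_mod_cast Nat.succ_ne_zero n)
  have hY : ∀ n, v (.Y :: List.replicate n .B) = 0 := fun n => by
    have h := ρ.diff_replicate hv (n + 1)
    rw [hd, h0, map_zero, smul_zero, Nat.add_sub_cancel, zero_add, Pi.zero_apply, eq_comm] at h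
    refine (smul_eq_zero.mp h).resolve_left (mul_ne_zero ?_ ?_)
    · exact_mod_cast Nat.succ_ne_zero (n + 1)
    · exact_mod_cast Nat.succ_ne_zero n
  refine hv.eq_zero hA hX h0 (fun n => ?_) hY (fun n => ?_)
  · have h := ρ.lie_A_replicate hv (n + 1)
    rw [hL, h0, map_zero, smul_zero, Nat.add_sub_cancel, zero_sub, Pi.zero_apply, eq_comm,
      neg_eq_zero] at h
    exact (smul_eq_zero.mp h).resolve_left (hn n)
  · have h := ρ.lie_A_Y hv (n + 1)
    simp only [hL, hY, h0, map_zero, smul_zero, Nat.add_sub_cancel, Pi.zero_apply, sub_zero,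
      zero_add] at h
    exact (smul_eq_zero.mp h.symm).resolve_left (hn n)

/-- A relative cocycle of degree at least two is a coboundary if it vanishes on `(H, B)`. -/
theorem exists_eq_diff {v : List OspBasis → M} (hv : IsAlt 𝕜 v) (hd : ρ.diff v = 0)
    (hA : contract 𝕜 .A v = 0) (h0 : v [] = 0) (h1 : v [.B] = 0) (h2 : v [.H, .B] = 0) :
    ∃ g : List OspBasis → M, IsAlt 𝕜 g ∧ v = ρ.diff g := by
  obtain ⟨hL, hX⟩ := ρ.relative_of_closed hd hA
  -- With no values on `B, …, B`, `d g` takes there only `(n + 2)(n + 1)` times the `Y`-value of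
  -- `g`, which fixes that value. The value on `H, Y` is then chosen to make `L_A g = 0`.
  obtain ⟨g, hg, hgA, hgX, hg0, hgH, hgY, hgHY, -⟩ := exists_iterate_contract_A (𝕜 := 𝕜) 0 0 0
    (fun n => ((n + 2 : ℕ) * (n + 1 : ℕ) : 𝕜)⁻¹ • v (List.replicate (n + 2) .B))
    (fun n => -(((n + 2 : ℕ) * (n + 1 : ℕ) : 𝕜)⁻¹ • v (.H :: List.replicate (n + 2) .B)))
  have hH : ∀ n, ρ.twist .A (v (.H :: List.replicate n .B)) = 0 := by
    intro n
    have h := ρ.lie_A_H hv hA n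
    rw [hL, Pi.zero_apply, eq_comm] at h
    exact (smul_eq_zero.mp h).resolve_left (pow_ne_zero _ (by simp))
  have hB : ∀ n : ℕ, (-1 : 𝕜) ^ n • ρ.twist .A (v (List.replicate n .B)) =
      (2 * n : 𝕜) • v (.H :: List.replicate (n - 1) .B) := by
    intro n
    have h := ρ.lie_A_replicate hv n
    rw [hL, Pi.zero_apply, eq_comm, sub_eq_zero] at h
    exact h
  have hLg : ρ.lie .A g = 0 := by
    refine ρ.lie_A_eq_zero hg hgA hgX (fun n => ?_) (fun n => ?_) (fun n => ?_) (fun n => ?_)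
    · rw [hg0, hgH]
      simp
    · rw [hgH]
      simp
    · rw [hgY, hgHY, hg0]
      have h := hB (n + 2)
      simp only [pow_succ, mul_neg, mul_one, neg_neg] at h
      rw [map_smul, smul_comm, h]
      -- The case `n = 0` is the only place where `v(H, B) = 0` is needed: there is no value of `g`
      -- on `H, Y` to compensate. For larger `n` the two contributions cancel.
      cases n with
      | zero => simp [h2]
      | succ n =>
        have h3 : ((n : 𝕜) + 1) ≠ 0 := by exact_mod_cast Nat.succ_ne_zero n
        have h4 : ((n : 𝕜) + 1 + 1) ≠ 0 := by exact_mod_cast Nat.succ_ne_zero (n + 1)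
        have h5 : ((n : 𝕜) + 1 + 2) ≠ 0 := by exact_mod_cast Nat.succ_ne_zero (n + 2)
        have h6 : ((n : 𝕜) + 2) ≠ 0 := by exact_mod_cast Nat.succ_ne_zero (n + 1)
        simp only [Nat.add_sub_cancel, show n + 1 + 2 - 1 = n + 2 by omega, smul_neg, smul_smul,
          Pi.zero_apply]
        rw [← sub_eq_add_neg, ← sub_smul]
        push_cast
        convert zero_smul 𝕜 _
        field_simp
        ring
    · rw [hgHY, hgH, map_neg, map_smul, hH]
      simp
  refine ⟨g, hg, ?_⟩
  rw [← sub_eq_zero]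
  refine ρ.eq_zero_of_relative (hv.sub (hg.diff ρ)) (by rw [map_sub, hd, diff_diff, sub_zero])
    ?_ (fun n => ?_)
  · rw [map_sub, hA, contract_diff, hLg, hgA, map_zero, sub_zero, sub_zero]
  · rw [Pi.sub_apply]
    match n with
    | 0 => simp [h0, diff_nil]
    | 1 =>
      rw [ρ.diff_replicate hg 0, hg0]
      simp [h1]
    | n + 2 =>
      rw [ρ.diff_replicate hg (n + 1), hg0, hgY, Pi.zero_apply, map_zero, smul_zero, zero_add,
        Nat.add_sub_cancel, smul_smul]
      have h3 : ((n : 𝕜) + 1) ≠ 0 := by exact_mod_cast Nat.succ_ne_zero n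
      have h6 : ((n : 𝕜) + 2) ≠ 0 := by exact_mod_cast Nat.succ_ne_zero (n + 1)
      have h7 : (((n + 1 : ℕ) : 𝕜) + 1) * ((n + 1 : ℕ) : 𝕜) *
          (((n + 2 : ℕ) : 𝕜) * ((n + 1 : ℕ) : 𝕜))⁻¹ = 1 := by
        push_cast
        field_simp
        ring
      rw [h7, one_smul, sub_self]

end OspModule

end Reduction

/-! ### Passage to cohomology classes and dimensions. -/

section Degree

variable {𝕜 M : Type*} [RCLike 𝕜] [AddCommGroup M] [Module 𝕜 M] [Module ℝ M]
  [IsScalarTower ℝ 𝕜 M] (ρ : OspModule 𝕜 M)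

theorem degreePart_toList {n : ℕ} (f : MultilinearMap ℝ (fun _ : Fin n => Osp) M) :
    degreePart n (toList f) = toList f := by
  rw [← toList_ofList, ofList_toList]

theorem contract_degreePart (b : OspBasis) (n : ℕ) (v : List OspBasis → M) :
    contract 𝕜 b (degreePart (n + 1) v) = degreePart n (contract 𝕜 b v) := by
  funext l
  simp [degreePart]

theorem degreePart_sub (n : ℕ) (v w : List OspBasis → M) :
    degreePart n (v - w) = degreePart n v - degreePart n w := by
  funext l
  by_cases h : l.length = n <;> simp [degreePart, h]

theorem iterate_contract_A_toList {n : ℕ} (f : MultilinearMap ℝ (fun _ : Fin n => Osp) M) :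
    (contract 𝕜 .A)^[n + 1] (toList f) = 0 := by
  have h : ∀ (k : ℕ) (v : List OspBasis → M) (l : List OspBasis),
      ((contract 𝕜 .A)^[k] v) l = v (List.replicate k .A ++ l) := by
    intro k
    induction k with
    | zero => simp
    | succ k ih =>
      intro v l
      rw [Function.iterate_succ_apply', contract_apply, ih, List.replicate_succ',
        List.append_assoc, List.singleton_append]
  funext l
  rw [h, toList_of_length_ne f, Pi.zero_apply]
  rw [List.length_append, List.length_replicate]
  omega

namespace OspModule

theorem mem_coboundaries_iff {n : ℕ} (f : MultilinearMap ℝ (fun _ : Fin (n + 1) => Osp) M) :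
    f ∈ ρ.coboundaries (n + 1) ↔
      ∃ g : MultilinearMap ℝ (fun _ : Fin n => Osp) M,
        IsAlt 𝕜 (toList g) ∧ toList f = ρ.diff (toList g) := by
  constructor
  · rintro ⟨g, hg, rfl⟩
    exact ⟨g, (mem_cochains_iff g).mp hg, ρ.toList_d hg⟩
  · rintro ⟨g, hg, h⟩
    have hg' := (mem_cochains_iff g).mpr hg
    exact ⟨g, hg', toList_injective ((ρ.toList_d hg').trans h.symm)⟩

/-- The primitive may have parts in several degrees; its part of degree `n` already suffices. -/
theorem mem_coboundaries_of {n : ℕ} {f : MultilinearMap ℝ (fun _ : Fin (n + 1) => Osp) M}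
    {w : List OspBasis → M} (hw : IsAlt 𝕜 w) (h : toList f = ρ.diff w) :
    f ∈ ρ.coboundaries (n + 1) := by
  refine (ρ.mem_coboundaries_iff f).mpr ⟨ofList n w, ?_, ?_⟩
  · rw [toList_ofList]
    exact hw.degreePart n
  · rw [toList_ofList, diff_degreePart, ← h, degreePart_toList]

/-- Every cohomology class of positive degree contains a cocycle without `A`-component. -/
theorem exists_relative (hA : Function.Surjective (ρ.twist .A)) {n : ℕ}
    {f : MultilinearMap ℝ (fun _ : Fin (n + 1) => Osp) M} (hf : f ∈ ρ.cocycles (n + 1)) :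
    ∃ g ∈ ρ.cocycles (n + 1), f - g ∈ ρ.coboundaries (n + 1) ∧ contract 𝕜 .A (toList g) = 0 := by
  obtain ⟨hv, hd⟩ := (ρ.mem_cocycles_iff f).mp hf
  obtain ⟨w, hw, hwA⟩ := ρ.exists_contract_A_sub_diff hA _ hv hd (iterate_contract_A_toList f)
  have hg : toList (ofList (n + 1) (toList f - ρ.diff w)) =
      toList f - ρ.diff (degreePart n w) := by
    rw [toList_ofList, degreePart_sub, degreePart_toList, diff_degreePart]
  refine ⟨ofList (n + 1) (toList f - ρ.diff w), ?_, ?_, ?_⟩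
  · rw [mem_cocycles_iff, hg, map_sub, hd, diff_diff, sub_zero]
    exact ⟨hv.sub ((hw.degreePart n).diff ρ), rfl⟩
  · refine ρ.mem_coboundaries_of (hw.degreePart n) ?_
    rw [toList_sub, hg, sub_sub_cancel]
  · rw [toList_ofList, contract_degreePart, hwA]
    funext l
    simp [degreePart]

theorem mem_coboundaries_of_relative {n : ℕ}
    {f : MultilinearMap ℝ (fun _ : Fin (n + 2) => Osp) M} (hf : f ∈ ρ.cocycles (n + 2))
    (hA : contract 𝕜 .A (toList f) = 0) (h : toList f [.H, .B] = 0) :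
    f ∈ ρ.coboundaries (n + 2) := by
  obtain ⟨hv, hd⟩ := (ρ.mem_cocycles_iff f).mp hf
  obtain ⟨g, hg, hfg⟩ := ρ.exists_eq_diff hv hd hA (toList_of_length_ne f (by simp))
    (toList_of_length_ne f (by simp)) h
  exact ρ.mem_coboundaries_of hg hfg

/-- In degree at least three the obstruction on `(H, B)` vanishes, because that list has the wrong
length. -/
theorem mem_coboundaries_of_surjective (hA : Function.Surjective (ρ.twist .A)) {n : ℕ}
    {f : MultilinearMap ℝ (fun _ : Fin (n + 3) => Osp) M} (hf : f ∈ ρ.cocycles (n + 3)) :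
    f ∈ ρ.coboundaries (n + 3) := by
  obtain ⟨g, hg, hfg, hgA⟩ := ρ.exists_relative hA hf
  have h := ρ.mem_coboundaries_of_relative hg hgA (toList_of_length_ne g (by simp))
  simpa using Submodule.add_mem _ hfg h

theorem cls_eq_zero_iff {n : ℕ} {f : MultilinearMap ℝ (fun _ : Fin n => Osp) M}
    (hf : f ∈ ρ.cocycles n) : ρ.cls f hf = 0 ↔ f ∈ ρ.coboundaries n := by
  rw [cls, Submodule.mkQ_apply, Submodule.Quotient.mk_eq_zero]
  rfl

theorem exists_cls_eq {n : ℕ} (x : ρ.cohomology n) : ∃ f, ∃ hf : f ∈ ρ.cocycles n,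
    ρ.cls f hf = x := by
  obtain ⟨⟨f, hf⟩, rfl⟩ := Submodule.Quotient.mk_surjective _ x
  exact ⟨f, hf, rfl⟩

theorem cls_sub_smul {n : ℕ} {f g : MultilinearMap ℝ (fun _ : Fin n => Osp) M}
    (hf : f ∈ ρ.cocycles n) (hg : g ∈ ρ.cocycles n) (r : 𝕜) :
    ρ.cls (f - r • g) (Submodule.sub_mem _ hf (Submodule.smul_mem _ r hg)) =
      ρ.cls f hf - r • ρ.cls g hg := rfl

theorem cls_smul_add_smul {n : ℕ} {f g : MultilinearMap ℝ (fun _ : Fin n => Osp) M}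
    (hf : f ∈ ρ.cocycles n) (hg : g ∈ ρ.cocycles n) (r s : 𝕜) :
    ρ.cls (r • f + s • g) (Submodule.add_mem _ (Submodule.smul_mem _ r hf)
      (Submodule.smul_mem _ s hg)) = r • ρ.cls f hf + s • ρ.cls g hg := rfl

theorem cls_sub {n : ℕ} {f g : MultilinearMap ℝ (fun _ : Fin n => Osp) M}
    (hf : f ∈ ρ.cocycles n) (hg : g ∈ ρ.cocycles n) :
    ρ.cls (f - g) (Submodule.sub_mem _ hf hg) = ρ.cls f hf - ρ.cls g hg := rfl

theorem rank_cohomology_eq_zero {n : ℕ} (h : ∀ f ∈ ρ.cocycles n, f ∈ ρ.coboundaries n) :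
    Module.rank 𝕜 (ρ.cohomology n) = 0 := by
  have : Subsingleton (ρ.cohomology n) := ⟨fun x y => by
    obtain ⟨f, hf, rfl⟩ := ρ.exists_cls_eq x
    obtain ⟨g, hg, rfl⟩ := ρ.exists_cls_eq y
    rw [(ρ.cls_eq_zero_iff hf).mpr (h f hf), (ρ.cls_eq_zero_iff hg).mpr (h g hg)]⟩
  exact rank_subsingleton' 𝕜 _

theorem span_cls_eq_top {n : ℕ} {g : MultilinearMap ℝ (fun _ : Fin n => Osp) M}
    (hg : g ∈ ρ.cocycles n)
    (h : ∀ f ∈ ρ.cocycles n, ∃ r : 𝕜, f - r • g ∈ ρ.coboundaries n) :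
    Submodule.span 𝕜 {ρ.cls g hg} = ⊤ := by
  refine eq_top_iff.mpr fun x _ => ?_
  obtain ⟨f, hf, rfl⟩ := ρ.exists_cls_eq x
  obtain ⟨r, hr⟩ := h f hf
  rw [← ρ.cls_eq_zero_iff (Submodule.sub_mem _ hf (Submodule.smul_mem _ r hg)),
    cls_sub_smul _ hf hg, sub_eq_zero] at hr
  exact Submodule.mem_span_singleton.mpr ⟨r, hr.symm⟩

theorem rank_cohomology_eq_one {n : ℕ} {g : MultilinearMap ℝ (fun _ : Fin n => Osp) M}
    (hg : g ∈ ρ.cocycles n) (h : Submodule.span 𝕜 {ρ.cls g hg} = ⊤)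
    (h0 : g ∉ ρ.coboundaries n) : Module.rank 𝕜 (ρ.cohomology n) = 1 :=
  rank_eq_one (ρ.cls g hg) (fun h' => h0 ((ρ.cls_eq_zero_iff hg).mp h')) fun _ =>
    Submodule.mem_span_singleton.mp (h ▸ Submodule.mem_top)

theorem span_cls_pair_eq_top {n : ℕ} {g g' : MultilinearMap ℝ (fun _ : Fin n => Osp) M}
    (hg : g ∈ ρ.cocycles n) (hg' : g' ∈ ρ.cocycles n)
    (h : ∀ f ∈ ρ.cocycles n, ∃ r s : 𝕜, f - (r • g + s • g') ∈ ρ.coboundaries n) :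
    Submodule.span 𝕜 {ρ.cls g hg, ρ.cls g' hg'} = ⊤ := by
  refine eq_top_iff.mpr fun x _ => ?_
  obtain ⟨f, hf, rfl⟩ := ρ.exists_cls_eq x
  obtain ⟨r, s, hr⟩ := h f hf
  have hgg := Submodule.add_mem _ (Submodule.smul_mem _ r hg) (Submodule.smul_mem _ s hg')
  rw [← ρ.cls_eq_zero_iff (Submodule.sub_mem _ hf hgg), cls_sub _ hf hgg,
    cls_smul_add_smul _ hg hg', sub_eq_zero] at hr
  exact Submodule.mem_span_pair.mpr ⟨r, s, hr.symm⟩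

theorem rank_cohomology_eq_two {n : ℕ} {g g' : MultilinearMap ℝ (fun _ : Fin n => Osp) M}
    (hg : g ∈ ρ.cocycles n) (hg' : g' ∈ ρ.cocycles n)
    (h : Submodule.span 𝕜 {ρ.cls g hg, ρ.cls g' hg'} = ⊤)
    (h0 : ∀ r s : 𝕜, r • g + s • g' ∈ ρ.coboundaries n → r = 0 ∧ s = 0) :
    Module.rank 𝕜 (ρ.cohomology n) = 2 := by
  have hli : LinearIndependent 𝕜 ![ρ.cls g hg, ρ.cls g' hg'] := by
    refine LinearIndependent.pair_iff.mpr fun r s hrs => h0 r s ?_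
    rw [← ρ.cls_eq_zero_iff (Submodule.add_mem _ (Submodule.smul_mem _ r hg)
      (Submodule.smul_mem _ s hg'))]
    exact hrs
  have hb := Module.Basis.mk hli (by
    rw [Matrix.range_cons, Matrix.range_cons, Matrix.range_empty, Set.union_empty,
      Set.singleton_union, h])
  simpa using rank_eq_card_basis hb

end OspModule

end Degree

/-! ### Low-degree values and criteria for cocycles. -/

section Values

variable {𝕜 M : Type*} [RCLike 𝕜] [AddCommGroup M] [Module 𝕜 M] (ρ : OspModule 𝕜 M)

namespace OspModule

theorem twist_H_A (m : M) : ρ.twist .H (ρ.twist .A m) =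
    ρ.twist .A (ρ.twist .H m) + (1 / 2 : 𝕜) • ρ.twist .A m := by
  have h := ρ.twist_twist .H .A m
  rw [sum_ospBasis] at h
  norm_num [brCoeff_eq, structureConst, koszul, OspBasis.parity] at h
  rw [sub_eq_iff_eq_add'] at h
  simpa using h

theorem twist_H_B (m : M) : ρ.twist .H (ρ.twist .B m) =
    ρ.twist .B (ρ.twist .H m) - (1 / 2 : 𝕜) • ρ.twist .B m := by
  have h := ρ.twist_twist .H .B m
  rw [sum_ospBasis] at h
  norm_num [brCoeff_eq, structureConst, koszul, OspBasis.parity] at h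
  rw [sub_eq_iff_eq_add'] at h
  rw [h]
  module

theorem twist_A_B (m : M) : ρ.twist .A (ρ.twist .B m) =
    -ρ.twist .B (ρ.twist .A m) - (2 : 𝕜) • ρ.twist .H m := by
  have h := ρ.twist_twist .A .B m
  rw [sum_ospBasis] at h
  norm_num [brCoeff_eq, structureConst, koszul, OspBasis.parity] at h
  rw [← eq_sub_iff_add_eq] at h
  rw [h]
  abel

theorem diff_singleton (b : OspBasis) (v : List OspBasis → M) :
    ρ.diff v [b] = ρ.twist b (v []) := by
  rw [diff_cons, lie_nil, diff_nil, sub_zero]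

theorem diff_H_B (v : List OspBasis → M) : ρ.diff v [.H, .B] =
    ρ.twist .H (v [.B]) + (1 / 2 : 𝕜) • v [.B] - ρ.twist .B (v [.H]) := by
  rw [diff_cons, lie_cons, diff_cons, lie_nil, lie_nil, diff_nil, sum_ospBasis]
  norm_num [brCoeff_eq, structureConst, koszul, OspBasis.parity]

theorem twist_A_H_eq {v : List OspBasis → M} (hv : IsAlt 𝕜 v) (hA : contract 𝕜 .A v = 0)
    (hL : ρ.lie .A v = 0) : ρ.twist .A (v [.H]) = 0 := by
  have h := ρ.lie_A_H hv hA 0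
  simpa [hL] using h.symm

theorem twist_A_B_eq {v : List OspBasis → M} (hv : IsAlt 𝕜 v) (hL : ρ.lie .A v = 0) :
    ρ.twist .A (v [.B]) = (-2 : 𝕜) • v [.H] := by
  have h := ρ.lie_A_replicate hv 1
  simp only [hL, Pi.zero_apply, pow_one, List.replicate_one, Nat.cast_one, mul_one, Nat.sub_self,
    List.replicate_zero, neg_smul, one_smul] at h
  rw [neg_smul, ← sub_eq_zero, ← neg_eq_zero]
  rw [h]
  abel

theorem twist_A_H_B_eq {v : List OspBasis → M} (hv : IsAlt 𝕜 v) (hA : contract 𝕜 .A v = 0)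
    (hL : ρ.lie .A v = 0) : ρ.twist .A (v [.H, .B]) = 0 := by
  have h := ρ.lie_A_H hv hA 1
  simpa [hL] using h.symm

end OspModule

variable [Module ℝ M] [IsScalarTower ℝ 𝕜 M]

theorem toList_singleton (f : MultilinearMap ℝ (fun _ : Fin 1 => Osp) M) (b : OspBasis) :
    toList f [b] = f fun _ => Osp.e b := by
  have h := toList_ofFn f fun _ => b
  simpa using h

theorem toList_pair (f : MultilinearMap ℝ (fun _ : Fin 2 => Osp) M) (b c : OspBasis) :
    toList f [b, c] = f fun i => Osp.e ((![b, c] : Fin 2 → OspBasis) i) := by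
  have h := toList_ofFn f ![b, c]
  simpa using h

theorem isAlt_toList_zero (f : MultilinearMap ℝ (fun _ : Fin 0 => Osp) M) :
    IsAlt 𝕜 (toList f) := fun l₁ b c l₂ => by
  rw [toList_of_length_ne f (by simp), toList_of_length_ne f (by simp), smul_zero, neg_zero]

theorem isAlt_toList_one (f : MultilinearMap ℝ (fun _ : Fin 1 => Osp) M) :
    IsAlt 𝕜 (toList f) := fun l₁ b c l₂ => by
  rw [toList_of_length_ne f (by simp; omega), toList_of_length_ne f (by simp; omega), smul_zero,
    neg_zero]

theorem contract_toList_one (f : MultilinearMap ℝ (fun _ : Fin 1 => Osp) M) {b : OspBasis}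
    (h : toList f [b] = 0) : contract 𝕜 b (toList f) = 0 := by
  funext l
  cases l with
  | nil => exact h
  | cons c l => exact toList_of_length_ne f (l := b :: c :: l) (by simp)

namespace OspModule

theorem relative_cocycle_ext {f g : MultilinearMap ℝ (fun _ : Fin 1 => Osp) M}
    (hf : f ∈ ρ.cocycles 1) (hg : g ∈ ρ.cocycles 1) (hfA : contract 𝕜 .A (toList f) = 0)
    (hgA : contract 𝕜 .A (toList g) = 0) (h : toList f [.B] = toList g [.B]) : f = g := by
  obtain ⟨hfv, hfd⟩ := (ρ.mem_cocycles_iff f).mp hf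
  obtain ⟨hgv, hgd⟩ := (ρ.mem_cocycles_iff g).mp hg
  refine toList_injective (sub_eq_zero.mp ?_)
  refine ρ.eq_zero_of_relative (hfv.sub hgv) (by rw [map_sub, hfd, hgd, sub_zero])
    (by rw [map_sub, hfA, hgA, sub_zero]) fun n => ?_
  by_cases hn : n = 1
  · subst hn
    exact sub_eq_zero.mpr h
  · rw [Pi.sub_apply, toList_of_length_ne f (by simpa using hn),
      toList_of_length_ne g (by simpa using hn), sub_zero]

/-- Here `d v` is itself a closed cochain without `A`-component, so by `eq_zero_of_relative` its
values on copies of `B` decide. -/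
theorem closed_of_relative {v : List OspBasis → M} (hv : IsAlt 𝕜 v) (hA : contract 𝕜 .A v = 0)
    (hL : ρ.lie .A v = 0) (h : ∀ n, ρ.diff v (List.replicate n .B) = 0) : ρ.diff v = 0 :=
  ρ.eq_zero_of_relative (hv.diff ρ) (ρ.diff_diff v)
    (by rw [contract_diff, hL, hA, map_zero, sub_zero]) h

/-- The conditions `h1`, `h2`, `h3` express `L_A f = 0` on sorted lists, and `h4` is closedness on
`(B, B)`; nothing else is left to test. -/
theorem mem_cocycles_one {f : MultilinearMap ℝ (fun _ : Fin 1 => Osp) M}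
    (hA : toList f [.A] = 0) (hX : toList f [.X] = 0) (h1 : ρ.twist .A (toList f [.H]) = 0)
    (h2 : ρ.twist .A (toList f [.B]) = (-2 : 𝕜) • toList f [.H])
    (h3 : ρ.twist .A (toList f [.Y]) = toList f [.B])
    (h4 : ρ.twist .B (toList f [.B]) = toList f [.Y]) : f ∈ ρ.cocycles 1 := by
  have hv := isAlt_toList_one (𝕜 := 𝕜) f
  have hA' := contract_toList_one (𝕜 := 𝕜) f hA
  refine (ρ.mem_cocycles_iff f).mpr ⟨hv, ρ.closed_of_relative hv hA' ?_ fun n => ?_⟩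
  · refine ρ.lie_A_eq_zero hv hA' (contract_toList_one f hX) (fun n => ?_) (fun n => ?_)
      (fun n => ?_) fun n => ?_
    · match n with
      | 0 => simp [toList_of_length_ne f]
      | 1 => simp [h2]
      | n + 2 => simp [toList_of_length_ne f]
    · match n with
      | 0 => exact h1
      | n + 1 => simp [toList_of_length_ne f]
    · match n with
      | 0 => simp [h3]
      | n + 1 => simp [toList_of_length_ne f]
    · simp [toList_of_length_ne f]
  · match n with
    | 0 => rfl
    | 1 => rw [ρ.diff_replicate hv 0]; simp [toList_of_length_ne f]
    | 2 =>
      rw [ρ.diff_replicate hv 1]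
      simp only [List.replicate_one, h4, Nat.sub_self, List.replicate_zero]
      module
    | n + 3 => rw [ρ.diff_replicate hv (n + 2)]; simp [toList_of_length_ne f]

/-- As in degree one: `h1` to `h4` express `L_A f = 0`, and `h5` is closedness on `(B, B, B)`. -/
theorem mem_cocycles_two {f : MultilinearMap ℝ (fun _ : Fin 2 => Osp) M}
    (hv : IsAlt 𝕜 (toList f))
    (hA : ∀ b, toList f [.A, b] = 0) (hX : ∀ b, toList f [.X, b] = 0)
    (h1 : ρ.twist .A (toList f [.H, .B]) = 0)
    (h2 : ρ.twist .A (toList f [.B, .B]) = (4 : 𝕜) • toList f [.H, .B])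
    (h3 : (2 : 𝕜) • toList f [.H, .Y] - ρ.twist .A (toList f [.Y, .B]) = toList f [.B, .B])
    (h4 : ρ.twist .A (toList f [.H, .Y]) = toList f [.H, .B])
    (h5 : ρ.twist .B (toList f [.B, .B]) = (-2 : 𝕜) • toList f [.Y, .B]) : f ∈ ρ.cocycles 2 := by
  have hc : ∀ b, (∀ c, toList f [b, c] = 0) → contract 𝕜 b (toList f) = 0 := by
    intro b hb
    funext l
    match l with
    | [] => exact toList_of_length_ne f (l := [b]) (by simp)
    | [c] => exact hb c
    | c :: c' :: l => exact toList_of_length_ne f (l := b :: c :: c' :: l) (by simp)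
  have hA' := hc .A hA
  refine (ρ.mem_cocycles_iff f).mpr ⟨hv, ρ.closed_of_relative hv hA' ?_ fun n => ?_⟩
  · refine ρ.lie_A_eq_zero hv hA' (hc .X hX) (fun n => ?_) (fun n => ?_)
      (fun n => ?_) fun n => ?_
    · match n with
      | 0 => simp [toList_of_length_ne f]
      | 1 => simp [toList_of_length_ne f]
      | 2 =>
        simp only [List.replicate_succ, List.replicate_zero, h2]
        norm_num
      | n + 3 => simp [toList_of_length_ne f]
    · match n with
      | 0 => simp [toList_of_length_ne f]
      | 1 => exact h1
      | n + 2 => simp [toList_of_length_ne f]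
    · match n with
      | 0 => simp [toList_of_length_ne f]
      | 1 =>
        simp only [List.replicate_succ, List.replicate_zero, ← h3]
        push_cast
        module
      | n + 2 => simp [toList_of_length_ne f]
    · match n with
      | 0 => simp [h4]
      | n + 1 => simp [toList_of_length_ne f]
  · match n with
    | 0 => rfl
    | 1 => rw [ρ.diff_replicate hv 0]; simp [toList_of_length_ne f]
    | 2 => rw [ρ.diff_replicate hv 1]; simp [toList_of_length_ne f]
    | 3 =>
      rw [ρ.diff_replicate hv 2]
      simp only [List.replicate_succ, List.replicate_zero, h5]
      push_cast
      module
    | n + 4 => rw [ρ.diff_replicate hv (n + 3)]; simp [toList_of_length_ne f]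

theorem toList_cochainZero (m : M) : toList (cochainZero m) [] = m := rfl

theorem cochainZero_mem_cocycles {m : M} (hA : ρ.twist .A m = 0) (hB : ρ.twist .B m = 0) :
    cochainZero m ∈ ρ.cocycles 0 := by
  have hv := isAlt_toList_zero (𝕜 := 𝕜) (cochainZero m)
  have hA' : contract 𝕜 .A (toList (cochainZero m)) = 0 := by
    funext l
    exact toList_of_length_ne (cochainZero m) (l := .A :: l) (by simp)
  have hX' : contract 𝕜 .X (toList (cochainZero m)) = 0 := by
    funext l
    exact toList_of_length_ne (cochainZero m) (l := .X :: l) (by simp)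
  refine (ρ.mem_cocycles_iff _).mpr ⟨hv, ρ.closed_of_relative hv hA' ?_ fun n => ?_⟩
  · refine ρ.lie_A_eq_zero hv hA' hX' (fun n => ?_) (fun n => ?_) (fun n => ?_) fun n => ?_
    · match n with
      | 0 => simp [toList_cochainZero, hA]
      | n + 1 => simp [toList_of_length_ne]
    all_goals simp [toList_of_length_ne]
  · match n with
    | 0 => rfl
    | 1 => rw [ρ.diff_replicate hv 0]; simp [toList_cochainZero, hB]
    | n + 2 => rw [ρ.diff_replicate hv (n + 1)]; simp [toList_of_length_ne]

theorem exists_cochainZero_eq {f : MultilinearMap ℝ (fun _ : Fin 0 => Osp) M}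
    (hf : f ∈ ρ.cocycles 0) :
    ∃ m : M, f = cochainZero m ∧ ρ.twist .A m = 0 ∧ ρ.twist .B m = 0 := by
  obtain ⟨-, hd⟩ := (ρ.mem_cocycles_iff f).mp hf
  refine ⟨toList f [], multilinear_ext fun κ => ?_, ?_, ?_⟩
  · rw [← toList_ofFn, ← toList_ofFn]
    rfl
  · rw [← diff_singleton, hd, Pi.zero_apply]
  · rw [← diff_singleton, hd, Pi.zero_apply]

end OspModule

end Values

/-! ### The small complex on the kernel of `A`. -/

section LowDegree

variable {𝕜 M : Type*} [RCLike 𝕜] [AddCommGroup M] [Module 𝕜 M] (ρ : OspModule 𝕜 M)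

namespace OspModule

/-- `τ` is a linear right inverse of the action of `A` on the kernel of `A`, of weight `-1/2`. -/
structure IsLift (τ : M →ₗ[𝕜] M) : Prop where
  twist_A : ∀ v, ρ.twist .A v = 0 → ρ.twist .A (τ v) = v
  twist_H : ∀ v, ρ.twist .A v = 0 → ρ.twist .H (τ v) = τ (ρ.twist .H v) - (1 / 2 : 𝕜) • τ v

/-- The kernel of `A` is the direct sum of the kernel and of the image of `H + r`. -/
structure IsSplit (r : 𝕜) : Prop where
  exists_eq_add : ∀ v, ρ.twist .A v = 0 → ∃ u w, ρ.twist .A u = 0 ∧ ρ.twist .A w = 0 ∧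
    ρ.twist .H u + r • u = 0 ∧ v = u + (ρ.twist .H w + r • w)
  eq_zero : ∀ v, ρ.twist .A v = 0 →
    ρ.twist .H (ρ.twist .H v + r • v) + r • (ρ.twist .H v + r • v) = 0 →
    ρ.twist .H v + r • v = 0

/-- The action of `B` on the kernel of `A`, made to preserve this kernel with the help of `τ`. -/
def lower (τ : M →ₗ[𝕜] M) : M →ₗ[𝕜] M := ρ.twist .B + (2 : 𝕜) • τ ∘ₗ ρ.twist .H

theorem lower_apply (τ : M →ₗ[𝕜] M) (v : M) :
    ρ.lower τ v = ρ.twist .B v + (2 : 𝕜) • τ (ρ.twist .H v) := rfl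

theorem twist_B_eq (τ : M →ₗ[𝕜] M) (v : M) :
    ρ.twist .B v = ρ.lower τ v - (2 : 𝕜) • τ (ρ.twist .H v) := by
  rw [lower_apply, add_sub_cancel_right]

theorem twist_A_H {v : M} (hv : ρ.twist .A v = 0) : ρ.twist .A (ρ.twist .H v) = 0 := by
  have h := ρ.twist_H_A v
  rw [hv, map_zero, smul_zero, add_zero] at h
  exact h.symm

variable {ρ} {τ : M →ₗ[𝕜] M}

/-- On the kernel of `A` the relation `[A, B] = 2H` gives `A B v = -2 H v`, which the term `2τH`
cancels. -/
theorem IsLift.twist_A_lower (hτ : ρ.IsLift τ) {v : M} (hv : ρ.twist .A v = 0) :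
    ρ.twist .A (ρ.lower τ v) = 0 := by
  rw [lower_apply, map_add, map_smul, hτ.twist_A _ (ρ.twist_A_H hv), ρ.twist_A_B, hv, map_zero]
  abel

theorem IsLift.twist_H_lower (hτ : ρ.IsLift τ) {v : M} (hv : ρ.twist .A v = 0) :
    ρ.twist .H (ρ.lower τ v) = ρ.lower τ (ρ.twist .H v) - (1 / 2 : 𝕜) • ρ.lower τ v := by
  rw [lower_apply, lower_apply, map_add, map_smul, hτ.twist_H _ (ρ.twist_A_H hv), ρ.twist_H_B]
  module

variable (ρ)

theorem twist_H_eq_zero {m : M} (hA : ρ.twist .A m = 0) (hB : ρ.twist .B m = 0) :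
    ρ.twist .H m = 0 := by
  have h := ρ.twist_A_B m
  rw [hA, hB, map_zero, map_zero, neg_zero, zero_sub, eq_comm, neg_eq_zero] at h
  exact (smul_eq_zero.mp h).resolve_left two_ne_zero

variable [Module ℝ M] [IsScalarTower ℝ 𝕜 M]

/-- Both `f` and `d w` are relative 1-cocycles with the same value on `B`, and that value determines
them. -/
theorem mem_coboundaries_one {f : MultilinearMap ℝ (fun _ : Fin 1 => Osp) M} {w : M}
    (hf : f ∈ ρ.cocycles 1) (hA : contract 𝕜 .A (toList f) = 0) (hw : ρ.twist .A w = 0)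
    (h : toList f [.B] = ρ.twist .B w) : f ∈ ρ.coboundaries 1 := by
  set g := ofList 1 (ρ.diff (toList (cochainZero w))) with hg
  have hgd : toList g = ρ.diff (toList (cochainZero w)) := by
    rw [hg, toList_ofList, ← diff_degreePart, degreePart_toList]
  refine (ρ.mem_coboundaries_iff f).mpr ⟨cochainZero w, isAlt_toList_zero _, ?_⟩
  rw [← hgd, ρ.relative_cocycle_ext hf (g := g) _ hA]
  · exact contract_toList_one g (by rw [hgd, diff_singleton, toList_cochainZero, hw])
  · rw [h, hgd, diff_singleton, toList_cochainZero]
  · rw [mem_cocycles_iff, hgd, diff_diff]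
    exact ⟨(isAlt_toList_zero _).diff ρ, rfl⟩

theorem exists_of_mem_coboundaries_one {f : MultilinearMap ℝ (fun _ : Fin 1 => Osp) M}
    (hf : f ∈ ρ.coboundaries 1) : ∃ w : M, ∀ b, toList f [b] = ρ.twist b w := by
  obtain ⟨g, -, h⟩ := (ρ.mem_coboundaries_iff f).mp hf
  exact ⟨toList g [], fun b => by rw [h, diff_singleton]⟩

variable {ρ}

/-- The normal form of a class of degree one. -/
theorem IsLift.exists_normal_form (hτ : ρ.IsLift τ) (hA : Function.Surjective (ρ.twist .A))
    (h0 : ρ.IsSplit 0) (h1 : ρ.IsSplit (1 / 2))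
    {f : MultilinearMap ℝ (fun _ : Fin 1 => Osp) M} (hf : f ∈ ρ.cocycles 1) :
    ∃ g ∈ ρ.cocycles 1, f - g ∈ ρ.coboundaries 1 ∧ contract 𝕜 .A (toList g) = 0 ∧
      ∃ q p : M, ρ.twist .A q = 0 ∧ ρ.twist .A p = 0 ∧ ρ.twist .H q = 0 ∧ ρ.lower τ q = 0 ∧
        ρ.twist .H p + (1 / 2 : 𝕜) • p = 0 ∧ toList g [.B] = p - (2 : 𝕜) • τ q := by
  obtain ⟨g, hg, hfg, hgA⟩ := ρ.exists_relative hA hf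
  obtain ⟨hgv, hgd⟩ := (ρ.mem_cocycles_iff g).mp hg
  obtain ⟨hgL, -⟩ := ρ.relative_of_closed hgd hgA
  -- Splitting `g(H) = q + H w` with `H q = 0` shows what to subtract: the coboundary of `w` removes
  -- the part `H w`.
  obtain ⟨q, w, hq, hw, hHq, hgq⟩ := h0.exists_eq_add _ (ρ.twist_A_H_eq hgv hgA hgL)
  rw [zero_smul, add_zero] at hHq hgq
  -- Since `A g(B) = -2 g(H)`, this correction by `τ` lies in the kernel of `A`.
  set p₀ := toList g [.B] + (2 : 𝕜) • τ (toList g [.H]) with hp₀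
  have hp₀A : ρ.twist .A p₀ = 0 := by
    rw [hp₀, map_add, map_smul, hτ.twist_A _ (ρ.twist_A_H_eq hgv hgA hgL),
      ρ.twist_A_B_eq hgv hgL]
    module
  have hHB := ρ.diff_H_B (toList g)
  have hcl : ρ.twist .H p₀ + (1 / 2 : 𝕜) • p₀ = ρ.lower τ (toList g [.H]) := by
    rw [hgd, Pi.zero_apply, ρ.twist_B_eq τ] at hHB
    rw [hp₀, map_add, map_smul, hτ.twist_H _ (ρ.twist_A_H_eq hgv hgA hgL)]
    linear_combination (norm := module) -hHB
  have hpA : ρ.twist .A (p₀ - ρ.lower τ w) = 0 := by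
    rw [map_sub, hp₀A, hτ.twist_A_lower hw, sub_zero]
  have hHp : ρ.twist .H (p₀ - ρ.lower τ w) + (1 / 2 : 𝕜) • (p₀ - ρ.lower τ w) =
      ρ.lower τ q := by
    rw [map_sub, hτ.twist_H_lower hw]
    rw [hgq, (ρ.lower τ).map_add] at hcl
    linear_combination (norm := module) hcl
  -- By `hHp` the element `lower q` lies in the image of `H + 1/2`, and it lies in its kernel
  -- because `H q = 0` and `lower` shifts weights by `-1/2`. The splitting makes this intersection
  -- zero.
  have hlq : ρ.lower τ q = 0 := by
    rw [← hHp]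
    refine h1.eq_zero _ hpA ?_
    rw [hHp, hτ.twist_H_lower hq, hHq, map_zero]
    module
  set d := ofList 1 (ρ.diff (toList (cochainZero w))) with hd
  have hdd : toList d = ρ.diff (toList (cochainZero w)) := by
    rw [hd, toList_ofList, ← diff_degreePart, degreePart_toList]
  have hdB : d ∈ ρ.coboundaries 1 :=
    (ρ.mem_coboundaries_iff d).mpr ⟨cochainZero w, isAlt_toList_zero _, hdd⟩
  have hdZ : d ∈ ρ.cocycles 1 := by
    rw [mem_cocycles_iff, hdd, diff_diff]
    exact ⟨(isAlt_toList_zero _).diff ρ, rfl⟩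
  refine ⟨g - d, Submodule.sub_mem _ hg hdZ, ?_, ?_, q, p₀ - ρ.lower τ w, hq, hpA, hHq, hlq,
    hHp.trans hlq, ?_⟩
  · rw [← sub_add]
    exact Submodule.add_mem _ hfg hdB
  · rw [toList_sub, map_sub, hgA, zero_sub, neg_eq_zero]
    exact contract_toList_one d (by rw [hdd, diff_singleton, toList_cochainZero, hw])
  · rw [toList_sub, Pi.sub_apply, hdd, diff_singleton, toList_cochainZero, ρ.twist_B_eq τ, hp₀,
      hgq, τ.map_add]
    module

/-- The pair `(q, y)` is realised by a 1-cochain `g` with `L_A g = 0`, `g(H) = q` and `g(B) = y -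
2τq`. Then `d g` has the prescribed value on `(H, B)`, and the difference from `f` is unobstructed.
-/
theorem IsLift.mem_coboundaries_two (hτ : ρ.IsLift τ) (hA : Function.Surjective (ρ.twist .A))
    {f : MultilinearMap ℝ (fun _ : Fin 2 => Osp) M} (hf : f ∈ ρ.cocycles 2)
    (hfA : contract 𝕜 .A (toList f) = 0) {y q : M} (hy : ρ.twist .A y = 0)
    (hq : ρ.twist .A q = 0)
    (h : toList f [.H, .B] = ρ.twist .H y + (1 / 2 : 𝕜) • y - ρ.lower τ q) :
    f ∈ ρ.coboundaries 2 := by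
  -- This will be `g(Y)`: invariance under `A` requires `A g(Y) = g(B)`, because `[Y, A] = -B`.
  obtain ⟨s, hs⟩ := hA (y - (2 : 𝕜) • τ q)
  obtain ⟨g, hg, hgA, hgX, hg0, hgH, hgY, hgHY, -⟩ := exists_iterate_contract_A (𝕜 := 𝕜) 0
    (Pi.single 1 (y - (2 : 𝕜) • τ q)) (Pi.single 0 q) (Pi.single 0 s) 0
  have hgL : ρ.lie .A g = 0 := by
    refine ρ.lie_A_eq_zero hg hgA hgX (fun n => ?_) (fun n => ?_) (fun n => ?_) fun n => ?_
    · rw [hg0, hgH]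
      match n with
      | 0 => simp
      | 1 => simp [hτ.twist_A q hq, hy]
      | n + 2 => simp
    · rw [hgH]
      cases n <;> simp [hq]
    · rw [hg0, hgY, hgHY]
      cases n <;> simp [hs]
    · rw [hgH, hgHY]
      simp
  have hgB : g [.B] = y - (2 : 𝕜) • τ q := by simpa using hg0 1
  have hgq : g [.H] = q := by simpa using hgH 0
  obtain ⟨hv, hd⟩ := (ρ.mem_cocycles_iff f).mp hf
  set d := ofList 2 (ρ.diff g) with hd'
  have hdd : toList d = ρ.diff (degreePart 1 g) := by
    rw [hd', toList_ofList, diff_degreePart]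
  have hdB : d ∈ ρ.coboundaries 2 := ρ.mem_coboundaries_of (hg.degreePart 1) hdd
  have hdZ : d ∈ ρ.cocycles 2 := by
    rw [mem_cocycles_iff, hdd, diff_diff]
    exact ⟨(hg.degreePart 1).diff ρ, rfl⟩
  have hfd : f - d ∈ ρ.coboundaries 2 := by
    refine ρ.mem_coboundaries_of_relative (Submodule.sub_mem _ hf hdZ) ?_ ?_
    · rw [toList_sub, map_sub, hfA, hd', toList_ofList, contract_degreePart, contract_diff, hgL,
        hgA, map_zero]
      funext l
      simp [degreePart]
    · rw [toList_sub, Pi.sub_apply, h, hd', toList_ofList,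
        degreePart_apply (n := 2) (l := [.H, .B]) _ rfl, diff_H_B, hgB,
        hgq, ρ.twist_B_eq τ, map_sub, map_smul, hτ.twist_H q hq]
      module
  simpa using Submodule.add_mem _ hfd hdB

/-- Subtracting from a primitive `g` the coboundary of `m` with `A m = g(A)` removes its
`A`-component without changing `d g`; its values on `H` and `B` then give `q` and `y`. -/
theorem IsLift.exists_of_mem_coboundaries_two (hτ : ρ.IsLift τ)
    (hA : Function.Surjective (ρ.twist .A))
    {f : MultilinearMap ℝ (fun _ : Fin 2 => Osp) M} (hf : f ∈ ρ.coboundaries 2)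
    (hfA : contract 𝕜 .A (toList f) = 0) : ∃ y q : M, ρ.twist .A y = 0 ∧ ρ.twist .A q = 0 ∧
      toList f [.H, .B] = ρ.twist .H y + (1 / 2 : 𝕜) • y - ρ.lower τ q := by
  obtain ⟨g, -, hfg⟩ := (ρ.mem_coboundaries_iff f).mp hf
  obtain ⟨m, hm⟩ := hA (toList g [.A])
  set g' := g - ofList 1 (ρ.diff (toList (cochainZero m))) with hg'
  have hgg : toList g' = toList g - ρ.diff (toList (cochainZero m)) := by
    rw [hg', toList_sub, toList_ofList, ← diff_degreePart, degreePart_toList]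
  have hfg' : toList f = ρ.diff (toList g') := by
    rw [hgg, map_sub, diff_diff, sub_zero, hfg]
  have hg'A : contract 𝕜 .A (toList g') = 0 := by
    refine contract_toList_one g' ?_
    rw [hgg, Pi.sub_apply, diff_singleton, toList_cochainZero, hm, sub_self]
  have hv := isAlt_toList_one (𝕜 := 𝕜) g'
  have hL : ρ.lie .A (toList g') = 0 := by
    have h := ρ.contract_diff .A (toList g')
    rw [← hfg', hfA, hg'A, map_zero, sub_zero] at h
    exact h.symm
  have hq := ρ.twist_A_H_eq hv hg'A hL
  refine ⟨toList g' [.B] + (2 : 𝕜) • τ (toList g' [.H]), toList g' [.H], ?_, hq, ?_⟩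
  · rw [map_add, map_smul, hτ.twist_A _ hq, ρ.twist_A_B_eq hv hL]
    module
  · rw [hfg', diff_H_B, ρ.twist_B_eq τ, map_add, map_smul, hτ.twist_H _ hq]
    module

end OspModule

end LowDegree

/-! ### Commutation relations between the basic operators. -/

section Relations

variable {𝕜 : Type*} [RCLike 𝕜] {c : CoeffClass}

namespace DiffOp

theorem ext {S T : DiffOp 𝕜 c} (h₀ : ∀ F, (S.1 F).fst = (T.1 F).fst)
    (h₁ : ∀ F, (S.1 F).snd = (T.1 F).snd) : S = T :=
  Subtype.ext <| LinearMap.ext fun F => TrivSqZeroExt.ext (h₀ F) (h₁ F)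

theorem mul_val (S T : DiffOp 𝕜 c) (F : SuperFun 𝕜) : (S * T).1 F = S.1 (T.1 F) := rfl

theorem add_val (S T : DiffOp 𝕜 c) (F : SuperFun 𝕜) : (S + T).1 F = S.1 F + T.1 F := rfl

theorem sub_val (S T : DiffOp 𝕜 c) (F : SuperFun 𝕜) : (S - T).1 F = S.1 F - T.1 F := rfl

theorem neg_val (S : DiffOp 𝕜 c) (F : SuperFun 𝕜) : (-S).1 F = -S.1 F := rfl

theorem smul_val (r : 𝕜) (S : DiffOp 𝕜 c) (F : SuperFun 𝕜) : (r • S).1 F = r • S.1 F := rfl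

theorem one_val (F : SuperFun 𝕜) : (1 : DiffOp 𝕜 c).1 F = F := rfl

theorem zero_val (F : SuperFun 𝕜) : (0 : DiffOp 𝕜 c).1 F = 0 := rfl

theorem x_fst (F : SuperFun 𝕜) : ((x 𝕜 c).1 F).fst = smoothX 𝕜 * F.fst := by
  simp [x, mulOp, coordX]

theorem x_snd (F : SuperFun 𝕜) : ((x 𝕜 c).1 F).snd = smoothX 𝕜 * F.snd := by
  simp [x, mulOp, coordX]

theorem θ_fst (F : SuperFun 𝕜) : ((θ 𝕜 c).1 F).fst = 0 := by
  simp [θ, mulOp, coordTheta]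

theorem θ_snd (F : SuperFun 𝕜) : ((θ 𝕜 c).1 F).snd = F.fst := by
  simp [θ, mulOp, coordTheta]

theorem partialX_fst (F : SuperFun 𝕜) :
    ((partialX 𝕜 c).1 F).fst = smoothDeriv 𝕜 F.fst := by
  simp [partialX, dx]

theorem partialX_snd (F : SuperFun 𝕜) :
    ((partialX 𝕜 c).1 F).snd = smoothDeriv 𝕜 F.snd := by
  simp [partialX, dx]

theorem partialTheta_fst (F : SuperFun 𝕜) : ((partialTheta 𝕜 c).1 F).fst = F.snd := by
  simp [partialTheta, dtheta]

theorem partialTheta_snd (F : SuperFun 𝕜) : ((partialTheta 𝕜 c).1 F).snd = 0 := by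
  simp [partialTheta, dtheta]

theorem field_val (l : ℝ) (b : OspBasis) (F : SuperFun 𝕜) :
    (field 𝕜 c l b).1 F = contactOp l (hamiltonian 𝕜 b) F := rfl

theorem ε_fst (F : SuperFun 𝕜) : ((ε 𝕜 c).1 F).fst = F.fst := signOp_fst F

theorem ε_snd (F : SuperFun 𝕜) : ((ε 𝕜 c).1 F).snd = -F.snd := signOp_snd F

variable (𝕜 c) in
/-- The operator `η̄ = ∂_θ - θ ∂_x`. -/
def etaBarOp : DiffOp 𝕜 c := partialTheta 𝕜 c - θ 𝕜 c * partialX 𝕜 c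

variable (𝕜 c) in
/-- The operator `η = ∂_θ + θ ∂_x`, by which `A` acts on densities of any weight. -/
def etaOp : DiffOp 𝕜 c := field 𝕜 c 0 .A

theorem etaBarOp_fst (F : SuperFun 𝕜) : ((etaBarOp 𝕜 c).1 F).fst = F.snd := by
  rw [etaBarOp, sub_val, TrivSqZeroExt.fst_sub, partialTheta_fst, mul_val, θ_fst, sub_zero]

theorem etaBarOp_snd (F : SuperFun 𝕜) :
    ((etaBarOp 𝕜 c).1 F).snd = -smoothDeriv 𝕜 F.fst := by
  rw [etaBarOp, sub_val, TrivSqZeroExt.snd_sub, partialTheta_snd, mul_val, θ_snd, partialX_fst,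
    zero_sub]

theorem etaOp_fst (F : SuperFun 𝕜) : ((etaOp 𝕜 c).1 F).fst = F.snd := contactOp_fst 0 .A F

theorem etaOp_snd (F : SuperFun 𝕜) : ((etaOp 𝕜 c).1 F).snd = smoothDeriv 𝕜 F.fst :=
  contactOp_snd 0 .A F

theorem field_A (l : ℝ) : field 𝕜 c l .A = etaOp 𝕜 c :=
  ext (fun F => (contactOp_fst l .A F).trans (contactOp_fst 0 .A F).symm)
    fun F => (contactOp_snd l .A F).trans (contactOp_snd 0 .A F).symm

theorem field_B (l : ℝ) :
    field 𝕜 c l .B = -(x 𝕜 c * etaOp 𝕜 c) - (2 * l : 𝕜) • θ 𝕜 c := by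
  refine ext (fun F => ?_) fun F => ?_
  · rw [field_val, contactOp_fst]
    simp [sub_val, neg_val, smul_val, mul_val, x_fst, etaOp_fst, θ_fst]
  · rw [field_val, contactOp_snd]
    simp [sub_val, neg_val, smul_val, mul_val, x_snd, etaOp_snd, θ_snd]

theorem θ_mul_θ : θ 𝕜 c * θ 𝕜 c = 0 := by
  refine ext (fun F => ?_) fun F => ?_ <;> simp [mul_val, zero_val, θ_fst, θ_snd]

theorem etaBarOp_mul_etaBarOp : etaBarOp 𝕜 c * etaBarOp 𝕜 c = -partialX 𝕜 c := by
  refine ext (fun F => ?_) fun F => ?_ <;>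
    simp [mul_val, neg_val, etaBarOp_fst, etaBarOp_snd, partialX_fst, partialX_snd]

theorem etaBarOp_mul_θ : etaBarOp 𝕜 c * θ 𝕜 c = 1 - θ 𝕜 c * etaBarOp 𝕜 c := by
  refine ext (fun F => ?_) fun F => ?_ <;>
    simp [mul_val, sub_val, one_val, etaBarOp_fst, etaBarOp_snd, θ_fst, θ_snd]

theorem etaOp_mul_θ : etaOp 𝕜 c * θ 𝕜 c = 1 - θ 𝕜 c * etaOp 𝕜 c := by
  refine ext (fun F => ?_) fun F => ?_ <;>
    simp [mul_val, sub_val, one_val, etaOp_fst, etaOp_snd, θ_fst, θ_snd]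

theorem etaOp_mul_x : etaOp 𝕜 c * x 𝕜 c = x 𝕜 c * etaOp 𝕜 c + θ 𝕜 c := by
  refine ext (fun F => ?_) fun F => ?_ <;>
    simp [mul_val, add_val, etaOp_fst, etaOp_snd, θ_fst, θ_snd, x_fst, x_snd, smoothDeriv_mul,
      smoothDeriv_X]

theorem etaBarOp_mul_x : etaBarOp 𝕜 c * x 𝕜 c = x 𝕜 c * etaBarOp 𝕜 c - θ 𝕜 c := by
  refine ext (fun F => ?_) fun F => ?_ <;>
    simp [mul_val, sub_val, etaBarOp_fst, etaBarOp_snd, θ_fst, θ_snd, x_fst, x_snd,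
      smoothDeriv_mul, smoothDeriv_X]
  ring

theorem x_mul_θ : x 𝕜 c * θ 𝕜 c = θ 𝕜 c * x 𝕜 c := by
  refine ext (fun F => ?_) fun F => ?_ <;>
    simp [mul_val, θ_fst, θ_snd, x_fst, x_snd]

theorem θ_mul_etaOp : θ 𝕜 c * etaOp 𝕜 c = θ 𝕜 c * etaBarOp 𝕜 c := by
  refine ext (fun F => ?_) fun F => ?_ <;>
    simp [mul_val, etaBarOp_fst, etaOp_fst, θ_fst, θ_snd]

theorem θ_mul_partialTheta : θ 𝕜 c * partialTheta 𝕜 c = θ 𝕜 c * etaBarOp 𝕜 c := by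
  refine ext (fun F => ?_) fun F => ?_ <;>
    simp [mul_val, etaBarOp_fst, partialTheta_fst, θ_fst, θ_snd]

theorem etaOp_mul_etaBarOp : etaOp 𝕜 c * etaBarOp 𝕜 c = -(etaBarOp 𝕜 c * etaOp 𝕜 c) := by
  refine ext (fun F => ?_) fun F => ?_ <;>
    simp [mul_val, neg_val, etaBarOp_fst, etaOp_fst, etaBarOp_snd, etaOp_snd]

theorem field_H_mul_etaBarOp (l : ℝ) : field 𝕜 c l .H * etaBarOp 𝕜 c =
    etaBarOp 𝕜 c * field 𝕜 c l .H + (1 / 2 : 𝕜) • etaBarOp 𝕜 c := by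
  refine ext (fun F => ?_) fun F => ?_
  · simp only [mul_val, add_val, smul_val, field_val, contactOp_fst, contactOp_snd,
      TrivSqZeroExt.fst_add, TrivSqZeroExt.fst_smul, etaBarOp_fst]
    module
  · simp only [mul_val, add_val, smul_val, field_val, contactOp_fst, contactOp_snd,
      TrivSqZeroExt.snd_add, TrivSqZeroExt.snd_smul, etaBarOp_snd, map_sub, map_neg,
      map_smul, smoothDeriv_mul, smoothDeriv_X, mul_neg]
    rw [one_mul]
    module

theorem field_H_mul_θ (l : ℝ) : field 𝕜 c l .H * θ 𝕜 c =
    θ 𝕜 c * field 𝕜 c l .H - (1 / 2 : 𝕜) • θ 𝕜 c := by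
  refine ext (fun F => ?_) fun F => ?_
  · simp [mul_val, sub_val, smul_val, field_val, contactOp_fst, θ_fst]
  · simp only [mul_val, sub_val, smul_val, field_val, contactOp_fst, contactOp_snd,
      TrivSqZeroExt.snd_sub, TrivSqZeroExt.snd_smul, θ_snd]
    module

theorem field_B_mul_θ (l : ℝ) :
    field 𝕜 c l .B * θ 𝕜 c = -x 𝕜 c - θ 𝕜 c * field 𝕜 c l .B := by
  rw [field_B, sub_mul, neg_mul, mul_assoc, etaOp_mul_θ, smul_mul_assoc, θ_mul_θ, mul_sub,
    mul_sub, mul_neg, ← mul_assoc, ← mul_assoc, x_mul_θ, mul_smul_comm, θ_mul_θ]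
  simp
  abel

theorem etaBarOp_mul_field_B (l : ℝ) : etaBarOp 𝕜 c * field 𝕜 c l .B =
    -(field 𝕜 c l .B * etaBarOp 𝕜 c) + θ 𝕜 c * etaBarOp 𝕜 c - (2 * l : 𝕜) • 1 := by
  rw [field_B, mul_sub, mul_neg, ← mul_assoc, etaBarOp_mul_x, sub_mul, mul_assoc (x 𝕜 c),
    mul_smul_comm, etaBarOp_mul_θ, sub_mul, neg_mul, mul_assoc (x 𝕜 c), etaOp_mul_etaBarOp,
    θ_mul_etaOp, smul_mul_assoc, mul_neg]
  module

theorem signMap_x : signMap 𝕜 c (x 𝕜 c) = x 𝕜 c := by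
  refine ext (fun F => ?_) fun F => ?_ <;>
    simp [signMap_apply, mul_val, ε_fst, ε_snd, x_fst, x_snd]

theorem signMap_θ : signMap 𝕜 c (θ 𝕜 c) = -θ 𝕜 c := by
  refine ext (fun F => ?_) fun F => ?_ <;>
    simp [signMap_apply, mul_val, neg_val, ε_fst, ε_snd, θ_fst, θ_snd]

theorem signMap_etaBarOp : signMap 𝕜 c (etaBarOp 𝕜 c) = -etaBarOp 𝕜 c := by
  refine ext (fun F => ?_) fun F => ?_ <;>
    simp [signMap_apply, mul_val, neg_val, ε_fst, ε_snd, etaBarOp_fst, etaBarOp_snd]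

theorem signMap_one : signMap 𝕜 c 1 = 1 := by
  rw [signMap_apply, one_mul, ε_mul_ε]

theorem signMap_etaBarOp_pow (j : ℕ) :
    signMap 𝕜 c (etaBarOp 𝕜 c ^ j) = (-1 : 𝕜) ^ j • etaBarOp 𝕜 c ^ j := by
  induction j with
  | zero => simp [signMap_one]
  | succ j ih =>
    rw [pow_succ, signMap_mul, ih, signMap_etaBarOp, pow_succ]
    simp

theorem delta_eq (k : ℕ) : delta 𝕜 c k = etaBarOp 𝕜 c * partialX 𝕜 c ^ k := by
  rw [delta, etaBarOp, sub_mul, mul_assoc (θ 𝕜 c), pow_succ']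

theorem partialX_pow (k : ℕ) :
    partialX 𝕜 c ^ k = (-1 : 𝕜) ^ k • etaBarOp 𝕜 c ^ (2 * k) := by
  have h : partialX 𝕜 c = (-1 : 𝕜) • etaBarOp 𝕜 c ^ 2 := by
    rw [pow_two, etaBarOp_mul_etaBarOp]
    simp
  rw [h, smul_pow, pow_mul]

theorem delta_eq_pow (k : ℕ) :
    delta 𝕜 c k = (-1 : 𝕜) ^ k • etaBarOp 𝕜 c ^ (2 * k + 1) := by
  rw [delta_eq, partialX_pow, mul_smul_comm, pow_succ']

end DiffOp

end Relations

open scoped ContDiff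

/-! ### Coefficient functions, smooth or polynomial. -/

section Coefficients

variable {𝕜 : Type*} [RCLike 𝕜] {c : CoeffClass}

theorem exists_smoothDeriv_eq (g : SmoothFun 𝕜) : ∃ f, smoothDeriv 𝕜 f = g := by
  have hg : Continuous g.1 := (show ContDiff ℝ ∞ g.1 from g.2).continuous
  have hd : ∀ t, HasDerivAt (fun t => ∫ s in (0 : ℝ)..t, g.1 s) (g.1 t) t := fun t =>
    intervalIntegral.integral_hasDerivAt_right (hg.intervalIntegrable _ _)
      (hg.stronglyMeasurableAtFilter _ _) hg.continuousAt
  have hd' : deriv (fun t => ∫ s in (0 : ℝ)..t, g.1 s) = g.1 := funext fun t => (hd t).deriv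
  refine ⟨⟨fun t => ∫ s in (0 : ℝ)..t, g.1 s, contDiff_infty_iff_deriv.mpr
    ⟨fun t => (hd t).differentiableAt, ?_⟩⟩, Subtype.ext hd'⟩
  rw [hd']
  exact g.2

theorem exists_eq_algebraMap {f : SmoothFun 𝕜} (hf : smoothDeriv 𝕜 f = 0) :
    ∃ r : 𝕜, f = algebraMap 𝕜 (SmoothFun 𝕜) r := by
  refine ⟨f.1 0, Subtype.ext <| funext fun t => ?_⟩
  exact is_const_of_deriv_eq_zero (contDiff_infty_iff_deriv.mp f.2).1
    (fun s => congrFun (congrArg Subtype.val hf) s) t 0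

variable (𝕜) in
/-- The functions on `ℝ` of class `c`. -/
def evenCoeff : CoeffClass → Subalgebra 𝕜 (SmoothFun 𝕜)
  | .smooth => ⊤
  | .polynomial => Algebra.adjoin 𝕜 {smoothX 𝕜}

theorem mem_coeff_iff {F : SuperFun 𝕜} :
    F ∈ coeff 𝕜 c ↔ F.fst ∈ evenCoeff 𝕜 c ∧ F.snd ∈ evenCoeff 𝕜 c := by
  cases c with
  | smooth => exact ⟨fun _ => ⟨Algebra.mem_top, Algebra.mem_top⟩, fun _ => Algebra.mem_top⟩
  | polynomial =>
    constructor
    · intro h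
      refine Algebra.adjoin_induction (fun F hF => ?_) (fun r => ⟨?_, ?_⟩)
        (fun F G _ _ hF hG => ⟨add_mem hF.1 hG.1, add_mem hF.2 hG.2⟩)
        (fun F G _ _ hF hG => ⟨?_, ?_⟩) h
      · rcases hF with rfl | rfl
        · exact ⟨Algebra.subset_adjoin rfl, by simp [coordX]⟩
        · exact ⟨by simp [coordTheta], by simp [coordTheta]⟩
      · exact Subalgebra.algebraMap_mem _ r
      · exact Subalgebra.zero_mem _
      · rw [TrivSqZeroExt.fst_mul]
        exact mul_mem hF.1 hG.1
      · rw [DualNumber.snd_mul]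
        exact add_mem (mul_mem hF.1 hG.2) (mul_mem hF.2 hG.1)
    · rintro ⟨h₀, h₁⟩
      have h : ∀ f ∈ evenCoeff 𝕜 .polynomial,
          (TrivSqZeroExt.inl f : SuperFun 𝕜) ∈ coeff 𝕜 .polynomial := by
        intro f hf
        refine Algebra.adjoin_induction (fun f hf => ?_) (fun r => ?_)
          (fun f g _ _ hf hg => ?_) (fun f g _ _ hf hg => ?_) hf
        · rw [hf]
          exact coordX_mem _
        · exact Subalgebra.algebraMap_mem _ r
        · rw [TrivSqZeroExt.inl_add]
          exact add_mem hf hg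
        · rw [TrivSqZeroExt.inl_mul]
          exact mul_mem hf hg
      have hF : F = TrivSqZeroExt.inl F.fst + TrivSqZeroExt.inl F.snd * coordTheta 𝕜 := by
        ext <;> simp [coordTheta]
      rw [hF]
      exact add_mem (h _ h₀) (mul_mem (h _ h₁) (coordTheta_mem _))

theorem smoothDeriv_aeval (p : Polynomial 𝕜) :
    smoothDeriv 𝕜 (Polynomial.aeval (smoothX 𝕜) p) =
      Polynomial.aeval (smoothX 𝕜) (Polynomial.derivative p) := by
  have h : ∀ n : ℕ, smoothDeriv 𝕜 (smoothX 𝕜 ^ n) = (n : 𝕜) • smoothX 𝕜 ^ (n - 1) := by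
    intro n
    induction n with
    | zero => simp [smoothDeriv_one]
    | succ n ih =>
      rw [pow_succ, smoothDeriv_mul, smoothDeriv_X, ih]
      cases n with
      | zero => simp
      | succ n =>
        simp only [Nat.add_sub_cancel, smul_mul_assoc, ← pow_succ, mul_one]
        push_cast
        module
  induction p using Polynomial.induction_on' with
  | add p q hp hq => simp only [map_add, hp, hq]
  | monomial n a =>
    rw [Polynomial.derivative_monomial, Polynomial.aeval_monomial, Polynomial.aeval_monomial,
      ← Algebra.smul_def, ← Algebra.smul_def, map_smul, h, smul_smul]

theorem smoothDeriv_mem {f : SmoothFun 𝕜} (hf : f ∈ evenCoeff 𝕜 c) :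
    smoothDeriv 𝕜 f ∈ evenCoeff 𝕜 c := by
  cases c with
  | smooth => exact Algebra.mem_top
  | polynomial =>
    rw [evenCoeff, Algebra.adjoin_singleton_eq_range_aeval] at hf ⊢
    obtain ⟨p, rfl⟩ := hf
    exact ⟨_, (smoothDeriv_aeval p).symm⟩

theorem exists_smoothDeriv_eq_of_mem {g : SmoothFun 𝕜} (hg : g ∈ evenCoeff 𝕜 c) :
    ∃ f ∈ evenCoeff 𝕜 c, smoothDeriv 𝕜 f = g := by
  cases c with
  | smooth =>
    obtain ⟨f, hf⟩ := exists_smoothDeriv_eq g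
    exact ⟨f, Algebra.mem_top, hf⟩
  | polynomial =>
    have h : ∀ p : Polynomial 𝕜, ∃ q, Polynomial.derivative q = p := by
      intro p
      induction p using Polynomial.induction_on' with
      | add p q hp hq =>
        obtain ⟨p', rfl⟩ := hp
        obtain ⟨q', rfl⟩ := hq
        exact ⟨p' + q', Polynomial.derivative_add⟩
      | monomial n a =>
        refine ⟨Polynomial.monomial (n + 1) (a / (n + 1)), ?_⟩
        have hn : (n : 𝕜) + 1 ≠ 0 := by exact_mod_cast Nat.succ_ne_zero n
        rw [Polynomial.derivative_monomial, Nat.add_sub_cancel]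
        push_cast
        rw [div_mul_cancel₀ _ hn]
    rw [evenCoeff, Algebra.adjoin_singleton_eq_range_aeval] at hg ⊢
    obtain ⟨p, rfl⟩ := hg
    obtain ⟨q, rfl⟩ := h p
    exact ⟨_, ⟨q, rfl⟩, smoothDeriv_aeval q⟩

end Coefficients

/-! ### Normal form of differential operators in powers of `η̄`. -/

section NormalForm

variable {𝕜 : Type*} [RCLike 𝕜] {c : CoeffClass}

namespace DiffOp

variable (𝕜 c) in
/-- Multiplication by a coefficient, as a differential operator. -/
def ofCoeff : coeff 𝕜 c →ₗ[𝕜] DiffOp 𝕜 c where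
  toFun F := ⟨mulOp F.1, mulOp_mem F.2⟩
  map_add' F G := Subtype.ext (mulOp_add F.1 G.1)
  map_smul' r F := Subtype.ext <| LinearMap.ext fun G => smul_mul_assoc r F.1 G

theorem ofCoeff_val (F : coeff 𝕜 c) (G : SuperFun 𝕜) : (ofCoeff 𝕜 c F).1 G = F.1 * G := rfl

theorem ofCoeff_mul (F G : coeff 𝕜 c) :
    ofCoeff 𝕜 c F * ofCoeff 𝕜 c G = ofCoeff 𝕜 c (F * G) :=
  Subtype.ext (mulOp_mul F.1 G.1).symm

theorem ofCoeff_algebraMap (r : 𝕜) :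
    ofCoeff 𝕜 c (algebraMap 𝕜 (coeff 𝕜 c) r) = r • 1 := by
  refine Subtype.ext <| LinearMap.ext fun G => ?_
  exact (Algebra.smul_def r G).symm

variable (𝕜 c) in
/-- The grading involution of the coefficients. -/
def signCoeff (F : coeff 𝕜 c) : coeff 𝕜 c :=
  ⟨signOp 𝕜 F.1, mem_coeff_iff.mpr
    ⟨by rw [signOp_fst]; exact (mem_coeff_iff.mp F.2).1,
      by rw [signOp_snd]; exact neg_mem (mem_coeff_iff.mp F.2).2⟩⟩

variable (𝕜 c) in
/-- The derivation `η̄` on the coefficients. -/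
def etaBarCoeff (F : coeff 𝕜 c) : coeff 𝕜 c :=
  ⟨(etaBarOp 𝕜 c).1 F.1, mem_coeff_iff.mpr
    ⟨by rw [etaBarOp_fst]; exact (mem_coeff_iff.mp F.2).2,
      by rw [etaBarOp_snd]; exact neg_mem (smoothDeriv_mem (mem_coeff_iff.mp F.2).1)⟩⟩

variable (𝕜 c) in
/-- The derivation `η` on the coefficients. -/
def etaCoeff (F : coeff 𝕜 c) : coeff 𝕜 c :=
  ⟨(etaOp 𝕜 c).1 F.1, mem_coeff_iff.mpr
    ⟨by rw [etaOp_fst]; exact (mem_coeff_iff.mp F.2).2,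
      by rw [etaOp_snd]; exact smoothDeriv_mem (mem_coeff_iff.mp F.2).1⟩⟩

theorem etaBarOp_mul_ofCoeff (F : coeff 𝕜 c) : etaBarOp 𝕜 c * ofCoeff 𝕜 c F =
    ofCoeff 𝕜 c (etaBarCoeff 𝕜 c F) + ofCoeff 𝕜 c (signCoeff 𝕜 c F) * etaBarOp 𝕜 c := by
  refine ext (fun G => ?_) fun G => ?_
  · simp [mul_val, add_val, ofCoeff_val, etaBarOp_fst, etaBarCoeff, signCoeff, signOp_fst]
    ring
  · simp [mul_val, add_val, ofCoeff_val, etaBarOp_fst, etaBarOp_snd, etaBarCoeff, signCoeff,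
      signOp_fst, signOp_snd, smoothDeriv_mul]
    ring

theorem etaOp_mul_ofCoeff (F : coeff 𝕜 c) : etaOp 𝕜 c * ofCoeff 𝕜 c F =
    ofCoeff 𝕜 c (etaCoeff 𝕜 c F) + ofCoeff 𝕜 c (signCoeff 𝕜 c F) * etaOp 𝕜 c := by
  refine ext (fun G => ?_) fun G => ?_
  · simp [mul_val, add_val, ofCoeff_val, etaOp_fst, etaCoeff, signCoeff, signOp_fst]
    ring
  · simp [mul_val, add_val, ofCoeff_val, etaOp_fst, etaOp_snd, etaCoeff, signCoeff,
      signOp_fst, signOp_snd, smoothDeriv_mul]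
    ring

theorem signMap_ofCoeff (F : coeff 𝕜 c) :
    signMap 𝕜 c (ofCoeff 𝕜 c F) = ofCoeff 𝕜 c (signCoeff 𝕜 c F) := by
  refine ext (fun G => ?_) fun G => ?_
  · simp [signMap_apply, mul_val, ofCoeff_val, ε_fst, signCoeff, signOp_fst]
  · simp [signMap_apply, mul_val, ofCoeff_val, ε_fst, ε_snd, signCoeff, signOp_fst, signOp_snd]
    ring

theorem signCoeff_signCoeff (F : coeff 𝕜 c) : signCoeff 𝕜 c (signCoeff 𝕜 c F) = F :=
  Subtype.ext (LinearMap.congr_fun signOp_signOp F.1)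

/-- Since `η` sends `f₀ + f₁θ` to `f₁ + f₀'θ`, an antiderivative within the coefficient class gives
a preimage. The grading involution is included to match the action of `A`. -/
theorem exists_etaCoeff_eq (F : coeff 𝕜 c) :
    ∃ G, etaCoeff 𝕜 c (signCoeff 𝕜 c G) = F := by
  obtain ⟨f, hf, hfF⟩ := exists_smoothDeriv_eq_of_mem (mem_coeff_iff.mp F.2).2
  refine ⟨signCoeff 𝕜 c ⟨TrivSqZeroExt.inl f + TrivSqZeroExt.inr F.1.fst,
    mem_coeff_iff.mpr ⟨by simpa using hf, by simpa using (mem_coeff_iff.mp F.2).1⟩⟩, ?_⟩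
  rw [signCoeff_signCoeff]
  refine Subtype.ext (TrivSqZeroExt.ext ?_ ?_)
  · simp [etaCoeff, etaOp_fst]
  · simpa [etaCoeff, etaOp_snd] using hfF

theorem exists_eq_algebraMap_of_etaCoeff {F : coeff 𝕜 c}
    (hF : etaCoeff 𝕜 c (signCoeff 𝕜 c F) = 0) : ∃ r : 𝕜, F = algebraMap 𝕜 (coeff 𝕜 c) r := by
  have h := congrArg Subtype.val hF
  have h₀ := congrArg TrivSqZeroExt.fst h
  have h₁ := congrArg TrivSqZeroExt.snd h
  simp only [etaCoeff, signCoeff, etaOp_fst, etaOp_snd, signOp_fst, signOp_snd] at h₀ h₁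
  have h₂ : smoothDeriv 𝕜 F.1.fst = 0 := h₁
  obtain ⟨r, hr⟩ := exists_eq_algebraMap h₂
  exact ⟨r, Subtype.ext (TrivSqZeroExt.ext hr (neg_eq_zero.mp h₀))⟩

theorem sum_val {ι : Type*} (s : Finset ι) (S : ι → DiffOp 𝕜 c) (F : SuperFun 𝕜) :
    (∑ i ∈ s, S i).1 F = ∑ i ∈ s, (S i).1 F := by
  classical
  induction s using Finset.induction_on with
  | empty => rfl
  | insert i s hi ih => rw [Finset.sum_insert hi, Finset.sum_insert hi, add_val, ih]

/-- The space of such sums contains `1` and is stable under left multiplication by coefficients and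
by `η̄`, hence by `∂_x = -η̄²` and by `∂_θ = η̄ + θ∂_x`. It is therefore everything. -/
theorem exists_eq_sum (T : DiffOp 𝕜 c) : ∃ (n : ℕ) (a : ℕ → coeff 𝕜 c),
    T = ∑ j ∈ Finset.range n, ofCoeff 𝕜 c (a j) * etaBarOp 𝕜 c ^ j := by
  set Φ : (ℕ →₀ coeff 𝕜 c) →ₗ[𝕜] DiffOp 𝕜 c := Finsupp.lsum 𝕜 fun j =>
    LinearMap.mulRight 𝕜 (etaBarOp 𝕜 c ^ j) ∘ₗ ofCoeff 𝕜 c with hΦ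
  have hs : ∀ j F, Φ (Finsupp.single j F) = ofCoeff 𝕜 c F * etaBarOp 𝕜 c ^ j := by
    intro j F
    simp [hΦ]
  have hE : ∀ n ∈ LinearMap.range Φ, etaBarOp 𝕜 c * n ∈ LinearMap.range Φ := by
    rintro _ ⟨F, rfl⟩
    induction F using Finsupp.induction_linear with
    | zero => simp
    | add F G hF hG =>
      rw [map_add, mul_add]
      exact add_mem hF hG
    | single j F =>
      rw [hs, ← mul_assoc, etaBarOp_mul_ofCoeff, add_mul, mul_assoc, ← pow_succ', ← hs, ← hs]
      exact add_mem ⟨_, rfl⟩ ⟨_, rfl⟩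
  have hM : ∀ G, ∀ n ∈ LinearMap.range Φ, ofCoeff 𝕜 c G * n ∈ LinearMap.range Φ := by
    rintro G _ ⟨F, rfl⟩
    induction F using Finsupp.induction_linear with
    | zero => simp
    | add F G hF hG =>
      rw [map_add, mul_add]
      exact add_mem hF hG
    | single j F =>
      rw [hs, ← mul_assoc, ofCoeff_mul, ← hs]
      exact ⟨_, rfl⟩
  have hX : ∀ n ∈ LinearMap.range Φ, partialX 𝕜 c * n ∈ LinearMap.range Φ := by
    intro n hn
    rw [← neg_neg (partialX 𝕜 c), ← etaBarOp_mul_etaBarOp, neg_mul, mul_assoc]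
    exact neg_mem (hE _ (hE _ hn))
  have hθ : ∀ n ∈ LinearMap.range Φ, partialTheta 𝕜 c * n ∈ LinearMap.range Φ := by
    intro n hn
    have h : partialTheta 𝕜 c = etaBarOp 𝕜 c + θ 𝕜 c * partialX 𝕜 c := by
      rw [etaBarOp, sub_add_cancel]
    rw [h, add_mul, mul_assoc]
    exact add_mem (hE _ hn) (hM ⟨coordTheta 𝕜, coordTheta_mem c⟩ _ (hX _ hn))
  have hT : ∀ n ∈ LinearMap.range Φ, T * n ∈ LinearMap.range Φ := by
    refine Algebra.adjoin_induction (p := fun S _ => ∀ S' : DiffOp 𝕜 c, S'.1 = S →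
      ∀ n ∈ LinearMap.range Φ, S' * n ∈ LinearMap.range Φ) (fun S hS S' hS' n hn => ?_)
      (fun r S' hS' n hn => ?_) (fun R S hR hS ihR ihS S' hS' n hn => ?_)
      (fun R S hR hS ihR ihS S' hS' n hn => ?_) T.2 T rfl
    · rcases hS with ⟨G, hG, rfl⟩ | rfl | rfl
      · have h : S' = ofCoeff 𝕜 c ⟨G, hG⟩ := Subtype.ext hS'
        exact h ▸ hM ⟨G, hG⟩ n hn
      · have h : S' = partialX 𝕜 c := Subtype.ext hS'
        exact h ▸ hX n hn
      · have h : S' = partialTheta 𝕜 c := Subtype.ext hS'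
        exact h ▸ hθ n hn
    · have h : S' = algebraMap 𝕜 (DiffOp 𝕜 c) r := Subtype.ext hS'
      rw [h, ← Algebra.smul_def]
      exact Submodule.smul_mem _ r hn
    · obtain ⟨R', hR'⟩ : ∃ R' : DiffOp 𝕜 c, R'.1 = R := ⟨⟨R, hR⟩, rfl⟩
      obtain ⟨S₁, hS₁⟩ : ∃ S₁ : DiffOp 𝕜 c, S₁.1 = S := ⟨⟨S, hS⟩, rfl⟩
      have h : S' = R' + S₁ := Subtype.ext (by rw [hS', ← hR', ← hS₁]; rfl)
      rw [h, add_mul]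
      exact add_mem (ihR R' hR' n hn) (ihS S₁ hS₁ n hn)
    · obtain ⟨R', hR'⟩ : ∃ R' : DiffOp 𝕜 c, R'.1 = R := ⟨⟨R, hR⟩, rfl⟩
      obtain ⟨S₁, hS₁⟩ : ∃ S₁ : DiffOp 𝕜 c, S₁.1 = S := ⟨⟨S, hS⟩, rfl⟩
      have h : S' = R' * S₁ := Subtype.ext (by rw [hS', ← hR', ← hS₁]; rfl)
      rw [h, mul_assoc]
      exact ihR R' hR' _ (ihS S₁ hS₁ n hn)
  obtain ⟨F, hF⟩ := hT 1 ⟨Finsupp.single 0 (algebraMap 𝕜 _ 1), by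
    rw [hs, ofCoeff_algebraMap, pow_zero, one_smul, one_mul]⟩
  refine ⟨F.support.sup id + 1, F, ?_⟩
  rw [mul_one] at hF
  rw [← hF]
  refine Finsupp.sum_of_support_subset F (fun j hj => ?_) _ fun j _ => by simp
  exact Finset.mem_range.mpr (Nat.lt_succ_of_le (Finset.le_sup (f := id) hj))

/-- Test on iterated `η̄`-primitives of `1`: on the `j`-th one, `η̄^j` gives `1` and higher powers
give `0`, while the lower coefficients vanish by induction. -/
theorem eq_zero_of_sum_eq_zero {n : ℕ} {a : ℕ → coeff 𝕜 c}
    (h : ∑ j ∈ Finset.range n, ofCoeff 𝕜 c (a j) * etaBarOp 𝕜 c ^ j = 0) {j : ℕ} (hj : j < n) :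
    a j = 0 := by
  have hsurj : ∀ F : SuperFun 𝕜, ∃ G, (etaBarOp 𝕜 c).1 G = F := by
    intro F
    obtain ⟨f, hf⟩ := exists_smoothDeriv_eq (-F.snd)
    refine ⟨TrivSqZeroExt.inl f + TrivSqZeroExt.inr F.fst, TrivSqZeroExt.ext ?_ ?_⟩
    · simp [etaBarOp_fst]
    · simp [etaBarOp_snd, hf]
  choose r hr using hsurj
  set g : ℕ → SuperFun 𝕜 := fun i => r^[i] 1 with hg
  have hg0 : (etaBarOp 𝕜 c).1 1 = 0 := by
    refine TrivSqZeroExt.ext ?_ ?_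
    · simp [etaBarOp_fst]
    · simp [etaBarOp_snd, smoothDeriv_one]
  have hlow : ∀ k i, ((etaBarOp 𝕜 c ^ i).1 (g (i + k))) = g k := by
    intro k i
    induction i with
    | zero => rw [pow_zero, one_val, zero_add]
    | succ i ih =>
      rw [pow_succ, mul_val, show i + 1 + k = (i + k) + 1 by omega, hg]
      simp only
      rw [Function.iterate_succ_apply', hr]
      exact ih
  have hhigh : ∀ i k, ((etaBarOp 𝕜 c ^ (i + k + 1)).1 (g i)) = 0 := by
    intro i k
    have h1 := hlow 0 i
    rw [add_zero] at h1
    rw [show i + k + 1 = k + (1 + i) by omega, pow_add, mul_val, pow_add, mul_val, h1, pow_one]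
    change (etaBarOp 𝕜 c ^ k).1 ((etaBarOp 𝕜 c).1 1) = 0
    rw [hg0, map_zero]
  induction j using Nat.strong_induction_on with
  | _ j ih =>
    have h1 := sum_val (Finset.range n) (fun i => ofCoeff 𝕜 c (a i) * etaBarOp 𝕜 c ^ i) (g j)
    rw [h, zero_val, Finset.sum_eq_single j] at h1
    · have h2 := hlow 0 j
      rw [add_zero] at h2
      rw [mul_val, h2, ofCoeff_val] at h1
      refine Subtype.ext ?_
      rw [← mul_one (a j).1]
      exact h1.symm
    · intro i hi hij
      rcases lt_or_gt_of_ne hij with hlt | hgt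
      · rw [ih i hlt (Finset.mem_range.mp hi), map_zero, zero_mul, zero_val]
      · obtain ⟨k, rfl⟩ := Nat.exists_eq_add_of_lt hgt
        rw [mul_val, hhigh, map_zero]
    · intro h
      exact absurd (Finset.mem_range.mpr hj) h

end DiffOp

end NormalForm

/-! ### Kernel of `A` and weights in the density modules. -/

section Density

variable {𝕜 : Type*} [RCLike 𝕜] {c : CoeffClass} {l m : ℝ}

namespace DiffOp

theorem twist_A (T : DiffOp 𝕜 c) : (densityModule 𝕜 c l m).twist .A T =
    etaOp 𝕜 c * signMap 𝕜 c T - T * etaOp 𝕜 c := by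
  change field 𝕜 c m .A * signMap 𝕜 c T - signMap 𝕜 c (signMap 𝕜 c T) * field 𝕜 c l .A = _
  rw [signMap_signMap, field_A, field_A]

theorem twist_B (T : DiffOp 𝕜 c) : (densityModule 𝕜 c l m).twist .B T =
    field 𝕜 c m .B * signMap 𝕜 c T - T * field 𝕜 c l .B := by
  change field 𝕜 c m .B * signMap 𝕜 c T - signMap 𝕜 c (signMap 𝕜 c T) * field 𝕜 c l .B = _
  rw [signMap_signMap]

theorem twist_H (T : DiffOp 𝕜 c) : (densityModule 𝕜 c l m).twist .H T =
    field 𝕜 c m .H * T - T * field 𝕜 c l .H := rfl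

theorem field_H_eq (l m : ℝ) :
    field 𝕜 c m .H = field 𝕜 c l .H + (l - m : 𝕜) • 1 := by
  refine ext (fun F => ?_) fun F => ?_
  · simp only [add_val, smul_val, one_val, field_val, contactOp_fst, TrivSqZeroExt.fst_add,
      TrivSqZeroExt.fst_smul]
    module
  · simp only [add_val, smul_val, one_val, field_val, contactOp_snd, TrivSqZeroExt.snd_add,
      TrivSqZeroExt.snd_smul]
    module

theorem field_B_eq (l m : ℝ) :
    field 𝕜 c m .B = field 𝕜 c l .B + (2 * (l - m) : 𝕜) • θ 𝕜 c := by
  rw [field_B, field_B]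
  module

theorem etaOp_mul_etaBarOp_pow (j : ℕ) :
    etaOp 𝕜 c * etaBarOp 𝕜 c ^ j = (-1 : 𝕜) ^ j • (etaBarOp 𝕜 c ^ j * etaOp 𝕜 c) := by
  induction j with
  | zero => simp
  | succ j ih =>
    rw [pow_succ, ← mul_assoc, ih, smul_mul_assoc, mul_assoc, etaOp_mul_etaBarOp, pow_succ,
      mul_assoc]
    simp

/-- Because `η` and `η̄` anticommute, the terms with `η` on the right cancel and only the derivative
of the coefficient survives. -/
theorem twist_A_ofCoeff_mul (F : coeff 𝕜 c) (j : ℕ) :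
    (densityModule 𝕜 c l m).twist .A (ofCoeff 𝕜 c F * etaBarOp 𝕜 c ^ j) =
      (-1 : 𝕜) ^ j •
        (ofCoeff 𝕜 c (etaCoeff 𝕜 c (signCoeff 𝕜 c F)) * etaBarOp 𝕜 c ^ j) := by
  rw [twist_A, signMap_mul, signMap_ofCoeff, signMap_etaBarOp_pow, mul_smul_comm, mul_smul_comm,
    ← mul_assoc, etaOp_mul_ofCoeff, signCoeff_signCoeff, add_mul, mul_assoc _ (etaOp 𝕜 c),
    etaOp_mul_etaBarOp_pow, mul_smul_comm, smul_add, smul_smul, ← mul_pow, mul_assoc]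
  simp

theorem twist_A_surjective : Function.Surjective ((densityModule 𝕜 c l m).twist .A) := by
  intro T
  obtain ⟨n, a, rfl⟩ := exists_eq_sum T
  choose r hr using exists_etaCoeff_eq (𝕜 := 𝕜) (c := c)
  refine ⟨∑ j ∈ Finset.range n, (-1 : 𝕜) ^ j • (ofCoeff 𝕜 c (r (a j)) * etaBarOp 𝕜 c ^ j), ?_⟩
  rw [map_sum]
  refine Finset.sum_congr rfl fun j _ => ?_
  rw [map_smul, twist_A_ofCoeff_mul, hr, smul_smul, ← mul_pow]
  simp

theorem twist_A_aeval (p : Polynomial 𝕜) :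
    (densityModule 𝕜 c l m).twist .A (Polynomial.aeval (etaBarOp 𝕜 c) p) = 0 := by
  induction p using Polynomial.induction_on' with
  | add p q hp hq => rw [map_add, map_add, hp, hq, add_zero]
  | monomial j a =>
    rw [Polynomial.aeval_monomial, ← Algebra.smul_def, map_smul, twist_A, signMap_etaBarOp_pow,
      mul_smul_comm, etaOp_mul_etaBarOp_pow, smul_smul, ← mul_pow]
    simp

/-- By uniqueness of the normal form each coefficient is annihilated by `η`, up to the grading
involution, and hence constant. -/
theorem exists_eq_aeval {T : DiffOp 𝕜 c} (hT : (densityModule 𝕜 c l m).twist .A T = 0) :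
    ∃ p : Polynomial 𝕜, T = Polynomial.aeval (etaBarOp 𝕜 c) p := by
  obtain ⟨n, a, rfl⟩ := exists_eq_sum T
  have h : ∀ j, ∃ r : 𝕜, j < n → a j = algebraMap 𝕜 (coeff 𝕜 c) r := by
    intro j
    by_cases hj : j < n
    · have h0 : ∑ j ∈ Finset.range n, ofCoeff 𝕜 c ((-1 : 𝕜) ^ j •
          etaCoeff 𝕜 c (signCoeff 𝕜 c (a j))) * etaBarOp 𝕜 c ^ j = 0 := by
        rw [← hT, map_sum]
        refine Finset.sum_congr rfl fun j _ => ?_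
        rw [twist_A_ofCoeff_mul, map_smul, smul_mul_assoc]
      have h1 := eq_zero_of_sum_eq_zero h0 hj
      obtain ⟨r, hr⟩ := exists_eq_algebraMap_of_etaCoeff
        ((smul_eq_zero.mp h1).resolve_left (pow_ne_zero j (by simp)))
      exact ⟨r, fun _ => hr⟩
    · exact ⟨0, fun h => absurd h hj⟩
  choose r hr using h
  refine ⟨∑ j ∈ Finset.range n, Polynomial.monomial j (r j), ?_⟩
  rw [map_sum]
  refine Finset.sum_congr rfl fun j hj => ?_
  rw [hr j (Finset.mem_range.mp hj), ofCoeff_algebraMap, Polynomial.aeval_monomial,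
    ← Algebra.smul_def, smul_mul_assoc, one_mul]

theorem aeval_eq_zero {p : Polynomial 𝕜} (hp : Polynomial.aeval (etaBarOp 𝕜 c) p = 0) :
    p = 0 := by
  ext j
  by_cases hj : j < p.natDegree + 1
  · have h : ∑ j ∈ Finset.range (p.natDegree + 1),
        ofCoeff 𝕜 c (algebraMap 𝕜 (coeff 𝕜 c) (p.coeff j)) * etaBarOp 𝕜 c ^ j = 0 := by
      rw [← hp, Polynomial.aeval_eq_sum_range]
      refine Finset.sum_congr rfl fun j _ => ?_
      rw [ofCoeff_algebraMap, smul_mul_assoc, one_mul]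
    have h1 := eq_zero_of_sum_eq_zero h hj
    rw [Polynomial.coeff_zero]
    exact congrFun (congrArg Subtype.val (congrArg TrivSqZeroExt.fst
      (congrArg Subtype.val h1))) 0
  · rw [Polynomial.coeff_zero, Polynomial.coeff_eq_zero_of_natDegree_lt (by omega)]

/-- The weight of `η̄ ^ j` under `H`. -/
theorem twist_H_pow (j : ℕ) : (densityModule 𝕜 c l m).twist .H (etaBarOp 𝕜 c ^ j) =
    (l - m + j / 2 : 𝕜) • etaBarOp 𝕜 c ^ j := by
  have h : field 𝕜 c l .H * etaBarOp 𝕜 c ^ j =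
      etaBarOp 𝕜 c ^ j * field 𝕜 c l .H + (j / 2 : 𝕜) • etaBarOp 𝕜 c ^ j := by
    induction j with
    | zero => simp
    | succ j ih =>
      rw [pow_succ, ← mul_assoc, ih, add_mul, mul_assoc, field_H_mul_etaBarOp, mul_add,
        mul_smul_comm, smul_mul_assoc]
      push_cast
      simp only [← mul_assoc]
      module
  rw [twist_H, field_H_eq l m, add_mul, h, smul_mul_assoc, one_mul]
  module

theorem coeff_twist_H (p : Polynomial 𝕜) (r : 𝕜) : ∃ q : Polynomial 𝕜,
    (densityModule 𝕜 c l m).twist .H (Polynomial.aeval (etaBarOp 𝕜 c) p) +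
      r • Polynomial.aeval (etaBarOp 𝕜 c) p = Polynomial.aeval (etaBarOp 𝕜 c) q ∧
    ∀ j, q.coeff j = (l - m + j / 2 + r : 𝕜) * p.coeff j := by
  induction p using Polynomial.induction_on' with
  | add p q hp hq =>
    obtain ⟨p', hp', hpc⟩ := hp
    obtain ⟨q', hq', hqc⟩ := hq
    refine ⟨p' + q', ?_, fun j => ?_⟩
    · rw [map_add, map_add, map_add, ← hp', ← hq']
      module
    · rw [Polynomial.coeff_add, Polynomial.coeff_add, hpc, hqc]
      ring
  | monomial j a =>
    refine ⟨Polynomial.monomial j ((l - m + j / 2 + r : 𝕜) * a), ?_, fun i => ?_⟩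
    · rw [Polynomial.aeval_monomial, Polynomial.aeval_monomial, ← Algebra.smul_def,
        ← Algebra.smul_def, map_smul, twist_H_pow]
      module
    · rw [Polynomial.coeff_monomial, Polynomial.coeff_monomial]
      split_ifs with h
      · rw [h]
      · simp

/-- On polynomials in `η̄` the operator `H` is diagonal in the basis of powers, so the kernel and
the image of `H + r` are complementary. -/
theorem isSplit (r : 𝕜) : (densityModule 𝕜 c l m).IsSplit r where
  exists_eq_add v hv := by
    obtain ⟨p, rfl⟩ := exists_eq_aeval hv
    clear hv
    induction p using Polynomial.induction_on' with
    | add p q hp hq =>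
      obtain ⟨u, w, hu, hw, hHu, hp⟩ := hp
      obtain ⟨u', w', hu', hw', hHu', hq⟩ := hq
      refine ⟨u + u', w + w', by rw [map_add, hu, hu', add_zero],
        by rw [map_add, hw, hw', add_zero], ?_, ?_⟩
      · rw [map_add, ← add_zero (0 : DiffOp 𝕜 c)]
        nth_rw 1 [← hHu]
        rw [← hHu']
        module
      · rw [map_add, hp, hq, map_add]
        module
    | monomial j a =>
      have hj : (densityModule 𝕜 c l m).twist .A (etaBarOp 𝕜 c ^ j) = 0 := by
        simpa using twist_A_aeval (c := c) (l := l) (m := m) (Polynomial.X ^ j : Polynomial 𝕜)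
      rw [Polynomial.aeval_monomial, ← Algebra.smul_def]
      by_cases h : (l - m + j / 2 + r : 𝕜) = 0
      · refine ⟨a • etaBarOp 𝕜 c ^ j, 0, by rw [map_smul, hj, smul_zero], map_zero _, ?_, ?_⟩
        · rw [map_smul, twist_H_pow, smul_smul, smul_smul, ← add_smul]
          convert zero_smul 𝕜 _
          linear_combination a * h
        · simp
      · refine ⟨0, (a * (l - m + j / 2 + r : 𝕜)⁻¹) • etaBarOp 𝕜 c ^ j, map_zero _,
          by rw [map_smul, hj, smul_zero], by simp, ?_⟩
        rw [map_smul, twist_H_pow, smul_smul, smul_smul, ← add_smul, zero_add]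
        congr 1
        linear_combination -a * mul_inv_cancel₀ h
  eq_zero v hv h := by
    obtain ⟨p, rfl⟩ := exists_eq_aeval hv
    obtain ⟨q, hq, hqc⟩ := coeff_twist_H (c := c) (l := l) (m := m) p r
    obtain ⟨q', hq', hqc'⟩ := coeff_twist_H (c := c) (l := l) (m := m) q r
    rw [hq, hq'] at h
    have h0 := aeval_eq_zero h
    rw [hq]
    suffices q = 0 by rw [this, map_zero]
    ext j
    have h1 := hqc' j
    rw [h0, Polynomial.coeff_zero, eq_comm, mul_eq_zero] at h1
    rcases h1 with h1 | h1
    · rw [hqc, h1, zero_mul, Polynomial.coeff_zero]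
    · rw [h1, Polynomial.coeff_zero]

/-- The weights `l - m + j/2` are distinct for distinct `j`, so an eigenspace of `H` in the kernel
of `A` is at most a line. -/
theorem exists_eq_smul_pow {r : 𝕜} {v : DiffOp 𝕜 c}
    (hv : (densityModule 𝕜 c l m).twist .A v = 0)
    (h : (densityModule 𝕜 c l m).twist .H v + r • v = 0) :
    v = 0 ∨ ∃ (j : ℕ) (a : 𝕜), (l - m + j / 2 + r : 𝕜) = 0 ∧ v = a • etaBarOp 𝕜 c ^ j := by
  obtain ⟨p, rfl⟩ := exists_eq_aeval hv
  obtain ⟨q, hq, hqc⟩ := coeff_twist_H (c := c) (l := l) (m := m) p r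
  rw [hq] at h
  have h0 := aeval_eq_zero h
  have hc : ∀ j : ℕ, (l - m + j / 2 + r : 𝕜) = 0 ∨ p.coeff j = 0 := by
    intro j
    rw [← mul_eq_zero, ← hqc, h0, Polynomial.coeff_zero]
  by_cases hj : ∃ j : ℕ, (l - m + j / 2 + r : 𝕜) = 0
  · obtain ⟨j, hj⟩ := hj
    refine Or.inr ⟨j, p.coeff j, hj, ?_⟩
    have hp : p = Polynomial.monomial j (p.coeff j) := by
      ext i
      rw [Polynomial.coeff_monomial]
      split_ifs with hij
      · rw [hij]
      · refine (hc i).resolve_left fun hi => hij ?_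
        have : (i : 𝕜) = j := by linear_combination 2 * hi - 2 * hj
        exact (Nat.cast_injective this).symm
    conv_lhs => rw [hp, Polynomial.aeval_monomial, ← Algebra.smul_def]
  · left
    have hp : p = 0 := by
      ext i
      exact (hc i).resolve_left fun hi => hj ⟨i, hi⟩
    rw [hp, map_zero]

variable (𝕜 c) in
/-- The operator `T ↦ -θ ∘ ε ∘ T ∘ ε`. -/
def lift : DiffOp 𝕜 c →ₗ[𝕜] DiffOp 𝕜 c := -(LinearMap.mulLeft 𝕜 (θ 𝕜 c) ∘ₗ signMap 𝕜 c)

theorem lift_apply (T : DiffOp 𝕜 c) : lift 𝕜 c T = -(θ 𝕜 c * signMap 𝕜 c T) := rfl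

theorem twist_A_θ_mul (T : DiffOp 𝕜 c) :
    (densityModule 𝕜 c l m).twist .A (θ 𝕜 c * T) =
      -signMap 𝕜 c T + θ 𝕜 c * (densityModule 𝕜 c l m).twist .A T := by
  rw [twist_A, twist_A, signMap_mul, signMap_θ, neg_mul, mul_neg, ← mul_assoc, etaOp_mul_θ]
  noncomm_ring

theorem twist_A_x_mul (T : DiffOp 𝕜 c) :
    (densityModule 𝕜 c l m).twist .A (x 𝕜 c * T) =
      θ 𝕜 c * signMap 𝕜 c T + x 𝕜 c * (densityModule 𝕜 c l m).twist .A T := by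
  rw [twist_A, twist_A, signMap_mul, signMap_x, ← mul_assoc, etaOp_mul_x]
  noncomm_ring

theorem twist_B_θ_mul (T : DiffOp 𝕜 c) :
    (densityModule 𝕜 c l m).twist .B (θ 𝕜 c * T) =
      x 𝕜 c * signMap 𝕜 c T + θ 𝕜 c * (densityModule 𝕜 c l m).twist .B T := by
  rw [twist_B, twist_B, signMap_mul, signMap_θ, neg_mul, mul_neg, ← mul_assoc, field_B_mul_θ]
  noncomm_ring

/-- Since `ηθ + θη = 1`, left multiplication by `θ` inverts the action of `A` on its kernel up to
the grading involution and a sign; `θ` has weight `-1/2`. -/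
theorem isLift : (densityModule 𝕜 c l m).IsLift (lift 𝕜 c) where
  twist_A v hv := by
    -- The kernel of `A` is stable under the grading involution.
    have h : (densityModule 𝕜 c l m).twist .A (signMap 𝕜 c v) = 0 := by
      rw [twist_A, sub_eq_zero] at hv
      rw [twist_A, signMap_signMap, sub_eq_zero]
      have h1 := congrArg (signMap 𝕜 c) hv
      rw [signMap_mul, signMap_mul, signMap_signMap, ← field_A 0, signMap_field] at h1
      simpa [OspBasis.parity, field_A] using h1
    rw [lift_apply, map_neg, twist_A_θ_mul, h, signMap_signMap]
    simp
  twist_H v _ := by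
    have h : (densityModule 𝕜 c l m).twist .H (signMap 𝕜 c v) =
        signMap 𝕜 c ((densityModule 𝕜 c l m).twist .H v) := by
      rw [twist_H, twist_H, map_sub, signMap_mul, signMap_mul, signMap_field, signMap_field]
      simp [OspBasis.parity]
    rw [lift_apply, lift_apply, ← h, map_neg, twist_H, twist_H, ← mul_assoc, field_H_mul_θ,
      sub_mul, smul_mul_assoc, mul_sub, mul_assoc, mul_assoc]
    module

end DiffOp

end Density

/-! ### The operator `lower` on powers of `η̄`. -/

section Weights

variable {𝕜 : Type*} [RCLike 𝕜] {c : CoeffClass} {l m : ℝ}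

namespace DiffOp

/-- The induction alternates between odd and even exponents, each step moving one more `η̄` past the
field `B`. The weight `2l` enters at odd exponents only, which is why the special weights come from
odd powers. -/
theorem etaBarOp_pow_mul_field_B (l : ℝ) (i : ℕ) :
    etaBarOp 𝕜 c ^ (2 * i + 1) * field 𝕜 c l .B =
      -(field 𝕜 c l .B * etaBarOp 𝕜 c ^ (2 * i + 1)) +
        (2 * i + 1 : 𝕜) • (θ 𝕜 c * etaBarOp 𝕜 c ^ (2 * i + 1)) -
        (2 * l + i : 𝕜) • etaBarOp 𝕜 c ^ (2 * i) ∧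
    etaBarOp 𝕜 c ^ (2 * i + 2) * field 𝕜 c l .B =
      field 𝕜 c l .B * etaBarOp 𝕜 c ^ (2 * i + 2) -
        (2 * i + 2 : 𝕜) • (θ 𝕜 c * etaBarOp 𝕜 c ^ (2 * i + 2)) +
        (i + 1 : 𝕜) • etaBarOp 𝕜 c ^ (2 * i + 1) := by
  have heven : ∀ i : ℕ, etaBarOp 𝕜 c ^ (2 * i + 1) * field 𝕜 c l .B =
      -(field 𝕜 c l .B * etaBarOp 𝕜 c ^ (2 * i + 1)) +
        (2 * i + 1 : 𝕜) • (θ 𝕜 c * etaBarOp 𝕜 c ^ (2 * i + 1)) -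
        (2 * l + i : 𝕜) • etaBarOp 𝕜 c ^ (2 * i) →
      etaBarOp 𝕜 c ^ (2 * i + 2) * field 𝕜 c l .B =
      field 𝕜 c l .B * etaBarOp 𝕜 c ^ (2 * i + 2) -
        (2 * i + 2 : 𝕜) • (θ 𝕜 c * etaBarOp 𝕜 c ^ (2 * i + 2)) +
        (i + 1 : 𝕜) • etaBarOp 𝕜 c ^ (2 * i + 1) := by
    intro i h
    rw [pow_succ' _ (2 * i + 1), mul_assoc, h, mul_sub, mul_add, mul_neg, ← mul_assoc,
      etaBarOp_mul_field_B, mul_smul_comm, mul_smul_comm, ← mul_assoc, etaBarOp_mul_θ,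
      ← pow_succ', sub_mul, add_mul, sub_mul, neg_mul, smul_mul_assoc, one_mul, mul_assoc,
      mul_assoc]
    module
  have hodd : ∀ i : ℕ, etaBarOp 𝕜 c ^ (2 * i + 2) * field 𝕜 c l .B =
      field 𝕜 c l .B * etaBarOp 𝕜 c ^ (2 * i + 2) -
        (2 * i + 2 : 𝕜) • (θ 𝕜 c * etaBarOp 𝕜 c ^ (2 * i + 2)) +
        (i + 1 : 𝕜) • etaBarOp 𝕜 c ^ (2 * i + 1) →
      etaBarOp 𝕜 c ^ (2 * (i + 1) + 1) * field 𝕜 c l .B =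
      -(field 𝕜 c l .B * etaBarOp 𝕜 c ^ (2 * (i + 1) + 1)) +
        (2 * (i + 1 : ℕ) + 1 : 𝕜) • (θ 𝕜 c * etaBarOp 𝕜 c ^ (2 * (i + 1) + 1)) -
        (2 * l + (i + 1 : ℕ) : 𝕜) • etaBarOp 𝕜 c ^ (2 * (i + 1)) := by
    intro i h
    rw [show 2 * (i + 1) = 2 * i + 2 by ring, pow_succ' _ (2 * i + 2), mul_assoc, h, mul_add,
      mul_sub, ← mul_assoc, etaBarOp_mul_field_B, mul_smul_comm, mul_smul_comm, ← mul_assoc,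
      etaBarOp_mul_θ, ← pow_succ', sub_mul, add_mul, sub_mul, neg_mul, smul_mul_assoc, one_mul,
      mul_assoc, mul_assoc]
    push_cast
    module
  induction i with
  | zero =>
    refine ⟨?_, heven 0 ?_⟩ <;>
    · rw [mul_zero, zero_add, pow_one, pow_zero, etaBarOp_mul_field_B]
      push_cast
      module
  | succ i ih => exact ⟨hodd i ih.2, heven (i + 1) (hodd i ih.2)⟩

/-- The correction by `lift` cancels the `θ`-terms, including the one from the difference of
weights. The remaining factor vanishes exactly at `l = -i/2`. -/
theorem lower_pow_odd (i : ℕ) :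
    (densityModule 𝕜 c l m).lower (lift 𝕜 c) (etaBarOp 𝕜 c ^ (2 * i + 1)) =
      (2 * l + i : 𝕜) • etaBarOp 𝕜 c ^ (2 * i) := by
  rw [OspModule.lower_apply, twist_B, twist_H_pow, map_smul, lift_apply, signMap_etaBarOp_pow,
    (etaBarOp_pow_mul_field_B l i).1, field_B_eq l m, Odd.neg_one_pow ⟨i, rfl⟩, neg_one_smul,
    add_mul, mul_neg, mul_neg, mul_neg, smul_mul_assoc]
  push_cast
  module

theorem lower_pow_even (i : ℕ) :
    (densityModule 𝕜 c l m).lower (lift 𝕜 c) (etaBarOp 𝕜 c ^ (2 * i + 2)) =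
      (-(i + 1) : 𝕜) • etaBarOp 𝕜 c ^ (2 * i + 1) := by
  rw [OspModule.lower_apply, twist_B, twist_H_pow, map_smul, lift_apply, signMap_etaBarOp_pow,
    (etaBarOp_pow_mul_field_B l i).2, field_B_eq l m, Even.neg_one_pow ⟨i + 1, by ring⟩, one_smul,
    add_mul, smul_mul_assoc]
  push_cast
  module

theorem lower_one : (densityModule 𝕜 c l m).lower (lift 𝕜 c) 1 = 0 := by
  have h := twist_H_pow (𝕜 := 𝕜) (c := c) (l := l) (m := m) 0
  rw [pow_zero] at h
  rw [OspModule.lower_apply, twist_B, h, map_smul, lift_apply, signMap_one, field_B_eq l m]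
  simp only [mul_one, one_mul]
  push_cast
  module

theorem twist_A_pow (j : ℕ) : (densityModule 𝕜 c l m).twist .A (etaBarOp 𝕜 c ^ j) = 0 := by
  simpa using twist_A_aeval (c := c) (l := l) (m := m) (Polynomial.X ^ j : Polynomial 𝕜)

theorem pow_ne_zero (j : ℕ) : etaBarOp 𝕜 c ^ j ≠ 0 := fun h => by
  have h' : Polynomial.aeval (etaBarOp 𝕜 c) (Polynomial.X ^ j : Polynomial 𝕜) = 0 := by simpa
  exact _root_.pow_ne_zero j Polynomial.X_ne_zero (aeval_eq_zero h')

theorem real_weight_eq_zero {n : ℕ} (h : (l - m + n / 2 : 𝕜) = 0) : l - m + (n : ℝ) / 2 = 0 := by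
  have h' : ((l - m + (n : ℝ) / 2 : ℝ) : 𝕜) = 0 := by
    push_cast
    exact h
  exact RCLike.ofReal_eq_zero.mp h'

/-- Outside of the special weights `lower` is a nonzero multiple of a shift. -/
theorem exists_lower_pow (h : ¬ ∃ k : ℕ, l = -k / 2 ∧ m = (k + 1) / 2) {j : ℕ}
    (hj : (l - m + (j + 1 : ℕ) / 2 : 𝕜) = 0) : ∃ r : 𝕜, r ≠ 0 ∧
      (densityModule 𝕜 c l m).lower (lift 𝕜 c) (etaBarOp 𝕜 c ^ (j + 1)) =
        r • etaBarOp 𝕜 c ^ j := by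
  obtain ⟨i, rfl | rfl⟩ := Nat.even_or_odd' j
  · refine ⟨_, fun h0 => h ⟨i, ?_⟩, lower_pow_odd i⟩
    have h1 : 2 * l + i = 0 := by exact_mod_cast h0
    have h2 := real_weight_eq_zero hj
    push_cast at h2
    constructor <;> linarith
  · refine ⟨_, neg_ne_zero.mpr ?_, lower_pow_even i⟩
    exact_mod_cast Nat.succ_ne_zero i

/-- Surjectivity of `lower` from `ker H` onto `ker (H + 1/2)` within the kernel of `A`: if `η̄^j`
has weight `-1/2`, then `η̄^(j+1)` has weight `0` and maps to a nonzero multiple of it. -/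
theorem exists_lower_eq (h : ¬ ∃ k : ℕ, l = -k / 2 ∧ m = (k + 1) / 2) {v : DiffOp 𝕜 c}
    (hv : (densityModule 𝕜 c l m).twist .A v = 0)
    (hH : (densityModule 𝕜 c l m).twist .H v + (1 / 2 : 𝕜) • v = 0) :
    ∃ w, (densityModule 𝕜 c l m).twist .A w = 0 ∧ (densityModule 𝕜 c l m).twist .H w = 0 ∧
      v = (densityModule 𝕜 c l m).lower (lift 𝕜 c) w := by
  obtain rfl | ⟨j, a, hj, rfl⟩ := exists_eq_smul_pow hv hH
  · exact ⟨0, map_zero _, map_zero _, (map_zero _).symm⟩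
  have hj' : (l - m + (j + 1 : ℕ) / 2 : 𝕜) = 0 := by
    rw [← hj]
    push_cast
    ring
  obtain ⟨r, hr, hlow⟩ := exists_lower_pow (c := c) h hj'
  refine ⟨(a * r⁻¹) • etaBarOp 𝕜 c ^ (j + 1), by rw [map_smul, twist_A_pow, smul_zero], ?_, ?_⟩
  · rw [map_smul, twist_H_pow, hj', zero_smul, smul_zero]
  · rw [map_smul, hlow, smul_smul, inv_mul_cancel_right₀ hr]

/-- Injectivity of `lower` on `ker H` within the kernel of `A`. The hypothesis `l ≠ m` excludes the
power `η̄^0 = 1`, which `lower` kills. -/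
theorem eq_zero_of_lower_eq_zero (h : ¬ ∃ k : ℕ, l = -k / 2 ∧ m = (k + 1) / 2) (hlm : l ≠ m)
    {v : DiffOp 𝕜 c} (hv : (densityModule 𝕜 c l m).twist .A v = 0)
    (hH : (densityModule 𝕜 c l m).twist .H v = 0)
    (hlow : (densityModule 𝕜 c l m).lower (lift 𝕜 c) v = 0) : v = 0 := by
  obtain rfl | ⟨j, a, hj, rfl⟩ := exists_eq_smul_pow (r := 0) hv (by rw [hH, zero_smul, add_zero])
  · rfl
  rw [add_zero] at hj
  cases j with
  | zero =>
    refine absurd ?_ hlm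
    simpa [sub_eq_zero] using real_weight_eq_zero hj
  | succ j =>
    obtain ⟨r, hr, hlow'⟩ := exists_lower_pow (c := c) h hj
    rw [map_smul, hlow', smul_smul, smul_eq_zero, mul_eq_zero] at hlow
    rw [(hlow.resolve_right (pow_ne_zero j)).resolve_right hr, zero_smul]

theorem exists_smul_one {v : DiffOp 𝕜 c} (hv : (densityModule 𝕜 c l l).twist .A v = 0)
    (hH : (densityModule 𝕜 c l l).twist .H v = 0) : ∃ a : 𝕜, v = a • 1 := by
  obtain rfl | ⟨j, a, hj, rfl⟩ := exists_eq_smul_pow (r := 0) hv (by rw [hH, zero_smul, add_zero])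
  · exact ⟨0, (zero_smul _ _).symm⟩
  · have hj0 : (j : 𝕜) = 0 := by linear_combination 2 * hj
    rw [Nat.cast_eq_zero.mp hj0, pow_zero]
    exact ⟨a, rfl⟩

/-- For equal weights such a vector would have to be a multiple of `η̄^(-1)`. -/
theorem eq_zero_of_weight {v : DiffOp 𝕜 c} (hv : (densityModule 𝕜 c l l).twist .A v = 0)
    (hH : (densityModule 𝕜 c l l).twist .H v + (1 / 2 : 𝕜) • v = 0) : v = 0 := by
  obtain rfl | ⟨j, a, hj, rfl⟩ := exists_eq_smul_pow hv hH
  · rfl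
  · have hj0 : ((j + 1 : ℕ) : 𝕜) = 0 := by
      push_cast
      linear_combination 2 * hj
    exact absurd (Nat.cast_eq_zero.mp hj0) (Nat.succ_ne_zero j)

/-! ### The special weights -/

theorem weight_eq {k : ℕ} (hl : l = -k / 2) (hm : m = (k + 1) / 2) :
    (l - m : 𝕜) = -k - 1 / 2 := by
  rw [hl, hm]
  push_cast
  ring

theorem twist_A_delta (k : ℕ) : (densityModule 𝕜 c l m).twist .A (delta 𝕜 c k) = 0 := by
  rw [delta_eq_pow, map_smul, twist_A_pow, smul_zero]

theorem twist_A_partialX_pow (k : ℕ) :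
    (densityModule 𝕜 c l m).twist .A (partialX 𝕜 c ^ k) = 0 := by
  rw [partialX_pow, map_smul, twist_A_pow, smul_zero]

theorem twist_H_delta {k : ℕ} (hl : l = -k / 2) (hm : m = (k + 1) / 2) :
    (densityModule 𝕜 c l m).twist .H (delta 𝕜 c k) = 0 := by
  rw [delta_eq_pow, map_smul, twist_H_pow, weight_eq hl hm]
  push_cast
  module

theorem twist_H_partialX_pow {k : ℕ} (hl : l = -k / 2) (hm : m = (k + 1) / 2) :
    (densityModule 𝕜 c l m).twist .H (partialX 𝕜 c ^ k) = (-1 / 2 : 𝕜) • partialX 𝕜 c ^ k := by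
  rw [partialX_pow, map_smul, twist_H_pow, weight_eq hl hm]
  push_cast
  module

theorem lower_delta {k : ℕ} (hl : l = -k / 2) :
    (densityModule 𝕜 c l m).lower (lift 𝕜 c) (delta 𝕜 c k) = 0 := by
  rw [delta_eq_pow, map_smul, lower_pow_odd, hl]
  push_cast
  module

theorem twist_B_delta {k : ℕ} (hl : l = -k / 2) (hm : m = (k + 1) / 2) :
    (densityModule 𝕜 c l m).twist .B (delta 𝕜 c k) = 0 := by
  rw [OspModule.twist_B_eq _ (lift 𝕜 c), lower_delta hl, twist_H_delta hl hm, map_zero, smul_zero,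
    sub_zero]

theorem signMap_delta (k : ℕ) : signMap 𝕜 c (delta 𝕜 c k) = -delta 𝕜 c k := by
  rw [delta_eq_pow, map_smul, signMap_etaBarOp_pow, Odd.neg_one_pow ⟨k, rfl⟩, neg_one_smul,
    smul_neg]

theorem signMap_partialX_pow (k : ℕ) : signMap 𝕜 c (partialX 𝕜 c ^ k) = partialX 𝕜 c ^ k := by
  rw [partialX_pow, map_smul, signMap_etaBarOp_pow, (even_two_mul k).neg_one_pow, one_smul]

theorem delta_mul_θ (k : ℕ) :
    delta 𝕜 c k * θ 𝕜 c = partialX 𝕜 c ^ k - θ 𝕜 c * delta 𝕜 c k := by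
  have h1 : partialX 𝕜 c * θ 𝕜 c = θ 𝕜 c * partialX 𝕜 c := by
    refine ext (fun F => ?_) fun F => ?_ <;>
      simp [mul_val, θ_fst, θ_snd, partialX_fst, partialX_snd]
  have h : partialX 𝕜 c ^ k * θ 𝕜 c = θ 𝕜 c * partialX 𝕜 c ^ k :=
    (Commute.pow_left (show Commute _ _ from h1) k).eq
  rw [delta_eq, mul_assoc, h, ← mul_assoc, etaBarOp_mul_θ, sub_mul, one_mul, mul_assoc]

theorem delta_ne_zero (k : ℕ) : delta 𝕜 c k ≠ 0 := by
  rw [delta_eq_pow]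
  exact smul_ne_zero (_root_.pow_ne_zero k (by simp)) (pow_ne_zero _)

theorem partialX_pow_ne_zero (k : ℕ) : partialX 𝕜 c ^ k ≠ 0 := by
  rw [partialX_pow]
  exact smul_ne_zero (_root_.pow_ne_zero k (by simp)) (pow_ne_zero _)

theorem exists_smul_delta {k : ℕ} (hl : l = -k / 2) (hm : m = (k + 1) / 2) {v : DiffOp 𝕜 c}
    (hv : (densityModule 𝕜 c l m).twist .A v = 0)
    (hH : (densityModule 𝕜 c l m).twist .H v = 0) : ∃ a : 𝕜, v = a • delta 𝕜 c k := by
  obtain rfl | ⟨j, a, hj, rfl⟩ := exists_eq_smul_pow (r := 0) hv (by rw [hH, zero_smul, add_zero])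
  · exact ⟨0, (zero_smul _ _).symm⟩
  · have hj0 : (j : 𝕜) = (2 * k + 1 : ℕ) := by
      rw [weight_eq hl hm] at hj
      push_cast
      linear_combination 2 * hj
    rw [Nat.cast_injective hj0]
    refine ⟨a * (-1) ^ k, ?_⟩
    rw [delta_eq_pow, smul_smul, mul_assoc, ← mul_pow]
    simp

theorem exists_smul_partialX_pow {k : ℕ} (hl : l = -k / 2) (hm : m = (k + 1) / 2)
    {v : DiffOp 𝕜 c} (hv : (densityModule 𝕜 c l m).twist .A v = 0)
    (hH : (densityModule 𝕜 c l m).twist .H v + (1 / 2 : 𝕜) • v = 0) :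
    ∃ a : 𝕜, v = a • partialX 𝕜 c ^ k := by
  obtain rfl | ⟨j, a, hj, rfl⟩ := exists_eq_smul_pow hv hH
  · exact ⟨0, (zero_smul _ _).symm⟩
  · have hj0 : (j : 𝕜) = (2 * k : ℕ) := by
      rw [weight_eq hl hm] at hj
      push_cast
      linear_combination 2 * hj
    rw [Nat.cast_injective hj0]
    refine ⟨a * (-1) ^ k, ?_⟩
    rw [partialX_pow, smul_smul, mul_assoc, ← mul_pow]
    simp

end DiffOp

end Weights

/-! ### Values of explicit cochains on lists. -/

section Cochains

variable {𝕜 M : Type*} [RCLike 𝕜] [AddCommGroup M] [Module 𝕜 M] [Module ℝ M]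
  [IsScalarTower ℝ 𝕜 M]

theorem toList_cochainOne (v : OspBasis → M) (b : OspBasis) : toList (cochainOne v) [b] = v b := by
  rw [toList_singleton]
  exact ofBasis_e (fun κ => v (κ 0)) fun _ : Fin 1 => b

theorem isAlt_toList_two {f : MultilinearMap ℝ (fun _ : Fin 2 => Osp) M}
    (h : ∀ b c, toList f [b, c] = -(koszul 𝕜 b c • toList f [c, b])) : IsAlt 𝕜 (toList f) := by
  intro l₁ b c l₂
  by_cases hl : l₁ = [] ∧ l₂ = []
  · rw [hl.1, hl.2]
    exact h b c
  · have hne : l₁.length + l₂.length ≠ 0 := fun h0 =>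
      hl ⟨List.length_eq_zero_iff.mp (by omega), List.length_eq_zero_iff.mp (by omega)⟩
    rw [toList_of_length_ne f (by simp; omega), toList_of_length_ne f (by simp; omega), smul_zero,
      neg_zero]

theorem isReduced_of_contract {n : ℕ} {f : MultilinearMap ℝ (fun _ : Fin (n + 1) => Osp) M}
    (h : contract 𝕜 .A (toList f) = 0) : IsReduced f := by
  intro κ _
  have h1 := toList_ofFn f (Fin.cons .A κ)
  rw [List.ofFn_cons] at h1
  have h2 : (fun i => Osp.e ((Fin.cons .A κ : Fin (n + 1) → OspBasis) i)) =
      Fin.cons (Osp.e .A) fun t => Osp.e (κ t) := by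
    funext i
    refine Fin.cases ?_ (fun j => ?_) i <;> simp
  rw [← h2, ← h1]
  exact congrFun h (List.ofFn κ)

end Cochains

/-! ### The cocycles `h`, `f_k`, `f̃_k` and `Ω_k`. -/

section Cocycles

variable {𝕜 : Type*} [RCLike 𝕜] {c : CoeffClass} {l m : ℝ}

namespace DiffOp

theorem toList_cup (f g : MultilinearMap ℝ (fun _ : Fin 1 => Osp) (DiffOp 𝕜 c))
    (b b' : OspBasis) : toList (cup f g) [b, b'] =
      toList f [b] * toList g [b'] - koszul 𝕜 b b' • (toList f [b'] * toList g [b]) := by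
  simp only [toList_pair, toList_singleton]
  exact ofBasis_e (fun κ : Fin 2 → OspBasis =>
    f (fun _ => Osp.e (κ 0)) * g (fun _ => Osp.e (κ 1)) -
      (-1 : 𝕜) ^ ((κ 0).parity * (κ 1).parity) •
        (f (fun _ => Osp.e (κ 1)) * g (fun _ => Osp.e (κ 0)))) ![b, b']

theorem isAlt_cup (f g : MultilinearMap ℝ (fun _ : Fin 1 => Osp) (DiffOp 𝕜 c)) :
    IsAlt 𝕜 (toList (cup f g)) := by
  refine isAlt_toList_two fun b b' => ?_
  rw [toList_cup, toList_cup, koszul_comm 𝕜 b' b, smul_sub, smul_smul, koszul_mul_self, one_smul,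
    neg_sub]

theorem contract_A_h : contract 𝕜 .A (toList (h 𝕜 c)) = 0 :=
  contract_toList_one _ (toList_cochainOne _ _)

theorem contract_A_f (k : ℕ) : contract 𝕜 .A (toList (f 𝕜 c k)) = 0 :=
  contract_toList_one _ (toList_cochainOne _ _)

theorem contract_A_fTilde (k : ℕ) : contract 𝕜 .A (toList (fTilde 𝕜 c k)) = 0 :=
  contract_toList_one _ (toList_cochainOne _ _)

theorem h_B : toList (h 𝕜 c) [.B] = (-2 : 𝕜) • θ 𝕜 c := toList_cochainOne _ _

theorem h_H : toList (h 𝕜 c) [.H] = -1 := toList_cochainOne _ _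

theorem h_Y : toList (h 𝕜 c) [.Y] = (-2 : 𝕜) • x 𝕜 c := toList_cochainOne _ _

theorem f_H (k : ℕ) : toList (f 𝕜 c k) [.H] = delta 𝕜 c k := toList_cochainOne _ _

theorem f_B (k : ℕ) : toList (f 𝕜 c k) [.B] = (-2 : 𝕜) • (θ 𝕜 c * delta 𝕜 c k) := by
  refine (toList_cochainOne _ _).trans ?_
  simp only [θ_mul_partialTheta, mul_assoc, delta_eq]

theorem f_Y (k : ℕ) : toList (f 𝕜 c k) [.Y] = (2 : 𝕜) • (x 𝕜 c * delta 𝕜 c k) :=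
  toList_cochainOne _ _

theorem fTilde_H (k : ℕ) : toList (fTilde 𝕜 c k) [.H] = 0 := toList_cochainOne _ _

theorem fTilde_B (k : ℕ) : toList (fTilde 𝕜 c k) [.B] = (-2 : 𝕜) • partialX 𝕜 c ^ k :=
  toList_cochainOne _ _

/-- Closedness on `(B, B)` forces the value on `Y` to be `B` applied to the value on `B`. This
explains the coefficients in the definition; `k = 0` is separate because `lower 1 = 0`. -/
theorem fTilde_Y {k : ℕ} (hl : l = -k / 2) (hm : m = (k + 1) / 2) : toList (fTilde 𝕜 c k) [.Y] =
    (densityModule 𝕜 c l m).twist .B ((-2 : 𝕜) • partialX 𝕜 c ^ k) := by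
  refine (toList_cochainOne _ _).trans ?_
  rw [map_smul, OspModule.twist_B_eq _ (lift 𝕜 c), twist_H_partialX_pow hl hm, map_smul,
    lift_apply, signMap_partialX_pow]
  cases k with
  | zero =>
    rw [pow_zero, lower_one]
    simp
    module
  | succ k =>
    have h : (densityModule 𝕜 c l m).lower (lift 𝕜 c) (partialX 𝕜 c ^ (k + 1)) =
        (k + 1 : 𝕜) • delta 𝕜 c k := by
      rw [partialX_pow, map_smul, mul_add, mul_one, lower_pow_even, delta_eq_pow, pow_succ]
      module
    rw [h, delta, Nat.add_sub_cancel]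
    push_cast
    module

theorem h_mem_cocycles : h 𝕜 c ∈ (densityModule 𝕜 c l l).cocycles 1 := by
  have hs : signMap 𝕜 c 1 = 1 := signMap_one
  have hA : (densityModule 𝕜 c l l).twist .A 1 = 0 := by simpa using twist_A_pow (c := c) 0
  have hB : (densityModule 𝕜 c l l).twist .B 1 = 0 := by
    rw [twist_B, hs, mul_one, one_mul, sub_self]
  have hθ := twist_A_θ_mul (l := l) (m := l) (1 : DiffOp 𝕜 c)
  have hx := twist_A_x_mul (l := l) (m := l) (1 : DiffOp 𝕜 c)
  have hθB := twist_B_θ_mul (l := l) (m := l) (1 : DiffOp 𝕜 c)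
  rw [mul_one, hA, hs, mul_zero, add_zero] at hθ hx
  rw [mul_one, hB, hs, mul_zero, add_zero, mul_one] at hθB
  refine OspModule.mem_cocycles_one _ (toList_cochainOne _ _) (toList_cochainOne _ _) ?_ ?_ ?_ ?_
  · rw [h_H, map_neg, hA, neg_zero]
  · rw [h_B, h_H, map_smul, hθ]
  · rw [h_Y, h_B, map_smul, hx, mul_one]
  · rw [h_B, h_Y, map_smul, hθB]

theorem f_mem_cocycles {k : ℕ} (hl : l = -k / 2) (hm : m = (k + 1) / 2) :
    f 𝕜 c k ∈ (densityModule 𝕜 c l m).cocycles 1 := by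
  refine OspModule.mem_cocycles_one _ (toList_cochainOne _ _) (toList_cochainOne _ _) ?_ ?_ ?_ ?_
  · rw [f_H, twist_A_delta]
  · rw [f_B, f_H, map_smul, twist_A_θ_mul, twist_A_delta, signMap_delta]
    simp
  · rw [f_Y, f_B, map_smul, twist_A_x_mul, twist_A_delta, signMap_delta]
    simp
  · rw [f_B, f_Y, map_smul, twist_B_θ_mul, twist_B_delta hl hm, signMap_delta]
    simp

theorem fTilde_mem_cocycles {k : ℕ} (hl : l = -k / 2) (hm : m = (k + 1) / 2) :
    fTilde 𝕜 c k ∈ (densityModule 𝕜 c l m).cocycles 1 := by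
  refine OspModule.mem_cocycles_one _ (toList_cochainOne _ _) (toList_cochainOne _ _) ?_ ?_ ?_ ?_
  · rw [fTilde_H, map_zero]
  · rw [fTilde_B, fTilde_H, map_smul, twist_A_partialX_pow, smul_zero]
  · rw [fTilde_Y hl hm, fTilde_B, OspModule.twist_A_B]
    simp only [map_smul, twist_A_partialX_pow, twist_H_partialX_pow hl hm, smul_zero, map_zero]
    module
  · rw [fTilde_B, fTilde_Y hl hm]

/-- This value is the obstruction class of the cup product: `∂_x^k` spans the cokernel of `lower` at
the special weights. -/
theorem cup_H_B (k : ℕ) :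
    toList (cup (f 𝕜 c k) (h 𝕜 c)) [.H, .B] = (-2 : 𝕜) • partialX 𝕜 c ^ k := by
  rw [toList_cup, f_H, f_B, h_H, h_B, mul_smul_comm, delta_mul_θ, koszul]
  simp only [OspBasis.parity, pow_zero, mul_neg, mul_one]
  module

theorem cup_B_B (k : ℕ) : toList (cup (f 𝕜 c k) (h 𝕜 c)) [.B, .B] =
    (8 : 𝕜) • (θ 𝕜 c * partialX 𝕜 c ^ k) := by
  rw [toList_cup, f_B, h_B, mul_smul_comm, smul_mul_assoc, mul_assoc, delta_mul_θ, mul_sub,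
    ← mul_assoc (θ 𝕜 c) (θ 𝕜 c), θ_mul_θ, koszul]
  simp only [OspBasis.parity, mul_one, pow_one, zero_mul, sub_zero]
  module

theorem cup_H_Y (k : ℕ) : toList (cup (f 𝕜 c k) (h 𝕜 c)) [.H, .Y] =
    (2 : 𝕜) • (x 𝕜 c * delta 𝕜 c k - delta 𝕜 c k * x 𝕜 c) := by
  rw [toList_cup, f_H, f_Y, h_H, h_Y, mul_smul_comm, koszul]
  simp only [OspBasis.parity, zero_mul, pow_zero, mul_neg, mul_one]
  module

theorem cup_Y_B (k : ℕ) : toList (cup (f 𝕜 c k) (h 𝕜 c)) [.Y, .B] =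
    (-4 : 𝕜) • (x 𝕜 c * (delta 𝕜 c k * θ 𝕜 c) + θ 𝕜 c * (delta 𝕜 c k * x 𝕜 c)) := by
  rw [toList_cup, f_Y, f_B, h_Y, h_B, mul_smul_comm, mul_smul_comm, koszul, smul_mul_assoc,
    smul_mul_assoc, mul_assoc, mul_assoc]
  simp only [OspBasis.parity, zero_mul, pow_zero]
  module

theorem contract_A_cup (k : ℕ) : contract 𝕜 .A (toList (cup (f 𝕜 c k) (h 𝕜 c))) = 0 := by
  have hfA : toList (f 𝕜 c k) [.A] = 0 := toList_cochainOne _ _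
  have hhA : toList (h 𝕜 c) [.A] = 0 := toList_cochainOne _ _
  funext l
  match l with
  | [] => exact toList_of_length_ne (cup (f 𝕜 c k) (h 𝕜 c)) (l := [.A]) (by simp)
  | [b] =>
    refine (toList_cup _ _ .A b).trans ?_
    rw [hfA, hhA, zero_mul, mul_zero, smul_zero, sub_zero]
    rfl
  | b :: b' :: l =>
    exact toList_of_length_ne (cup (f 𝕜 c k) (h 𝕜 c)) (l := .A :: b :: b' :: l) (by simp)

theorem twist_A_delta_mul_x (k : ℕ) :
    (densityModule 𝕜 c l m).twist .A (delta 𝕜 c k * x 𝕜 c) = delta 𝕜 c k * θ 𝕜 c := by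
  have h := twist_A_delta (𝕜 := 𝕜) (c := c) (l := l) (m := m) k
  rw [twist_A, signMap_delta, sub_eq_zero] at h
  rw [twist_A, signMap_mul, signMap_x, signMap_delta, ← mul_assoc, h, mul_assoc, etaOp_mul_x]
  noncomm_ring

theorem cup_mem_cocycles {k : ℕ} (hl : l = -k / 2) (hm : m = (k + 1) / 2) :
    cup (f 𝕜 c k) (h 𝕜 c) ∈ (densityModule 𝕜 c l m).cocycles 2 := by
  have hfX : toList (f 𝕜 c k) [.X] = 0 := toList_cochainOne _ _
  have hhX : toList (h 𝕜 c) [.X] = 0 := toList_cochainOne _ _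
  have hσ : signMap 𝕜 c (delta 𝕜 c k * θ 𝕜 c) = delta 𝕜 c k * θ 𝕜 c := by
    rw [signMap_mul, signMap_delta, signMap_θ, neg_mul_neg]
  have hA : (densityModule 𝕜 c l m).twist .A (delta 𝕜 c k * θ 𝕜 c) = -delta 𝕜 c k := by
    rw [delta_mul_θ, map_sub, twist_A_partialX_pow, twist_A_θ_mul, twist_A_delta, signMap_delta]
    simp
  have hθθ : θ 𝕜 c * (delta 𝕜 c k * θ 𝕜 c) = θ 𝕜 c * partialX 𝕜 c ^ k := by
    rw [delta_mul_θ, mul_sub, ← mul_assoc (θ 𝕜 c) (θ 𝕜 c), θ_mul_θ, zero_mul, sub_zero]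
  refine OspModule.mem_cocycles_two _ (isAlt_cup _ _)
    (fun b => congrFun (contract_A_cup k) [b]) (fun b => ?_) ?_ ?_ ?_ ?_ ?_
  · rw [toList_cup, hfX, hhX, zero_mul, mul_zero, smul_zero, sub_zero]
  · rw [cup_H_B, map_smul, twist_A_partialX_pow, smul_zero]
  · rw [cup_B_B, cup_H_B, map_smul, twist_A_θ_mul, twist_A_partialX_pow, signMap_partialX_pow,
      mul_zero]
    module
  · rw [cup_H_Y, cup_Y_B, cup_B_B, map_smul, map_add, twist_A_x_mul, twist_A_θ_mul, hσ, hA,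
      twist_A_delta_mul_x, signMap_mul, signMap_delta, signMap_x, ← hθθ, mul_neg, neg_mul]
    module
  · rw [cup_H_Y, cup_H_B, map_smul, map_sub, twist_A_x_mul, twist_A_delta, twist_A_delta_mul_x,
      signMap_delta, delta_mul_θ, mul_zero, mul_neg]
    module
  -- The invariance of `delta` under `B` lets the field `B` pass from weight `m` on the left to
  -- weight `l` on the right, where it meets `θ`.
  · have hB := twist_B_delta (𝕜 := 𝕜) (c := c) hl hm
    rw [twist_B, signMap_delta, sub_eq_zero] at hB
    have hBθ : (densityModule 𝕜 c l m).twist .B (delta 𝕜 c k * θ 𝕜 c) =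
        delta 𝕜 c k * x 𝕜 c := by
      have h1 : field 𝕜 c m .B * (delta 𝕜 c k * θ 𝕜 c) =
          -(delta 𝕜 c k * field 𝕜 c l .B * θ 𝕜 c) := by
        rw [← hB]
        noncomm_ring
      rw [twist_B, hσ, h1, mul_assoc, field_B_mul_θ]
      noncomm_ring
    rw [cup_B_B, cup_Y_B, ← hθθ, map_smul, twist_B_θ_mul, hσ, hBθ]
    module

end DiffOp

end Cocycles

/-! ### Cohomology of the density modules. -/

section Results

variable {𝕜 : Type*} [RCLike 𝕜] {c : CoeffClass} {l m : ℝ}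

namespace DiffOp

theorem smul_cochainZero (r : 𝕜) (T : DiffOp 𝕜 c) :
    cochainZero (r • T) = r • cochainZero T := MultilinearMap.ext fun _ => rfl

theorem cochainZero_notMem_coboundaries {T : DiffOp 𝕜 c} (hT : T ≠ 0) :
    cochainZero T ∉ (densityModule 𝕜 c l m).coboundaries 0 := fun h =>
  hT (congrArg (fun f => f Fin.elim0) ((Submodule.mem_bot 𝕜).mp h))

theorem exists_cochainZero (f : MultilinearMap ℝ (fun _ : Fin 0 => Osp) (DiffOp 𝕜 c))
    (hf : f ∈ (densityModule 𝕜 c l m).cocycles 0) : ∃ T : DiffOp 𝕜 c, f = cochainZero T ∧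
      (densityModule 𝕜 c l m).twist .A T = 0 ∧ (densityModule 𝕜 c l m).twist .H T = 0 ∧
      (densityModule 𝕜 c l m).lower (lift 𝕜 c) T = 0 := by
  obtain ⟨T, hfT, hA, hB⟩ := OspModule.exists_cochainZero_eq _ hf
  have hH := OspModule.twist_H_eq_zero _ hA hB
  exact ⟨T, hfT, hA, hH, by rw [OspModule.lower_apply, hB, hH, map_zero, smul_zero, add_zero]⟩

theorem one_mem_cocycles : cochainZero 1 ∈ (densityModule 𝕜 c l l).cocycles 0 := by
  have hA : (densityModule 𝕜 c l l).twist .A 1 = 0 := by simpa using twist_A_pow (c := c) 0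
  refine OspModule.cochainZero_mem_cocycles _ hA ?_
  rw [twist_B, signMap_one, mul_one, one_mul, sub_self]

theorem span_one : Submodule.span 𝕜
    {(densityModule 𝕜 c l l).cls _ (one_mem_cocycles (𝕜 := 𝕜) (c := c))} = ⊤ := by
  refine OspModule.span_cls_eq_top _ _ fun f hf => ?_
  obtain ⟨T, rfl, hA, hH, -⟩ := exists_cochainZero f hf
  obtain ⟨a, rfl⟩ := exists_smul_one hA hH
  refine ⟨a, ?_⟩
  rw [smul_cochainZero, sub_self]
  exact zero_mem _

theorem delta_mem_cocycles {k : ℕ} (hl : l = -k / 2) (hm : m = (k + 1) / 2) :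
    cochainZero (delta 𝕜 c k) ∈ (densityModule 𝕜 c l m).cocycles 0 :=
  OspModule.cochainZero_mem_cocycles _ (twist_A_delta k) (twist_B_delta hl hm)

theorem span_delta {k : ℕ} (hl : l = -k / 2) (hm : m = (k + 1) / 2) : Submodule.span 𝕜
    {(densityModule 𝕜 c l m).cls _ (delta_mem_cocycles (𝕜 := 𝕜) (c := c) hl hm)} = ⊤ := by
  refine OspModule.span_cls_eq_top _ _ fun f hf => ?_
  obtain ⟨T, rfl, hA, hH, -⟩ := exists_cochainZero f hf
  obtain ⟨a, rfl⟩ := exists_smul_delta hl hm hA hH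
  refine ⟨a, ?_⟩
  rw [smul_cochainZero, sub_self]
  exact zero_mem _

theorem mem_coboundaries_zero (hlm : l ≠ m) (h : ¬ ∃ k : ℕ, l = -k / 2 ∧ m = (k + 1) / 2)
    (f : MultilinearMap ℝ (fun _ : Fin 0 => Osp) (DiffOp 𝕜 c))
    (hf : f ∈ (densityModule 𝕜 c l m).cocycles 0) :
    f ∈ (densityModule 𝕜 c l m).coboundaries 0 := by
  obtain ⟨T, rfl, hA, hH, hlow⟩ := exists_cochainZero f hf
  rw [eq_zero_of_lower_eq_zero h hlm hA hH hlow]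
  exact zero_mem _

theorem span_h : Submodule.span 𝕜
    {(densityModule 𝕜 c l l).cls _ (h_mem_cocycles (𝕜 := 𝕜) (c := c))} = ⊤ := by
  refine OspModule.span_cls_eq_top _ _ fun f hf => ?_
  obtain ⟨g, hg, hfg, hgA, q, p, hq, hp, hHq, -, hHp, hgB⟩ :=
    isLift.exists_normal_form twist_A_surjective (isSplit 0) (isSplit (1 / 2)) hf
  obtain ⟨a, rfl⟩ := exists_smul_one hq hHq
  -- The normal form has `q = a` and `p = 0`, hence `g(B) = 2aθ`, whereas `h(B) = -2θ`.
  refine ⟨-a, ?_⟩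
  rwa [OspModule.relative_cocycle_ext _ hg (Submodule.smul_mem _ (-a) h_mem_cocycles) hgA
    (by rw [toList_smul, map_smul, contract_A_h, smul_zero])] at hfg
  rw [hgB, eq_zero_of_weight hp hHp, toList_smul, Pi.smul_apply, h_B, map_smul, lift_apply,
    signMap_one, mul_one]
  module

/-- A primitive `w` would give `H w = -1`, a nonzero element of both the image and the kernel of `H`
on the kernel of `A`. -/
theorem h_notMem_coboundaries : h 𝕜 c ∉ (densityModule 𝕜 c l l).coboundaries 1 := fun hh => by
  obtain ⟨w, hw⟩ := OspModule.exists_of_mem_coboundaries_one _ hh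
  have hA : (densityModule 𝕜 c l l).twist .A w = 0 := by
    rw [← hw]
    exact toList_cochainOne _ _
  have hH := hw .H
  rw [h_H] at hH
  have h1 : (densityModule 𝕜 c l l).twist .H 1 = 0 := by
    rw [twist_H, mul_one, one_mul, sub_self]
  have h0 := (isSplit 0).eq_zero w hA (by
    rw [zero_smul, zero_smul, add_zero, add_zero, ← hH, map_neg, h1, neg_zero])
  rw [zero_smul, add_zero, ← hH, neg_eq_zero, ← pow_zero (etaBarOp 𝕜 c)] at h0
  exact pow_ne_zero 0 h0

theorem span_f {k : ℕ} (hl : l = -k / 2) (hm : m = (k + 1) / 2) : Submodule.span 𝕜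
    {(densityModule 𝕜 c l m).cls _ (f_mem_cocycles (𝕜 := 𝕜) (c := c) hl hm),
      (densityModule 𝕜 c l m).cls _ (fTilde_mem_cocycles (𝕜 := 𝕜) (c := c) hl hm)} = ⊤ := by
  refine OspModule.span_cls_pair_eq_top _ _ _ fun f' hf => ?_
  obtain ⟨g, hg, hfg, hgA, q, p, hq, hp, hHq, -, hHp, hgB⟩ :=
    isLift.exists_normal_form twist_A_surjective (isSplit 0) (isSplit (1 / 2)) hf
  obtain ⟨a, rfl⟩ := exists_smul_delta hl hm hq hHq
  obtain ⟨b, rfl⟩ := exists_smul_partialX_pow hl hm hp hHp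
  -- Read off from the values on `B`: the term `-2τq` with `q = a • delta` is `a` times that of
  -- `f_k`, and `f̃_k(B) = -2∂_x^k`.
  refine ⟨a, -b / 2, ?_⟩
  rwa [OspModule.relative_cocycle_ext _ hg (Submodule.add_mem _
    (Submodule.smul_mem _ a (f_mem_cocycles hl hm))
    (Submodule.smul_mem _ (-b / 2) (fTilde_mem_cocycles hl hm))) hgA
    (by rw [toList_add, toList_smul, toList_smul, map_add, map_smul, map_smul, contract_A_f,
      contract_A_fTilde, smul_zero, smul_zero, add_zero])] at hfg
  rw [hgB, toList_add, toList_smul, toList_smul, Pi.add_apply, Pi.smul_apply, Pi.smul_apply, f_B,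
    fTilde_B, map_smul, lift_apply, signMap_delta, mul_neg]
  module

/-- The value on `H` would lie in both the kernel and the image of `H`, so `r = 0` and the primitive
is a multiple of `delta`. That is killed by `B`, whence `s = 0`. -/
theorem eq_zero_of_mem_coboundaries {k : ℕ} (hl : l = -k / 2) (hm : m = (k + 1) / 2) (r s : 𝕜)
    (h : r • f 𝕜 c k + s • fTilde 𝕜 c k ∈ (densityModule 𝕜 c l m).coboundaries 1) :
    r = 0 ∧ s = 0 := by
  obtain ⟨w, hw⟩ := OspModule.exists_of_mem_coboundaries_one _ h
  simp only [toList_add, toList_smul, Pi.add_apply, Pi.smul_apply] at hw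
  have hA : (densityModule 𝕜 c l m).twist .A w = 0 := by
    rw [← hw, show toList (f 𝕜 c k) [.A] = 0 from toList_cochainOne _ _,
      show toList (fTilde 𝕜 c k) [.A] = 0 from toList_cochainOne _ _, smul_zero, smul_zero,
      add_zero]
  have hH := hw .H
  rw [f_H, fTilde_H, smul_zero, add_zero] at hH
  have hH0 := (isSplit 0).eq_zero w hA (by
    rw [zero_smul, zero_smul, add_zero, add_zero, ← hH, map_smul, twist_H_delta hl hm, smul_zero])
  rw [zero_smul, add_zero] at hH0
  rw [hH0] at hH
  have hr := (smul_eq_zero.mp hH).resolve_right (delta_ne_zero k)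
  obtain ⟨a, rfl⟩ := exists_smul_delta hl hm hA hH0
  have hB := hw .B
  rw [hr, zero_smul, zero_add, map_smul, twist_B_delta hl hm, smul_zero, fTilde_B, smul_smul,
    smul_eq_zero] at hB
  exact ⟨hr, (mul_eq_zero.mp (hB.resolve_right (partialX_pow_ne_zero k))).resolve_right (by simp)⟩

theorem mem_coboundaries_one (hlm : l ≠ m) (h : ¬ ∃ k : ℕ, l = -k / 2 ∧ m = (k + 1) / 2)
    (f : MultilinearMap ℝ (fun _ : Fin 1 => Osp) (DiffOp 𝕜 c))
    (hf : f ∈ (densityModule 𝕜 c l m).cocycles 1) :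
    f ∈ (densityModule 𝕜 c l m).coboundaries 1 := by
  obtain ⟨g, hg, hfg, hgA, q, p, hq, hp, hHq, hlq, hHp, hgB⟩ :=
    isLift.exists_normal_form twist_A_surjective (isSplit 0) (isSplit (1 / 2)) hf
  obtain ⟨w, hw, hHw, rfl⟩ := exists_lower_eq h hp hHp
  rw [eq_zero_of_lower_eq_zero h hlm hq hHq hlq, map_zero, smul_zero, sub_zero] at hgB
  have hg' := OspModule.mem_coboundaries_one _ hg hgA hw (by
    rw [hgB, OspModule.twist_B_eq _ (lift 𝕜 c), hHw, map_zero, smul_zero, sub_zero])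
  simpa using Submodule.add_mem _ hfg hg'

theorem mem_coboundaries_two (h : ¬ ∃ k : ℕ, l = -k / 2 ∧ m = (k + 1) / 2)
    (f : MultilinearMap ℝ (fun _ : Fin 2 => Osp) (DiffOp 𝕜 c))
    (hf : f ∈ (densityModule 𝕜 c l m).cocycles 2) :
    f ∈ (densityModule 𝕜 c l m).coboundaries 2 := by
  obtain ⟨g, hg, hfg, hgA⟩ := OspModule.exists_relative _ twist_A_surjective hf
  obtain ⟨hgv, hgd⟩ := (OspModule.mem_cocycles_iff _ g).mp hg
  obtain ⟨hgL, -⟩ := OspModule.relative_of_closed _ hgd hgA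
  obtain ⟨u, y, hu, hy, hHu, hq⟩ :=
    (isSplit (1 / 2)).exists_eq_add _ (OspModule.twist_A_H_B_eq _ hgv hgA hgL)
  -- Away from the special weights the part of the obstruction in `ker (H + 1/2)` is itself a value
  -- of `lower`, so it too is removed by a coboundary.
  obtain ⟨w, hw, -, rfl⟩ := exists_lower_eq h hu hHu
  have hg' := isLift.mem_coboundaries_two twist_A_surjective hg hgA hy
    (q := -w) (by rw [map_neg, hw, neg_zero]) (by rw [hq, map_neg]; abel)
  simpa using Submodule.add_mem _ hfg hg'

theorem span_cup {k : ℕ} (hl : l = -k / 2) (hm : m = (k + 1) / 2) : Submodule.span 𝕜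
    {(densityModule 𝕜 c l m).cls _ (cup_mem_cocycles (𝕜 := 𝕜) (c := c) hl hm)} = ⊤ := by
  refine OspModule.span_cls_eq_top _ _ fun f' hf => ?_
  obtain ⟨g, hg, hfg, hgA⟩ := OspModule.exists_relative _ twist_A_surjective hf
  obtain ⟨hgv, hgd⟩ := (OspModule.mem_cocycles_iff _ g).mp hg
  obtain ⟨hgL, -⟩ := OspModule.relative_of_closed _ hgd hgA
  obtain ⟨u, y, hu, hy, hHu, hq⟩ :=
    (isSplit (1 / 2)).exists_eq_add _ (OspModule.twist_A_H_B_eq _ hgv hgA hgL)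
  obtain ⟨a, rfl⟩ := exists_smul_partialX_pow hl hm hu hHu
  -- Chosen so that, by `cup_H_B`, the multiple of `Ω_k` cancels the component `a • ∂_x^k` of `g(H,
  -- B)`.
  refine ⟨-a / 2, ?_⟩
  have hg' := isLift.mem_coboundaries_two twist_A_surjective
    (Submodule.sub_mem _ hg (Submodule.smul_mem _ (-a / 2) (cup_mem_cocycles hl hm)))
    (by rw [toList_sub, toList_smul, map_sub, map_smul, hgA, contract_A_cup, smul_zero, sub_zero])
    hy (q := 0) (map_zero _) (by
      rw [toList_sub, toList_smul, Pi.sub_apply, Pi.smul_apply, hq, cup_H_B, map_zero]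
      module)
  have h := Submodule.add_mem _ hfg hg'
  rwa [← add_sub_assoc, sub_add_cancel] at h

/-- Since `lower` kills `delta`, splitting `q` would place `-2∂_x^k` in the image of `H + 1/2` on
the kernel of `A`. It also lies in the kernel of `H + 1/2`, so the splitting would make it zero. -/
theorem cup_notMem_coboundaries {k : ℕ} (hl : l = -k / 2) (hm : m = (k + 1) / 2) :
    cup (f 𝕜 c k) (h 𝕜 c) ∉ (densityModule 𝕜 c l m).coboundaries 2 := fun hc => by
  obtain ⟨y, q, hy, hq, hyq⟩ :=
    isLift.exists_of_mem_coboundaries_two twist_A_surjective hc (contract_A_cup k)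
  obtain ⟨u, w, hu, hw, hHu, rfl⟩ := (isSplit 0).exists_eq_add _ hq
  rw [zero_smul, add_zero] at hHu
  obtain ⟨a, rfl⟩ := exists_smul_delta hl hm hu hHu
  have hlow := isLift.twist_H_lower hw
  rw [zero_smul, add_zero, map_add, map_smul, lower_delta hl, smul_zero, zero_add, cup_H_B] at hyq
  have hyw : (densityModule 𝕜 c l m).twist .H
      (y - (densityModule 𝕜 c l m).lower (lift 𝕜 c) w) +
      (1 / 2 : 𝕜) • (y - (densityModule 𝕜 c l m).lower (lift 𝕜 c) w) =
      (-2 : 𝕜) • partialX 𝕜 c ^ k := by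
    rw [hyq, map_sub, hlow]
    module
  have h0 := (isSplit (1 / 2)).eq_zero (y - (densityModule 𝕜 c l m).lower (lift 𝕜 c) w)
    (by rw [map_sub, hy, isLift.twist_A_lower hw, sub_zero])
    (by rw [hyw, map_smul, twist_H_partialX_pow hl hm]; module)
  rw [hyw, smul_eq_zero] at h0
  exact h0.elim (by simp) (partialX_pow_ne_zero k)

end DiffOp

end Results

end OspCohomology

end

/-! ### Assembly of the theorem. -/

open OspCohomology in
theorem mainTheorem3 (𝕜 : Type*) [RCLike 𝕜] (c : CoeffClass) (l m : ℝ) :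
    -- `H⁰`
    ((l = m → Module.rank 𝕜 ((densityModule 𝕜 c l m).cohomology 0) = 1) ∧
      (∀ k : ℕ, l = -k / 2 → m = (k + 1) / 2 →
        Module.rank 𝕜 ((densityModule 𝕜 c l m).cohomology 0) = 1) ∧
      (l ≠ m → (¬ ∃ k : ℕ, l = -k / 2 ∧ m = (k + 1) / 2) →
        Module.rank 𝕜 ((densityModule 𝕜 c l m).cohomology 0) = 0)) ∧
    -- `H¹`
    ((l = m → Module.rank 𝕜 ((densityModule 𝕜 c l m).cohomology 1) = 1) ∧
      (∀ k : ℕ, l = -k / 2 → m = (k + 1) / 2 →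
        Module.rank 𝕜 ((densityModule 𝕜 c l m).cohomology 1) = 2) ∧
      (l ≠ m → (¬ ∃ k : ℕ, l = -k / 2 ∧ m = (k + 1) / 2) →
        Module.rank 𝕜 ((densityModule 𝕜 c l m).cohomology 1) = 0)) ∧
    -- `H²`
    ((∀ k : ℕ, l = -k / 2 → m = (k + 1) / 2 →
        Module.rank 𝕜 ((densityModule 𝕜 c l m).cohomology 2) = 1) ∧
      ((¬ ∃ k : ℕ, l = -k / 2 ∧ m = (k + 1) / 2) →
        Module.rank 𝕜 ((densityModule 𝕜 c l m).cohomology 2) = 0)) ∧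
    -- `Hⁿ` for `n > 2`
    (∀ n : ℕ, 2 < n → Module.rank 𝕜 ((densityModule 𝕜 c l m).cohomology n) = 0) ∧
    -- explicit bases
    (l = m →
      (∃ h₀ : cochainZero 1 ∈ (densityModule 𝕜 c l m).cocycles 0,
        Submodule.span 𝕜 {(densityModule 𝕜 c l m).cls _ h₀} = ⊤) ∧
      IsReduced (DiffOp.h 𝕜 c) ∧
      (∃ h₁ : DiffOp.h 𝕜 c ∈ (densityModule 𝕜 c l m).cocycles 1,
        Submodule.span 𝕜 {(densityModule 𝕜 c l m).cls _ h₁} = ⊤)) ∧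
    (∀ k : ℕ, l = -k / 2 → m = (k + 1) / 2 →
      (∃ h₀ : cochainZero (DiffOp.delta 𝕜 c k) ∈ (densityModule 𝕜 c l m).cocycles 0,
        Submodule.span 𝕜 {(densityModule 𝕜 c l m).cls _ h₀} = ⊤) ∧
      IsReduced (DiffOp.f 𝕜 c k) ∧ IsReduced (DiffOp.fTilde 𝕜 c k) ∧
      (∃ (h₁ : DiffOp.f 𝕜 c k ∈ (densityModule 𝕜 c l m).cocycles 1)
          (h₁' : DiffOp.fTilde 𝕜 c k ∈ (densityModule 𝕜 c l m).cocycles 1),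
        Submodule.span 𝕜 {(densityModule 𝕜 c l m).cls _ h₁,
          (densityModule 𝕜 c l m).cls _ h₁'} = ⊤) ∧
      IsReduced (DiffOp.cup (DiffOp.f 𝕜 c k) (DiffOp.h 𝕜 c)) ∧
      (∃ h₂ : DiffOp.cup (DiffOp.f 𝕜 c k) (DiffOp.h 𝕜 c) ∈ (densityModule 𝕜 c l m).cocycles 2,
        Submodule.span 𝕜 {(densityModule 𝕜 c l m).cls _ h₂} = ⊤)) := by
  refine ⟨⟨?_, fun k hl hm => ?_, fun hlm h => ?_⟩, ⟨?_, fun k hl hm => ?_, fun hlm h => ?_⟩,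
    ⟨fun k hl hm => ?_, fun h => ?_⟩, fun n hn => ?_, ?_, fun k hl hm => ?_⟩
  · rintro rfl
    exact OspModule.rank_cohomology_eq_one _ _ DiffOp.span_one
      (DiffOp.cochainZero_notMem_coboundaries (by simpa using DiffOp.pow_ne_zero (𝕜 := 𝕜) 0))
  · exact OspModule.rank_cohomology_eq_one _ _ (DiffOp.span_delta hl hm)
      (DiffOp.cochainZero_notMem_coboundaries (DiffOp.delta_ne_zero k))
  · exact OspModule.rank_cohomology_eq_zero _ (DiffOp.mem_coboundaries_zero hlm h)
  · rintro rfl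
    exact OspModule.rank_cohomology_eq_one _ _ DiffOp.span_h DiffOp.h_notMem_coboundaries
  · exact OspModule.rank_cohomology_eq_two _ _ _ (DiffOp.span_f hl hm)
      (DiffOp.eq_zero_of_mem_coboundaries hl hm)
  · exact OspModule.rank_cohomology_eq_zero _ (DiffOp.mem_coboundaries_one hlm h)
  · exact OspModule.rank_cohomology_eq_one _ _ (DiffOp.span_cup hl hm)
      (DiffOp.cup_notMem_coboundaries hl hm)
  · exact OspModule.rank_cohomology_eq_zero _ (DiffOp.mem_coboundaries_two h)
  · obtain ⟨n, rfl⟩ := Nat.exists_eq_add_of_le' hn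
    exact OspModule.rank_cohomology_eq_zero _ fun f hf =>
      OspModule.mem_coboundaries_of_surjective _ DiffOp.twist_A_surjective hf
  · rintro rfl
    exact ⟨⟨_, DiffOp.span_one⟩, isReduced_of_contract DiffOp.contract_A_h, _, DiffOp.span_h⟩
  · exact ⟨⟨_, DiffOp.span_delta hl hm⟩, isReduced_of_contract (DiffOp.contract_A_f k),
      isReduced_of_contract (DiffOp.contract_A_fTilde k), ⟨_, _, DiffOp.span_f hl hm⟩,
      isReduced_of_contract (DiffOp.contract_A_cup k), _, DiffOp.span_cup hl hm⟩
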